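/- **Setting.** Fix a scale cutoff $\rho\in\mathbb N$, a slice ratio $M>1$ and a mass $m>0$. An *assigned graph* $(G,\mu)$ is a $\phi^4$ Feynman graph (every vertex carries four half-edges, some joined in pairs to internal edges, the others being external edges) with a scale $\mu(\ell)\in\{0,\dots,\rho\}$ on every internal edge $\ell$. Consider connected *biped-free* graphs: at least four external edges and no nontrivial subgraph with two external edges. A subgraph $g$ (a nonempty set of internal edges; its external edges are the other half-edges at its vertices) is a *high quadruped* if it is 1PI (connected, and still connected after cutting any one internal edge), has exactly four external edges, and all its internal scales exceed the scales of those of its external edges that are internal in $G$. For a family $\gamma$ of pairwise vertex-disjoint high quadrupeds, $G/\gamma$ is obtained by shrinking each member to a vertex. A *dangerous forest* is a set of high quadrupeds of $G$, any two nested or disjoint; for a forest $\mathcal F$, $g/\mathcal F$ denotes $g$ with the maximal elements of $\mathcal F$ strictly inside $g$ shrunk, and $G/\!/\mathcal F$ denotes $G$ with the maximal elements of $\mathcal F$ (possibly $G$ itself) shrunk. Let $\mathcal H$ be the free commutative real algebra on isomorphism classes of 1PI biped-free assigned graphs having an internal edge, with $\varepsilon(G)=0$ and $$\Delta G=G\otimes1+1\otimes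 G+\sum_{\gamma}\Big(\prod_{g\in\gamma}g\Big)\otimes G/\gamma ,$$ $\gamma$ running over nonempty families of disjoint high quadrupeds with $G\notin\gamma$. Let $S$ be the algebra morphism with $S(G)=-G-\sum_\gamma\prod_{g\in\gamma}S(g)\;G/\gamma$, and $\alpha*\beta=(\alpha\otimes\beta)\circ\Delta$ for characters (algebra morphisms $\mathcal H\to\mathbb R$). Let $\mathcal K_n$ be the span of isomorphism classes of connected biped-free assigned graphs with $n$ labelled external edges, with coaction $\underline\Delta\,G=\sum_{\gamma}\big(\prod_{g\in\gamma}g\big)\otimes G/\gamma$, $\gamma$ running over all families of disjoint high quadrupeds (including $\emptyset$, and $\{G\}$ if $G$ is a nontrivial graph with four external edges, in which case $G/G$ is a single vertex); a character acts on linear maps $f$ on $\mathcal K_n$ by $\alpha\cdot f=m\circ(\alpha\otimes f)\circ\underline\Delta$, where $m$ is scalar multiplication. With $C^0(x,y)=\int_1^\infty e^{-m^2\alpha-|x-y|^2/4\alpha}\frac{d\alpha}{\alpha^2}$ and $C^i(x,y)=\int_{M^{-2i}}^{M^{-2(i-1)}} e^{-m^2\alpha-|x-y|^2/4\alpha}\frac{d\alpha}{\alpha^2}$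 for $i\ge1$, the amplitude of $G\in\mathcal K_n$ is the functional on Schwartz functions on $(\mathbb R^4)^n$ $$A(G)[\varphi]=\int\prod_{v}dx_v\prod_{\ell}C^{\mu(\ell)}(x_{s(\ell)},x_{t(\ell)})\;\varphi(x_{v(1)},\dots,x_{v(n)}),$$ where $v(k)$ is the vertex carrying the external edge $k$. The number $\tau A(G)$ is the integral of $\prod_\ell C^{\mu(\ell)}$ over all vertex positions but that of one vertex carrying an external edge; $\tau A$ is extended multiplicatively to $\mathcal H$. The useful counterterms are the multiplicative map $C_U$ with $$C_U(G)=-\tau A(G)-\sum_\gamma\tau A(G/\gamma)\prod_{g\in\gamma}C_U(g)$$ ($\gamma$ as in $\Delta$), and the usefully renormalized amplitudes are given by the multiscale forest formula $$A_{UR}(G)=\sum_{\mathcal F\ \text{dangerous forest}}\ \prod_{g\in\mathcal F}\big(-\tau A(g/\mathcal F)\big)\;A(G/\!/\mathcal F).$$ **Proposition.** 1. The integrals defining $A(G)[\varphi]$ and $\tau A(G)$ converge absolutely, $A(G)$ is a tempered distribution, and $\tau A(G)$ depends neither on the external edge kept nor on the position of its vertex; $A$, $\tau A$ and $C_U$ depend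 only on isomorphism classes. In particular $\tau A$ is a well-defined character of $\mathcal H$. 2. $S$ is the antipode, $m\circ(S\otimes\mathrm{id})\circ\Delta=u\circ\varepsilon=m\circ(\mathrm{id}\otimes S)\circ\Delta$ (with $m$ the product and $u$ the unit of $\mathcal H$), and for every generator $G$ $$S(G)=\sum_{\mathcal F}\big(-G/\!/\mathcal F\big)\prod_{g\in\mathcal F}\big(-g/\mathcal F\big),$$ the sum being over dangerous forests $\mathcal F$ of proper subgraphs of $G$ (equivalently, over the forests $\mathcal F\cup\{G\}$). 3. $C_U$ is the convolution inverse of $\tau A$ (it is the unique character $\beta$ with $\beta*\tau A=\varepsilon$, and the unique one with $\tau A*\beta=\varepsilon$), and $C_U=(\tau A)^{-1*}=(\tau A)\circ S$. 4. For every $n$, $A_{UR}=C_U\cdot A$ as linear maps on $\mathcal K_n$. -/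

import Mathlib

open scoped TensorProduct SchwartzMap

noncomputable section

namespace Multiscale

/-- An assigned `φ⁴` graph with scales in `{0, …, ρ}`, given by its half-edges: `vert h` is the
vertex carrying `h` (each vertex carries exactly four), and the involution `σ` glues half-edges to
internal edges `{h, σ h}`; its fixed points are the external edges. `scale` is the scale of the
internal edge containing `h` (its value at an external edge is never used). -/
structure AGraph (ρ : ℕ) where
  V : Type
  H : Type
  [finV : Fintype V]
  [finH : Fintype H]
  vert : H → V
  σ : H → H
  σ_σ : ∀ h, σ (σ h) = h
  valence : ∀ v, Nat.card {h // vert h = v} = 4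
  scale : H → Fin (ρ + 1)
  scale_σ : ∀ h, scale (σ h) = scale h

attribute [instance] AGraph.finV AGraph.finH

namespace AGraph

open scoped Classical

variable {ρ : ℕ} (G : AGraph ρ)

/-- The half-edges of the internal edges. -/
def internal : Finset G.H := Finset.univ.filter fun h => G.σ h ≠ h

/-- The external edges. -/
def external : Finset G.H := Finset.univ.filter fun h => G.σ h = h

/-- A subgraph is given by its set of internal edges, i.e. by a set of internal half-edges that is
closed under `σ`. -/
def IsSub (γ : Finset G.H) : Prop := ∀ h ∈ γ, G.σ h ≠ h ∧ G.σ h ∈ γ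

/-- The vertices of a subgraph. -/
def verts (γ : Finset G.H) : Finset G.V := γ.image G.vert

/-- The external (half-)edges of a subgraph: attached to one of its vertices, not internal to it. -/
def legs (γ : Finset G.H) : Finset G.H :=
  Finset.univ.filter fun h => G.vert h ∈ G.verts γ ∧ h ∉ γ

/-- `v` and `w` are joined by a path of edges of `γ`. -/
def Joined (γ : Finset G.H) : G.V → G.V → Prop :=
  Relation.ReflTransGen fun v w => ∃ h ∈ γ, G.vert h = v ∧ G.vert (G.σ h) = w

/-- A nontrivial subgraph that is connected and stays so if any one of its edges is cut. -/
structure IsOnePI (γ : Finset G.H) : Prop where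
  sub : G.IsSub γ
  nonempty : γ.Nonempty
  connected : ∀ v ∈ G.verts γ, ∀ w ∈ G.verts γ, G.Joined γ v w
  cut : ∀ h ∈ γ, ∀ v ∈ G.verts γ, ∀ w ∈ G.verts γ, G.Joined (γ \ {h, G.σ h}) v w

/-- All internal scales exceed all external scales (external edges of `G` impose no condition:
they are below all scales). -/
def IsHigh (γ : Finset G.H) : Prop :=
  ∀ h ∈ γ, ∀ l ∈ G.legs γ, G.σ l ≠ l → G.scale l < G.scale h

/-- The connected divergent subgraphs of a biped-free graph: 1PI, high, four external edges. -/
structure IsHighQuad (γ : Finset G.H) : Prop where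
  onePI : G.IsOnePI γ
  high : G.IsHigh γ
  four : (G.legs γ).card = 4

/-- Connected, at least four external edges, no nontrivial subgraph with two external edges. -/
structure BipedFree : Prop where
  connected : ∀ v w, G.Joined G.internal v w
  four_le : 4 ≤ G.external.card
  noBiped : ∀ γ, G.IsSub γ → γ.Nonempty → (G.legs γ).card ≠ 2

/-- A family of pairwise disjoint high quadrupeds (the components of a high subgraph). -/
def IsDisjFam (𝓕 : Finset (Finset G.H)) : Prop :=
  (∀ g ∈ 𝓕, G.IsHighQuad g) ∧
    ∀ f ∈ 𝓕, ∀ g ∈ 𝓕, f ≠ g → Disjoint (G.verts f) (G.verts g)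

/-- A dangerous forest: high quadrupeds, any two of them nested or disjoint. -/
def IsForest (F : Finset (Finset G.H)) : Prop :=
  (∀ g ∈ F, G.IsHighQuad g) ∧
    ∀ f ∈ F, ∀ g ∈ F, f ⊆ g ∨ g ⊆ f ∨ Disjoint (G.verts f) (G.verts g)

variable {G}

/-- The maximal elements of `F`. -/
def tops (F : Finset (Finset G.H)) : Finset (Finset G.H) :=
  F.filter fun f => ∀ f' ∈ F, f ⊆ f' → f' = f

/-- The maximal ones among the elements of `F` strictly inside `g`. -/
def below (F : Finset (Finset G.H)) (g : Finset G.H) : Finset (Finset G.H) :=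
  tops (F.filter fun f => f ⊂ g)

theorem IsForest.tops {F : Finset (Finset G.H)} (hF : G.IsForest F) :
    G.IsDisjFam (AGraph.tops F) := by
  refine ⟨fun g hg => hF.1 g (Finset.mem_filter.1 hg).1, fun f hf g hg hne => ?_⟩
  obtain ⟨hf, hf'⟩ := Finset.mem_filter.1 hf
  obtain ⟨hg, hg'⟩ := Finset.mem_filter.1 hg
  rcases hF.2 f hf g hg with h | h | h
  · exact absurd (hf' g hg h).symm hne
  · exact absurd (hg' f hf h) hne
  · exact h

theorem IsForest.below {F : Finset (Finset G.H)} (hF : G.IsForest F) (g : Finset G.H) :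
    G.IsDisjFam (AGraph.below F g) :=
  IsForest.tops (F := F.filter fun f => f ⊂ g)
    ⟨fun f hf => hF.1 f (Finset.mem_filter.1 hf).1,
      fun f hf f' hf' => hF.2 f (Finset.mem_filter.1 hf).1 f' (Finset.mem_filter.1 hf').1⟩

theorem ssubset_of_mem_below {F : Finset (Finset G.H)} {g f : Finset G.H}
    (hf : f ∈ below F g) : f ⊂ g :=
  (Finset.mem_filter.1 (Finset.mem_filter.1 hf).1).2

theorem IsSub.subset_internal {γ : Finset G.H} (h : G.IsSub γ) : γ ⊆ G.internal :=
  fun k hk => by simpa [internal] using (h k hk).1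

theorem internal_isSub : G.IsSub G.internal := by
  intro h hh
  have : G.σ h ≠ h := by simpa [internal] using hh
  refine ⟨this, ?_⟩
  simp only [internal, Finset.mem_filter, Finset.mem_univ, true_and, G.σ_σ]
  exact this.symm

variable (G)

/-- A set of vertices together with internal edges between them. -/
structure Region where
  W : Finset G.V
  edges : Finset G.H
  sub : G.IsSub edges
  verts_sub : G.verts edges ⊆ W

variable {G}

/-- All of `G`. -/
def whole : G.Region where
  W := Finset.univ
  edges := G.internal
  sub := internal_isSub
  verts_sub := Finset.subset_univ _

/-- A subgraph `g` of `G`. -/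
def ofSub (g : Finset G.H) (hg : G.IsSub g) : G.Region where
  W := G.verts g
  edges := g
  sub := hg
  verts_sub := Finset.Subset.refl _

/-- Two vertices are identified if they are equal or lie in the same member of `𝓕`. -/
def shrinkSetoid (R : G.Region) (𝓕 : Finset (Finset G.H)) (h𝓕 : G.IsDisjFam 𝓕) :
    Setoid {v // v ∈ R.W} where
  r v w := v = w ∨ ∃ f ∈ 𝓕, v.1 ∈ G.verts f ∧ w.1 ∈ G.verts f
  iseqv := by
    refine ⟨fun v => Or.inl rfl, ?_, ?_⟩
    · rintro v w (h | ⟨f, hf, h1, h2⟩)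
      · exact Or.inl h.symm
      · exact Or.inr ⟨f, hf, h2, h1⟩
    · rintro u v w (rfl | ⟨f, hf, h1, h2⟩) (rfl | ⟨f', hf', h3, h4⟩)
      · exact Or.inl rfl
      · exact Or.inr ⟨f', hf', h3, h4⟩
      · exact Or.inr ⟨f, hf, h1, h2⟩
      · have : f = f' := by
          by_contra hne
          exact Finset.disjoint_left.1 (h𝓕.2 f hf f' hf' hne) h2 h3
        subst this
        exact Or.inr ⟨f, hf, h1, h4⟩

theorem vert_mem_verts {γ : Finset G.H} {h : G.H} (hh : h ∈ γ) : G.vert h ∈ G.verts γ :=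
  Finset.mem_image_of_mem _ hh

/-- The region `R` of `G`, regarded as a graph of its own (half-edges at vertices of `R` that do
not belong to the edges of `R` become external), in which every member of `𝓕` is shrunk to a
vertex. Remaining edges keep their scale. -/
def minor (R : G.Region) (𝓕 : Finset (Finset G.H)) (h𝓕 : G.IsDisjFam 𝓕)
    (hR : ∀ f ∈ 𝓕, f ⊆ R.edges) : AGraph ρ where
  V := Quotient (shrinkSetoid R 𝓕 h𝓕)
  H := {h // G.vert h ∈ R.W ∧ ∀ f ∈ 𝓕, h ∉ f}
  finV := Fintype.ofFinite _
  finH := Fintype.ofFinite _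
  vert h := Quotient.mk _ ⟨G.vert h.1, h.2.1⟩
  σ h := if hh : h.1 ∈ R.edges then
      ⟨G.σ h.1, R.verts_sub (vert_mem_verts (R.sub _ hh).2), fun f hf hmem =>
        h.2.2 f hf (by simpa [G.σ_σ] using ((h𝓕.1 f hf).onePI.sub _ hmem).2)⟩
    else h
  σ_σ h := by
    by_cases hh : h.1 ∈ R.edges
    · apply Subtype.ext
      simp [hh, (R.sub _ hh).2, G.σ_σ]
    · simp [hh]
  valence q := by
    induction q using Quotient.inductionOn with
    | h v =>
    obtain ⟨v, hv⟩ := v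
    by_cases hex : ∃ f ∈ 𝓕, v ∈ G.verts f
    · obtain ⟨f, hf, hvf⟩ := hex
      have huniq : ∀ f' ∈ 𝓕, ∀ w ∈ G.verts f, w ∈ G.verts f' → f' = f := by
        intro f' hf' w hw hw'
        by_contra hne
        exact Finset.disjoint_left.1 (h𝓕.2 f' hf' f hf hne) hw' hw
      have hcard : Nat.card {h // h ∈ G.legs f} = 4 := by
        rw [Nat.card_eq_fintype_card, Fintype.card_coe, (h𝓕.1 f hf).four]
      rw [← hcard]
      refine Nat.card_congr
        { toFun := fun h => ⟨h.1.1, ?_⟩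
          invFun := fun h => ⟨⟨h.1, ?_, ?_⟩, ?_⟩
          left_inv := fun h => rfl
          right_inv := fun h => rfl }
      · have h2 : (shrinkSetoid R 𝓕 h𝓕) ⟨G.vert h.1.1, h.1.2.1⟩ ⟨v, hv⟩ := Quotient.exact h.2
        have h3 : G.vert h.1.1 ∈ G.verts f := by
          rcases h2 with h2 | ⟨f', hf', h3, h4⟩
          · rw [Subtype.mk.injEq] at h2
            rwa [h2]
          · rwa [huniq f' hf' v hvf h4] at h3
        simp [legs, h3, h.1.2.2 f hf]
      · have h2 := h.2
        simp only [legs, Finset.mem_filter, Finset.mem_univ, true_and] at h2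
        obtain ⟨k, hk, hk2⟩ := Finset.mem_image.1 h2.1
        rw [← hk2]
        exact R.verts_sub (vert_mem_verts (hR f hf hk))
      · have h2 := h.2
        simp only [legs, Finset.mem_filter, Finset.mem_univ, true_and] at h2
        intro f' hf' hmem
        rw [huniq f' hf' _ h2.1 (vert_mem_verts hmem)] at hmem
        exact h2.2 hmem
      · have h2 := h.2
        simp only [legs, Finset.mem_filter, Finset.mem_univ, true_and] at h2
        exact Quotient.sound (Or.inr ⟨f, hf, h2.1, hvf⟩)
    · rw [← G.valence v]
      refine Nat.card_congr
        { toFun := fun h => ⟨h.1.1, ?_⟩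
          invFun := fun h => ⟨⟨h.1, ?_, ?_⟩, ?_⟩
          left_inv := fun h => rfl
          right_inv := fun h => rfl }
      · have h2 : (shrinkSetoid R 𝓕 h𝓕) ⟨G.vert h.1.1, h.1.2.1⟩ ⟨v, hv⟩ := Quotient.exact h.2
        rcases h2 with h2 | ⟨f', hf', h3, h4⟩
        · rwa [Subtype.mk.injEq] at h2
        · exact absurd ⟨f', hf', h4⟩ hex
      · rw [h.2]; exact hv
      · intro f hf hmem
        exact hex ⟨f, hf, h.2 ▸ vert_mem_verts hmem⟩
      · exact Quotient.sound (Or.inl (Subtype.ext h.2))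
  scale h := G.scale h.1
  scale_σ h := by
    by_cases hh : h.1 ∈ R.edges
    · simp [hh, G.scale_σ]
    · simp [hh]

section closure

variable {R : G.Region} {𝓕 : Finset (Finset G.H)} {h𝓕 : G.IsDisjFam 𝓕}
  {hR : ∀ f ∈ 𝓕, f ⊆ R.edges}

theorem IsDisjFam.uniq (h𝓕 : G.IsDisjFam 𝓕) {f f' : Finset G.H} (hf : f ∈ 𝓕) (hf' : f' ∈ 𝓕)
    {w : G.V} (hw : w ∈ G.verts f) (hw' : w ∈ G.verts f') : f = f' := by
  by_contra hne
  exact Finset.disjoint_left.1 (h𝓕.2 f hf f' hf' hne) hw hw'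

theorem minor_σ_of_mem (h : (minor R 𝓕 h𝓕 hR).H) (hh : h.1 ∈ R.edges) :
    ((minor R 𝓕 h𝓕 hR).σ h).1 = G.σ h.1 := by
  simp [minor, hh]

theorem minor_σ_of_notMem (h : (minor R 𝓕 h𝓕 hR).H) (hh : h.1 ∉ R.edges) :
    (minor R 𝓕 h𝓕 hR).σ h = h :=
  dif_neg hh

theorem minor_σ_eq_iff (h : (minor R 𝓕 h𝓕 hR).H) :
    (minor R 𝓕 h𝓕 hR).σ h = h ↔ h.1 ∉ R.edges := by
  refine ⟨fun h1 h2 => ?_, minor_σ_of_notMem h⟩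
  have h3 := minor_σ_of_mem h h2
  rw [h1] at h3
  exact (R.sub _ h2).1 h3.symm

theorem mem_internal_minor (h : (minor R 𝓕 h𝓕 hR).H) :
    h ∈ (minor R 𝓕 h𝓕 hR).internal ↔ h.1 ∈ R.edges := by
  simp only [internal, Finset.mem_filter, Finset.mem_univ, true_and, ne_eq, minor_σ_eq_iff, not_not]

theorem mem_external_minor (h : (minor R 𝓕 h𝓕 hR).H) :
    h ∈ (minor R 𝓕 h𝓕 hR).external ↔ h.1 ∉ R.edges := by
  simp only [external, Finset.mem_filter, Finset.mem_univ, true_and, minor_σ_eq_iff]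

theorem card_internal_minor_le : (minor R 𝓕 h𝓕 hR).internal.card ≤ R.edges.card :=
  Finset.card_le_card_of_injOn (fun h => h.1) (fun h hh => (mem_internal_minor h).1 hh)
    fun _ _ _ _ h => Subtype.ext h

theorem vert_eq_iff (h k : (minor R 𝓕 h𝓕 hR).H) :
    (minor R 𝓕 h𝓕 hR).vert h = (minor R 𝓕 h𝓕 hR).vert k ↔
      G.vert h.1 = G.vert k.1 ∨ ∃ f ∈ 𝓕, G.vert h.1 ∈ G.verts f ∧ G.vert k.1 ∈ G.verts f := by
  constructor
  · intro e
    have h2 : (shrinkSetoid R 𝓕 h𝓕) ⟨G.vert h.1, h.2.1⟩ ⟨G.vert k.1, k.2.1⟩ := Quotient.exact e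
    rcases h2 with h2 | h2
    · exact Or.inl (Subtype.mk.inj h2)
    · exact Or.inr h2
  · rintro (e | e)
    · exact Quotient.sound (Or.inl (Subtype.ext e))
    · exact Quotient.sound (Or.inr e)

/-- Paths in the region descend to the minor. -/
theorem joined_minor {γ : Finset G.H} (hγ : γ ⊆ R.edges) (γ' : Finset (minor R 𝓕 h𝓕 hR).H)
    (hγ' : ∀ h : (minor R 𝓕 h𝓕 hR).H, h.1 ∈ γ → h ∈ γ') {v w : G.V} (hv : v ∈ R.W)
    (hvw : G.Joined γ v w) :
    ∃ hw : w ∈ R.W, (minor R 𝓕 h𝓕 hR).Joined γ' (Quotient.mk _ ⟨v, hv⟩)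
      (Quotient.mk _ ⟨w, hw⟩) := by
  induction hvw with
  | refl => exact ⟨hv, Relation.ReflTransGen.refl⟩
  | tail _ hs ih =>
    obtain ⟨hu, ih⟩ := ih
    obtain ⟨h, hh, rfl, rfl⟩ := hs
    have hσ : G.σ h ∈ R.edges := (R.sub h (hγ hh)).2
    have hw : G.vert (G.σ h) ∈ R.W := R.verts_sub (vert_mem_verts hσ)
    refine ⟨hw, ?_⟩
    by_cases hex : ∃ f ∈ 𝓕, h ∈ f
    · obtain ⟨f, hf, hhf⟩ := hex
      have e : (Quotient.mk (shrinkSetoid R 𝓕 h𝓕) ⟨G.vert h, hu⟩) =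
          Quotient.mk _ ⟨G.vert (G.σ h), hw⟩ :=
        Quotient.sound (Or.inr ⟨f, hf, vert_mem_verts hhf,
          vert_mem_verts (((h𝓕.1 f hf).onePI.sub h hhf).2)⟩)
      exact e ▸ ih
    · push Not at hex
      let h' : (minor R 𝓕 h𝓕 hR).H := ⟨h, hu, hex⟩
      refine Relation.ReflTransGen.tail ih ⟨h', hγ' h' hh, rfl, ?_⟩
      refine congrArg (Quotient.mk (shrinkSetoid R 𝓕 h𝓕)) (Subtype.ext ?_)
      exact congrArg G.vert (minor_σ_of_mem h' (hγ hh))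

theorem minor_noBiped (hG : G.BipedFree) (δ' : Finset (minor R 𝓕 h𝓕 hR).H)
    (hsub : (minor R 𝓕 h𝓕 hR).IsSub δ') (hne : δ'.Nonempty) :
    ((minor R 𝓕 h𝓕 hR).legs δ').card ≠ 2 := by
  let T : Finset (Finset G.H) := 𝓕.filter fun f => ∃ k ∈ δ', G.vert k.1 ∈ G.verts f
  let δ : Finset G.H := δ'.image (fun h => h.1) ∪ T.biUnion id
  have hmem : ∀ h : G.H, h ∈ δ ↔ (∃ k ∈ δ', k.1 = h) ∨
      ∃ f ∈ 𝓕, (∃ k ∈ δ', G.vert k.1 ∈ G.verts f) ∧ h ∈ f := by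
    intro h
    simp only [δ, T, Finset.mem_union, Finset.mem_image, Finset.mem_biUnion, Finset.mem_filter, id]
    constructor
    · rintro (h1 | ⟨f, ⟨h1, h2⟩, h3⟩)
      · exact Or.inl h1
      · exact Or.inr ⟨f, h1, h2, h3⟩
    · rintro (h1 | ⟨f, h1, h2, h3⟩)
      · exact Or.inl h1
      · exact Or.inr ⟨f, ⟨h1, h2⟩, h3⟩
  have hedge : ∀ k ∈ δ', k.1 ∈ R.edges := fun k hk => by
    by_contra hk'
    exact (hsub k hk).1 (minor_σ_of_notMem k hk')
  have hδsub : G.IsSub δ := by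
    intro h hh
    rcases (hmem h).1 hh with ⟨k, hk, rfl⟩ | ⟨f, hf, hkf, hhf⟩
    · refine ⟨(R.sub _ (hedge k hk)).1, (hmem _).2 (Or.inl ⟨(minor R 𝓕 h𝓕 hR).σ k, (hsub k hk).2, ?_⟩)⟩
      exact minor_σ_of_mem k (hedge k hk)
    · have := (h𝓕.1 f hf).onePI.sub h hhf
      exact ⟨this.1, (hmem _).2 (Or.inr ⟨f, hf, hkf, this.2⟩)⟩
  have hδne : δ.Nonempty := by
    obtain ⟨k, hk⟩ := hne
    exact ⟨k.1, (hmem _).2 (Or.inl ⟨k, hk, rfl⟩)⟩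
  have hlegs : G.legs δ = ((minor R 𝓕 h𝓕 hR).legs δ').image (fun h => h.1) := by
    ext h
    simp only [legs, Finset.mem_image, Finset.mem_filter, Finset.mem_univ, true_and]
    constructor
    · rintro ⟨hv, hn⟩
      obtain ⟨k, hk, hkv⟩ := Finset.mem_image.1 hv
      rcases (hmem k).1 hk with ⟨k', hk', rfl⟩ | ⟨f, hf, ⟨k', hk', hkf⟩, hkf'⟩
      · have hW : G.vert h ∈ R.W := hkv ▸ k'.2.1
        have hnot : ∀ f ∈ 𝓕, h ∉ f := fun f hf hhf =>
          hn ((hmem h).2 (Or.inr ⟨f, hf, ⟨k', hk', hkv ▸ vert_mem_verts hhf⟩, hhf⟩))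
        refine ⟨⟨h, hW, hnot⟩, ⟨?_, ?_⟩, rfl⟩
        · exact Finset.mem_image.2 ⟨k', hk', (vert_eq_iff k' ⟨h, hW, hnot⟩).2 (Or.inl hkv)⟩
        · exact fun hh => hn ((hmem h).2 (Or.inl ⟨_, hh, rfl⟩))
      · have hvf : G.vert h ∈ G.verts f := hkv ▸ vert_mem_verts hkf'
        have hW : G.vert h ∈ R.W := hkv ▸ R.verts_sub (vert_mem_verts (hR f hf hkf'))
        have hnot : ∀ f' ∈ 𝓕, h ∉ f' := fun f' hf' hhf => by
          obtain rfl := h𝓕.uniq hf hf' hvf (vert_mem_verts hhf)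
          exact hn ((hmem h).2 (Or.inr ⟨f, hf, ⟨k', hk', hkf⟩, hhf⟩))
        refine ⟨⟨h, hW, hnot⟩, ⟨?_, ?_⟩, rfl⟩
        · exact Finset.mem_image.2
            ⟨k', hk', (vert_eq_iff k' ⟨h, hW, hnot⟩).2 (Or.inr ⟨f, hf, hkf, hvf⟩)⟩
        · exact fun hh => hn ((hmem h).2 (Or.inl ⟨_, hh, rfl⟩))
    · rintro ⟨h', ⟨hv, hn⟩, rfl⟩
      obtain ⟨k, hk, hkv⟩ := Finset.mem_image.1 hv
      refine ⟨?_, fun hh => ?_⟩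
      · rcases (vert_eq_iff k h').1 hkv with e | ⟨f, hf, h1, h2⟩
        · exact e ▸ vert_mem_verts ((hmem k.1).2 (Or.inl ⟨k, hk, rfl⟩))
        · obtain ⟨l, hl, hlv⟩ := Finset.mem_image.1 h2
          rw [← hlv]
          exact vert_mem_verts ((hmem l).2 (Or.inr ⟨f, hf, ⟨k, hk, h1⟩, hl⟩))
      · rcases (hmem _).1 hh with ⟨k', hk', e⟩ | ⟨f, hf, _, hhf⟩
        · exact hn (Subtype.ext e ▸ hk')
        · exact h'.2.2 f hf hhf
  have := hG.noBiped δ hδsub hδne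
  have hc := Finset.card_image_of_injective ((minor R 𝓕 h𝓕 hR).legs δ')
    (f := fun h : (minor R 𝓕 h𝓕 hR).H => (h.1 : G.H)) fun _ _ h => Subtype.ext h
  exact fun h => this ((congrArg Finset.card hlegs).trans (hc.trans h))

theorem minor_bipedFree (hG : G.BipedFree)
    (hconn : ∀ v ∈ R.W, ∀ w ∈ R.W, G.Joined R.edges v w)
    (hfour : 4 ≤ (Finset.univ.filter fun h => G.vert h ∈ R.W ∧ h ∉ R.edges).card) :
    (minor R 𝓕 h𝓕 hR).BipedFree where
  connected v w := by
    induction v using Quotient.inductionOn with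
    | h v =>
    induction w using Quotient.inductionOn with
    | h w =>
    exact (joined_minor (Finset.Subset.refl _) _ (fun h hh => (mem_internal_minor h).2 hh) v.2
      (hconn v.1 v.2 w.1 w.2)).2
  four_le := by
    refine hfour.trans ?_
    rw [← Finset.card_image_of_injective (minor R 𝓕 h𝓕 hR).external
      (Subtype.val_injective : Function.Injective fun h : (minor R 𝓕 h𝓕 hR).H => h.1)]
    refine Finset.card_le_card fun h hh => ?_
    simp only [Finset.mem_filter, Finset.mem_univ, true_and] at hh
    have hnot : ∀ f ∈ 𝓕, h ∉ f := fun f hf hhf => hh.2 (hR f hf hhf)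
    refine Finset.mem_image.2 ⟨⟨h, hh.1, hnot⟩, ?_, rfl⟩
    exact (mem_external_minor (h𝓕 := h𝓕) (hR := hR) ⟨h, hh.1, hnot⟩).2 hh.2
  noBiped := minor_noBiped hG

theorem minor_onePI
    (hcut : ∀ h ∈ R.edges, ∀ v ∈ R.W, ∀ w ∈ R.W, G.Joined (R.edges \ {h, G.σ h}) v w)
    (hconn : ∀ v ∈ R.W, ∀ w ∈ R.W, G.Joined R.edges v w)
    (hne : ∃ h ∈ R.edges, ∀ f ∈ 𝓕, h ∉ f) :
    (minor R 𝓕 h𝓕 hR).IsOnePI (minor R 𝓕 h𝓕 hR).internal where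
  sub := internal_isSub
  nonempty := by
    obtain ⟨h, hh, hn⟩ := hne
    exact ⟨⟨h, R.verts_sub (vert_mem_verts hh), hn⟩, (mem_internal_minor _).2 hh⟩
  connected v _ w _ := by
    induction v using Quotient.inductionOn with
    | h v =>
    induction w using Quotient.inductionOn with
    | h w =>
    exact (joined_minor (Finset.Subset.refl _) _ (fun h hh => (mem_internal_minor h).2 hh) v.2
      (hconn v.1 v.2 w.1 w.2)).2
  cut k hk v _ w _ := by
    induction v using Quotient.inductionOn with
    | h v =>
    induction w using Quotient.inductionOn with
    | h w =>
    have hk' := (mem_internal_minor k).1 hk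
    refine (joined_minor Finset.sdiff_subset _ (fun h hh => ?_) v.2
      (hcut k.1 hk' v.1 v.2 w.1 w.2)).2
    simp only [Finset.mem_sdiff, Finset.mem_insert, Finset.mem_singleton, not_or] at hh ⊢
    refine ⟨(mem_internal_minor h).2 hh.1, fun e => hh.2.1 (e ▸ rfl), fun e => hh.2.2 ?_⟩
    rw [e, minor_σ_of_mem k hk']

/-- Shrinking proper disjoint subgraphs of a connected subgraph leaves an edge. -/
theorem exists_notMem {g : Finset G.H} (hne : g.Nonempty)
    (hconn : ∀ v ∈ G.verts g, ∀ w ∈ G.verts g, G.Joined g v w) (h𝓕 : G.IsDisjFam 𝓕)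
    (hlt : ∀ f ∈ 𝓕, f ⊂ g) : ∃ h ∈ g, ∀ f ∈ 𝓕, h ∉ f := by
  by_contra hcon
  push Not at hcon
  obtain ⟨h₀, hh₀⟩ := hne
  obtain ⟨f, hf, hhf⟩ := hcon h₀ hh₀
  obtain ⟨k, hk, hkf⟩ := Finset.exists_of_ssubset (hlt f hf)
  have key : ∀ w, G.Joined g (G.vert h₀) w → w ∈ G.verts f := by
    intro w hw
    induction hw with
    | refl => exact vert_mem_verts hhf
    | tail _ hs ih =>
      obtain ⟨h, hh, rfl, rfl⟩ := hs
      obtain ⟨f', hf', hhf'⟩ := hcon h hh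
      obtain rfl := h𝓕.uniq hf hf' ih (vert_mem_verts hhf')
      exact vert_mem_verts (((h𝓕.1 f hf).onePI.sub h hhf').2)
  have hkv := key _ (hconn _ (vert_mem_verts hh₀) _ (vert_mem_verts hk))
  obtain ⟨f', hf', hkf'⟩ := hcon k hk
  obtain rfl := h𝓕.uniq hf hf' hkv (vert_mem_verts hkf')
  exact hkf hkf'

end closure

/-- Isomorphism of assigned graphs: external edges and scales of internal edges are respected. -/
structure Iso (G G' : AGraph ρ) where
  eV : G.V ≃ G'.V
  eH : G.H ≃ G'.H
  vert_eH : ∀ h, G'.vert (eH h) = eV (G.vert h)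
  σ_eH : ∀ h, G'.σ (eH h) = eH (G.σ h)
  scale_eH : ∀ h ∈ G.internal, G'.scale (eH h) = G.scale h

/-- The identity. -/
def Iso.refl (G : AGraph ρ) : Iso G G where
  eV := Equiv.refl _
  eH := Equiv.refl _
  vert_eH _ := rfl
  σ_eH _ := rfl
  scale_eH _ _ := rfl

theorem Iso.mem_internal {G G' : AGraph ρ} (e : Iso G G') (h : G.H) :
    e.eH h ∈ G'.internal ↔ h ∈ G.internal := by
  simp [internal, e.σ_eH]

/-- The inverse. -/
def Iso.symm {G G' : AGraph ρ} (e : Iso G G') : Iso G' G where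
  eV := e.eV.symm
  eH := e.eH.symm
  vert_eH h := by rw [Equiv.eq_symm_apply, ← e.vert_eH, Equiv.apply_symm_apply]
  σ_eH h := by rw [Equiv.eq_symm_apply, ← e.σ_eH, Equiv.apply_symm_apply]
  scale_eH h hh := by
    have := e.scale_eH (e.eH.symm h) ((e.mem_internal _).1 (by simpa using hh))
    rw [← this, Equiv.apply_symm_apply]

/-- The composite. -/
def Iso.trans {G G' G'' : AGraph ρ} (e : Iso G G') (e' : Iso G' G'') : Iso G G'' where
  eV := e.eV.trans e'.eV
  eH := e.eH.trans e'.eH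
  vert_eH h := by simp [e.vert_eH, e'.vert_eH]
  σ_eH h := by simp [e.σ_eH, e'.σ_eH]
  scale_eH h hh := by
    rw [Equiv.trans_apply, e'.scale_eH _ ((e.mem_internal h).2 hh), e.scale_eH h hh]

end AGraph

open AGraph
open scoped Classical

variable {ρ : ℕ}

/-- The connected graphs that generate the Hopf algebra: biped-free, 1PI, with an internal edge. -/
structure HGraph (ρ : ℕ) extends AGraph ρ where
  bipedFree : toAGraph.BipedFree
  onePI : toAGraph.IsOnePI toAGraph.internal

/-- A connected biped-free assigned graph with `n` labelled external edges. -/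
structure KGraph (ρ n : ℕ) extends AGraph ρ where
  bipedFree : toAGraph.BipedFree
  label : Fin n ≃ {h // toAGraph.σ h = h}

instance HGraph.setoid (ρ : ℕ) : Setoid (HGraph ρ) where
  r G G' := Nonempty (Iso G.toAGraph G'.toAGraph)
  iseqv := ⟨fun _ => ⟨Iso.refl _⟩, fun ⟨e⟩ => ⟨e.symm⟩, fun ⟨e⟩ ⟨e'⟩ => ⟨e.trans e'⟩⟩

instance KGraph.setoid (ρ n : ℕ) : Setoid (KGraph ρ n) where
  r G G' := ∃ e : Iso G.toAGraph G'.toAGraph, ∀ k, e.eH (G.label k).1 = (G'.label k).1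
  iseqv := by
    refine ⟨fun _ => ⟨Iso.refl _, fun _ => rfl⟩, ?_, ?_⟩
    · rintro G G' ⟨e, he⟩
      exact ⟨e.symm, fun k => (Equiv.symm_apply_eq _).2 (he k).symm⟩
    · rintro G G' G'' ⟨e, he⟩ ⟨e', he'⟩
      exact ⟨e.trans e', fun k => (congrArg e'.eH (he k)).trans (he' k)⟩

/-- For a high quadruped `g` of a biped-free graph and disjoint high quadrupeds `𝓕` strictly
inside `g`, the graph `g / 𝓕`. -/
def subQuot (G : AGraph ρ) (hG : G.BipedFree) (g : Finset G.H) (hg : G.IsHighQuad g)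
    (𝓕 : Finset (Finset G.H)) (h𝓕 : G.IsDisjFam 𝓕) (hlt : ∀ f ∈ 𝓕, f ⊂ g) : HGraph ρ where
  toAGraph := minor (ofSub g hg.onePI.sub) 𝓕 h𝓕 fun f hf => (hlt f hf).subset
  bipedFree := minor_bipedFree hG hg.onePI.connected hg.four.ge
  onePI := minor_onePI hg.onePI.cut hg.onePI.connected
    (exists_notMem hg.onePI.nonempty hg.onePI.connected h𝓕 hlt)

/-- The subgraph `g`, as a graph. -/
def sub (G : AGraph ρ) (hG : G.BipedFree) (g : Finset G.H) (hg : G.IsHighQuad g) : HGraph ρ :=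
  subQuot G hG g hg ∅ ⟨by simp, by simp⟩ (by simp)

theorem AGraph.BipedFree.four_le_whole {G : AGraph ρ} (hG : G.BipedFree) :
    4 ≤ (Finset.univ.filter fun h => G.vert h ∈ (whole (G := G)).W ∧
      h ∉ (whole (G := G)).edges).card := by
  simpa [whole, internal, external] using hG.four_le

theorem HGraph.mem_verts (G : HGraph ρ) (v : G.V) : v ∈ G.verts G.internal := by
  obtain ⟨h, hh⟩ := G.onePI.nonempty
  rcases Relation.ReflTransGen.cases_head (G.bipedFree.connected v (G.vert h)) with e | ⟨w, hs, _⟩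
  · exact e ▸ vert_mem_verts hh
  · obtain ⟨k, hk, rfl, _⟩ := hs
    exact vert_mem_verts hk

/-- A nonempty family of disjoint high quadrupeds of `G`, not containing `G` itself. -/
abbrev ProperFam (G : AGraph ρ) : Type :=
  {𝓕 : Finset (Finset G.H) // G.IsDisjFam 𝓕 ∧ 𝓕.Nonempty ∧ G.internal ∉ 𝓕}

/-- A family of disjoint high quadrupeds of `G`; it may be empty and it may be `{G}`. -/
abbrev Fam (G : AGraph ρ) : Type := {𝓕 : Finset (Finset G.H) // G.IsDisjFam 𝓕}

/-- A dangerous forest of `G`; it may be empty and it may contain `G`. -/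
abbrev Forest (G : AGraph ρ) : Type := {F : Finset (Finset G.H) // G.IsForest F}

/-- A dangerous forest of proper subgraphs of `G`. -/
abbrev ProperForest (G : AGraph ρ) : Type :=
  {F : Finset (Finset G.H) // G.IsForest F ∧ G.internal ∉ F}

theorem AGraph.IsHighQuad.ssubset {G : AGraph ρ} {g : Finset G.H} (hg : G.IsHighQuad g)
    (hne : g ≠ G.internal) : g ⊂ G.internal :=
  (hg.onePI.sub.subset_internal).ssubset_of_ne hne

/-- The cograph `G / 𝓕`, for proper subgraphs. -/
def HGraph.quot (G : HGraph ρ) (𝓕 : Finset (Finset G.H)) (h𝓕 : G.IsDisjFam 𝓕)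
    (hG : G.internal ∉ 𝓕) : HGraph ρ where
  toAGraph := minor whole 𝓕 h𝓕 fun _ hf => (h𝓕.1 _ hf).onePI.sub.subset_internal
  bipedFree := minor_bipedFree G.bipedFree (fun v _ w _ => G.bipedFree.connected v w)
    G.bipedFree.four_le_whole
  onePI := minor_onePI
    (fun h hh v _ w _ => G.onePI.cut h hh v (G.mem_verts v) w (G.mem_verts w))
    (fun v _ w _ => G.bipedFree.connected v w)
    (exists_notMem G.onePI.nonempty G.onePI.connected h𝓕
      fun f hf => (h𝓕.1 f hf).ssubset fun e => hG (e ▸ hf))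

/-- The cograph `G / 𝓕` of a graph with labelled external edges. -/
def KGraph.quot {n : ℕ} (G : KGraph ρ n) (𝓕 : Finset (Finset G.H)) (h𝓕 : G.IsDisjFam 𝓕) :
    KGraph ρ n where
  toAGraph := minor whole 𝓕 h𝓕 fun _ hf => (h𝓕.1 _ hf).onePI.sub.subset_internal
  bipedFree := minor_bipedFree G.bipedFree (fun v _ w _ => G.bipedFree.connected v w)
    G.bipedFree.four_le_whole
  label := G.label.trans
    { toFun := fun h => ⟨⟨h.1, Finset.mem_univ _, fun f hf hmem =>
          ((h𝓕.1 f hf).onePI.sub _ hmem).1 h.2⟩,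
        (minor_σ_eq_iff _).2 (by simp [whole, internal, h.2])⟩
      invFun := fun h => ⟨h.1.1, by
        simpa [whole, internal] using (minor_σ_eq_iff _).1 h.2⟩
      left_inv := fun _ => rfl
      right_inv := fun _ => rfl }

/-! ### The Hopf algebra -/

/-- The free commutative algebra on isomorphism classes of connected graphs; products are disjoint
unions. -/
abbrev HAlg (ρ : ℕ) : Type 1 := MvPolynomial (Quotient (HGraph.setoid ρ)) ℝ

/-- The class of a connected graph, as an element of the algebra. -/
def gen (G : HGraph ρ) : HAlg ρ := MvPolynomial.X (Quotient.mk _ G)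

/-- The coproduct (the classes on the right do not depend on the representative of `c`). -/
def Δ (ρ : ℕ) : HAlg ρ →ₐ[ℝ] HAlg ρ ⊗[ℝ] HAlg ρ :=
  MvPolynomial.aeval fun c => let G := c.out
    gen G ⊗ₜ 1 + 1 ⊗ₜ gen G + ∑ 𝓕 : ProperFam G.toAGraph,
      (∏ g : 𝓕.1, gen (sub G.toAGraph G.bipedFree g (𝓕.2.1.1 g g.2))) ⊗ₜ
        gen (G.quot 𝓕.1 𝓕.2.1 𝓕.2.2.2)

/-- The counit. -/
def ε (ρ : ℕ) : HAlg ρ →ₐ[ℝ] ℝ := MvPolynomial.aeval fun _ => 0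

/-- Convolution of characters, `(α ⊗ β) ∘ Δ`. -/
def conv (α β : HAlg ρ →ₐ[ℝ] ℝ) : HAlg ρ →ₐ[ℝ] ℝ :=
  ((Algebra.TensorProduct.lmul' ℝ).comp (Algebra.TensorProduct.map α β)).comp (Δ ρ)

theorem sub_card_lt (G : HGraph ρ) (𝓕 : ProperFam G.toAGraph) (g : 𝓕.1) :
    (sub G.toAGraph G.bipedFree g (𝓕.2.1.1 g g.2)).internal.card < G.internal.card :=
  have hne : ∀ f ∈ 𝓕.1, f ≠ G.internal := fun _ hf e => 𝓕.2.2.2 (e ▸ hf)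
  lt_of_le_of_lt (card_internal_minor_le (h𝓕 := ⟨by simp, by simp⟩) (hR := by simp))
    (Finset.card_lt_card ((𝓕.2.1.1 g g.2).ssubset fun e => hne g.1 g.2 e))

/-- The antipode on connected graphs, `S(G) = -G - ∑ S(G') G/G'`. -/
def antipodeGen (G : HGraph ρ) : HAlg ρ :=
  -gen G - ∑ 𝓕 : ProperFam G.toAGraph,
    (∏ g : 𝓕.1, antipodeGen (sub G.toAGraph G.bipedFree g (𝓕.2.1.1 g g.2))) *
      gen (G.quot 𝓕.1 𝓕.2.1 𝓕.2.2.2)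
termination_by G.internal.card
decreasing_by exact sub_card_lt G 𝓕 g

/-- The antipode (multiplicative, as the algebra is commutative). -/
def S (ρ : ℕ) : HAlg ρ →ₐ[ℝ] HAlg ρ := MvPolynomial.aeval fun c => antipodeGen c.out

/-- The span of the classes of connected graphs with `n` labelled external edges. -/
abbrev KSpace (ρ n : ℕ) : Type 1 := Quotient (KGraph.setoid ρ n) →₀ ℝ

/-- The class of a labelled graph. -/
def kgen {n : ℕ} (G : KGraph ρ n) : KSpace ρ n := Finsupp.single (Quotient.mk _ G) 1

/-- The coaction. The empty family gives `1 ⊗ G`; for a graph with four external edges, the family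
`{G}` gives the term with `G` on the left and a single vertex on the right. -/
def coaction (ρ n : ℕ) : KSpace ρ n →ₗ[ℝ] HAlg ρ ⊗[ℝ] KSpace ρ n :=
  Finsupp.linearCombination ℝ fun c => let G := c.out
    ∑ 𝓕 : Fam G.toAGraph,
      (∏ g : 𝓕.1, gen (sub G.toAGraph G.bipedFree g (𝓕.2.1 g g.2))) ⊗ₜ kgen (G.quot 𝓕.1 𝓕.2)

/-- The action of a character on linear maps, `α · f = m ∘ (α ⊗ f) ∘ coaction`. -/
def act {n : ℕ} {D : Type*} [AddCommGroup D] [Module ℝ D] (α : HAlg ρ →ₐ[ℝ] ℝ)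
    (f : KSpace ρ n →ₗ[ℝ] D) : KSpace ρ n →ₗ[ℝ] D :=
  (TensorProduct.lid ℝ D).toLinearMap ∘ₗ TensorProduct.map α.toLinearMap f ∘ₗ coaction ρ n

/-! ### Amplitudes -/

/-- Space-time. -/
abbrev E4 : Type := EuclideanSpace ℝ (Fin 4)

/-- The `i`-th slice of the propagator, for slice ratio `M` and mass `m`. -/
def cov (M m : ℝ) (i : ℕ) (x y : E4) : ℝ :=
  ∫ α in (if i = 0 then Set.Ioi 1 else Set.Ioc (M ^ (-2 * (i : ℤ))) (M ^ (-2 * ((i : ℤ) - 1)))),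
    Real.exp (-m ^ 2 * α - ‖x - y‖ ^ 2 / (4 * α)) / α ^ 2

/-- The internal edges, as unordered pairs of half-edges. -/
def AGraph.edges (G : AGraph ρ) : Finset (Sym2 G.H) := G.internal.image fun h => s(h, G.σ h)

/-- The product of the propagators of the internal edges, the vertices being placed at `x`. The
two half-edges of `e` are taken in an arbitrary order. -/
def integrand (M m : ℝ) (G : AGraph ρ) (x : G.V → E4) : ℝ :=
  ∏ e ∈ G.edges, cov M m (G.scale (Quot.out e).1)
    (x (G.vert (Quot.out e).1)) (x (G.vert (Quot.out e).2))

/-- Put the vertex `v` at `a` and the others at `y`. -/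
def place {V : Type} (v : V) (a : E4) (y : {w // w ≠ v} → E4) (w : V) : E4 :=
  if hw : w = v then a else y ⟨w, hw⟩

/-- `τ A(G)`, where all positions of external edges but that of `h` are integrated, and `h` is
kept at `a`: an external edge forces its position to be that of its vertex, so all vertices except
that of `h` are integrated. -/
def tauAt (M m : ℝ) (G : AGraph ρ) (h : G.H) (a : E4) : ℝ :=
  ∫ y : {w // w ≠ G.vert h} → E4, integrand M m G (place (G.vert h) a y)

/-- The integral defining `tauAt` converges absolutely. -/
def TauConverges (M m : ℝ) (G : AGraph ρ) (h : G.H) (a : E4) : Prop :=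
  MeasureTheory.Integrable fun y : {w // w ≠ G.vert h} → E4 =>
    integrand M m G (place (G.vert h) a y)

theorem AGraph.BipedFree.external_nonempty {G : AGraph ρ} (hG : G.BipedFree) :
    G.external.Nonempty :=
  Finset.card_pos.1 (lt_of_lt_of_le (by norm_num) hG.four_le)

/-- The number `τ A(G)`, computed with any external edge. -/
def tau (M m : ℝ) (G : HGraph ρ) : ℝ :=
  tauAt M m G.toAGraph G.bipedFree.external_nonempty.choose 0

/-- `τ A` as a character. -/
def tauA (M m : ℝ) (ρ : ℕ) : HAlg ρ →ₐ[ℝ] ℝ := MvPolynomial.aeval fun c => tau M m c.out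

/-- The counterterm of a connected graph, `C(G) = -τA(G) - ∑ τA(G/G') C(G')`. -/
def counterterm (M m : ℝ) (G : HGraph ρ) : ℝ :=
  -tau M m G + ∑ 𝓕 : ProperFam G.toAGraph,
    -tau M m (G.quot 𝓕.1 𝓕.2.1 𝓕.2.2.2) *
      ∏ g : 𝓕.1, counterterm M m (sub G.toAGraph G.bipedFree g (𝓕.2.1.1 g g.2))
termination_by G.internal.card
decreasing_by exact sub_card_lt G 𝓕 g

/-- The useful counterterms, extended multiplicatively to disjoint unions. -/
def CU (M m : ℝ) (ρ : ℕ) : HAlg ρ →ₐ[ℝ] ℝ := MvPolynomial.aeval fun c => counterterm M m c.out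

/-- Functionals on the Schwartz functions of `n` space-time points. -/
abbrev Distr (n : ℕ) : Type := 𝓢(Fin n → E4, ℝ) → ℝ

/-- The amplitude with its `n` external positions, as a functional of test functions: the kernel is
`∫ ∏ dx_v ∏ C(x_s, x_t) ∏_k δ(y_k - x_{v(k)})`, where `v(k)` carries the external edge `k`. -/
def amp {n : ℕ} (M m : ℝ) (G : KGraph ρ n) : Distr n := fun φ =>
  ∫ x : G.V → E4, integrand M m G.toAGraph x * φ fun k => x (G.vert (G.label k).1)

/-- The usefully renormalized amplitude, by the multiscale forest formula: the sum over dangerous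
forests `F` in which the subtraction `-τ` is applied to every `g ∈ F`, from the inside to the
outside, so that each `g ∈ F` becomes a vertex with the constant `-τA` of `g` with the smaller
members of `F` shrunk. -/
def ampUR {n : ℕ} (M m : ℝ) (G : KGraph ρ n) : Distr n :=
  ∑ F : Forest G.toAGraph,
    (∏ g : F.1, -tau M m (subQuot G.toAGraph G.bipedFree g (F.2.1 g g.2) (below F.1 g)
      (F.2.below g) fun _ => ssubset_of_mem_below)) • amp M m (G.quot (tops F.1) F.2.tops)

/-- The amplitudes as a linear map. -/
def A {n : ℕ} (M m : ℝ) (ρ : ℕ) : KSpace ρ n →ₗ[ℝ] Distr n :=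
  Finsupp.linearCombination ℝ fun c => amp M m c.out

/-- The usefully renormalized amplitudes as a linear map. -/
def AUR {n : ℕ} (M m : ℝ) (ρ : ℕ) : KSpace ρ n →ₗ[ℝ] Distr n :=
  Finsupp.linearCombination ℝ fun c => ampUR M m c.out

/-- The sum over forests `{G} ∪ F` of the products of `-g`, each `g` taken with the smaller members
of the forest shrunk. -/
def forestSum (G : HGraph ρ) : HAlg ρ :=
  ∑ F : ProperForest G.toAGraph,
    (-gen (G.quot (tops F.1) F.2.1.tops fun h => F.2.2 (Finset.mem_filter.1 h).1)) *
      ∏ g : F.1, -gen (subQuot G.toAGraph G.bipedFree g (F.2.1.1 g g.2) (below F.1 g)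
        (F.2.1.below g) fun _ => ssubset_of_mem_below)

end Multiscale
end

open Multiscale

noncomputable section

namespace Multiscale

open AGraph
open scoped Classical

variable {ρ : ℕ}

namespace AGraph

/-! The algebra rests on one fact about contractions. Let `N` be the minor of `G` obtained from a
high region `R` by shrinking a family `γ`. Disjoint families of high quadrupeds of `N` then
correspond to disjoint families `γ'` of `G` inside `R` such that every member of `γ` lies in a
member of `γ'`. A subgraph of `N` is lifted by putting back the members of `γ` that it touches
(`up`), and a member of `γ'` not in `γ` is contracted (`down`). Both operations preserve being 1PI,
high and having four legs (`isHighQuad_up`, `Compat.isHighQuad_down`). A further quotient of `N` is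
the minor of `R` by `γ'`, and the contraction of `g` is `g` divided by the members of `γ` inside it.
`Realization` records this up to isomorphism, so sums over families of subgraphs and quotients of
`G` become sums over families of `G` (`famSum_eq`). It follows that such sums depend only on the
isomorphism class.

Both recursions, for `S` and for the counterterms, read `Φ G = -famSum Φ Ψ G`, where `famSum` runs
over all families other than `{G}`, including the empty one. The identity with `S` on the left is
this recursion. For the one with `S` on the right (`gen_add_famSum_antipodeGen`), the recursion is
inserted for each `S(G/γ)`, which gives a double sum over `γ` and a coarser `γ'`. For fixed `γ'` the
sum over `γ` factors over the members `g` of `γ'`, and each factor is the same identity for the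
smaller graph `g`, hence zero. Only the empty `γ'` survives and gives `-G`.

A forest with maximal elements `γ` is an independent choice, for each `g` in `γ`, of a forest inside
`g` containing `g`. By induction the sum of the weights of these forests is the product of the
`S(g)` (`hasForestSum`, `sum_tops_eq`). Grouping forests by maximal elements therefore gives the
forest formula for `S` and, after applying `τA`, also `A_UR = C_U · A` (`ampUR_eq`). Convolution
inverses on either side are determined by induction on the number of edges (`conv_eq_ε_iff`,
`conv_eq_ε_iff'`), without coassociativity.

Analytically, a propagator slice is bounded by a constant times `exp (-m |x - y|)` (`cov_le`). By
connectedness the integrand is bounded by a product of integrable weights in the distances to any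
one vertex (`exists_integrand_le`). This gives convergence when that vertex is fixed, or when a
Schwartz function controls its position. Translation invariance and a volume-preserving change of
origin make `τA` independent of the vertex that is kept (`tauAt_eq`). -/

/-! ### Elementary facts on subgraphs and disjoint families. -/

theorem exists_vert_eq (G : AGraph ρ) (v : G.V) : ∃ h, G.vert h = v := by
  have h4 := G.valence v
  have : Nonempty {h // G.vert h = v} := by
    by_contra hne
    rw [not_nonempty_iff] at hne
    simp at h4
  exact ⟨this.some.1, this.some.2⟩

theorem mem_verts {G : AGraph ρ} {γ : Finset G.H} {v : G.V} :
    v ∈ G.verts γ ↔ ∃ h ∈ γ, G.vert h = v := Finset.mem_image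

theorem verts_mono {G : AGraph ρ} {γ γ' : Finset G.H} (h : γ ⊆ γ') : G.verts γ ⊆ G.verts γ' :=
  Finset.image_subset_image h

theorem mem_legs {G : AGraph ρ} {γ : Finset G.H} {h : G.H} :
    h ∈ G.legs γ ↔ G.vert h ∈ G.verts γ ∧ h ∉ γ := by
  simp [legs]

theorem mem_internal {G : AGraph ρ} {h : G.H} : h ∈ G.internal ↔ G.σ h ≠ h := by
  simp [internal]

theorem Joined.mono {G : AGraph ρ} {γ γ' : Finset G.H} (hγ : γ ⊆ γ') {v w : G.V}
    (h : G.Joined γ v w) : G.Joined γ' v w :=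
  Relation.ReflTransGen.mono (fun _ _ ⟨k, hk, e⟩ => ⟨k, hγ hk, e⟩) _ _ h

theorem Joined.trans {G : AGraph ρ} {γ : Finset G.H} {u v w : G.V}
    (h : G.Joined γ u v) (h' : G.Joined γ v w) : G.Joined γ u w :=
  Relation.ReflTransGen.trans h h'

theorem IsHighQuad.verts_nonempty {G : AGraph ρ} {g : Finset G.H} (hg : G.IsHighQuad g) :
    (G.verts g).Nonempty :=
  hg.onePI.nonempty.image _

theorem IsHighQuad.exists_leg {G : AGraph ρ} {g : Finset G.H} (hg : G.IsHighQuad g) :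
    ∃ l, G.vert l ∈ G.verts g ∧ l ∉ g := by
  have : (G.legs g).Nonempty := Finset.card_pos.1 (by rw [hg.four]; norm_num)
  obtain ⟨l, hl⟩ := this
  exact ⟨l, mem_legs.1 hl⟩

theorem isDisjFam_empty (G : AGraph ρ) : G.IsDisjFam ∅ := ⟨by simp, by simp⟩

theorem IsDisjFam.eq_of_subset {G : AGraph ρ} {𝓕 : Finset (Finset G.H)} (h𝓕 : G.IsDisjFam 𝓕)
    {f g : Finset G.H} (hf : f ∈ 𝓕) (hg : g ∈ 𝓕) (h : f ⊆ g) : f = g := by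
  obtain ⟨v, hv⟩ := (h𝓕.1 f hf).verts_nonempty
  exact h𝓕.uniq hf hg hv (verts_mono h hv)

theorem IsDisjFam.mono {G : AGraph ρ} {𝓕 𝓖 : Finset (Finset G.H)} (h𝓕 : G.IsDisjFam 𝓕)
    (h : 𝓖 ⊆ 𝓕) : G.IsDisjFam 𝓖 :=
  ⟨fun g hg => h𝓕.1 g (h hg), fun f hf g hg => h𝓕.2 f (h hf) g (h hg)⟩

/-! ### Realizations of minors up to isomorphism. -/

/-- All scales of the region exceed those of the internal edges of `G` leaving it. -/
def Region.High {G : AGraph ρ} (R : G.Region) : Prop :=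
  ∀ h ∈ R.edges, ∀ l, G.vert l ∈ R.W → l ∉ R.edges → G.σ l ≠ l → G.scale l < G.scale h

theorem whole_high (G : AGraph ρ) : (whole : G.Region).High :=
  fun _ _ _ _ hl hσ => absurd (mem_internal.2 hσ) hl

theorem ofSub_high {G : AGraph ρ} {g : Finset G.H} (hg : G.IsHighQuad g) :
    (ofSub g hg.onePI.sub).High :=
  fun h hh l hl hlg hσ => hg.high h hh l (mem_legs.2 ⟨hl, hlg⟩) hσ

/-- The graph `N` is, up to isomorphism, the minor of `G` obtained from the high region `R` by
shrinking the members of `γ`. -/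
structure Realization (N G : AGraph ρ) (R : G.Region) (γ : Finset (Finset G.H)) where
  fam : G.IsDisjFam γ
  le : ∀ f ∈ γ, f ⊆ R.edges
  high : R.High
  j : N.H → G.H
  inj : Function.Injective j
  mem_range : ∀ h, (∃ k, j k = h) ↔ G.vert h ∈ R.W ∧ ∀ f ∈ γ, h ∉ f
  vert_iff : ∀ h k, N.vert h = N.vert k ↔
    G.vert (j h) = G.vert (j k) ∨ ∃ f ∈ γ, G.vert (j h) ∈ G.verts f ∧ G.vert (j k) ∈ G.verts f
  σ_mem : ∀ h, j h ∈ R.edges → j (N.σ h) = G.σ (j h)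
  σ_notMem : ∀ h, j h ∉ R.edges → N.σ h = h
  scale : ∀ h, j h ∈ R.edges → G.scale (j h) = N.scale h

/-- The minor realizes itself. -/
def Realization.ofMinor {G : AGraph ρ} {R : G.Region} {γ : Finset (Finset G.H)}
    (hγ : G.IsDisjFam γ) (hR : ∀ f ∈ γ, f ⊆ R.edges) (hh : R.High) :
    Realization (minor R γ hγ hR) G R γ where
  fam := hγ
  le := hR
  high := hh
  j := Subtype.val
  inj := Subtype.val_injective
  mem_range h := ⟨fun ⟨k, hk⟩ => hk ▸ k.2, fun hh => ⟨⟨h, hh⟩, rfl⟩⟩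
  vert_iff h k := vert_eq_iff h k
  σ_mem h hh := minor_σ_of_mem h hh
  σ_notMem h hh := minor_σ_of_notMem h hh
  scale _ _ := rfl

/-- An isomorphic graph is a realization of the whole graph. -/
def Realization.ofIso {N G : AGraph ρ} (e : Iso N G) : Realization N G whole ∅ where
  fam := isDisjFam_empty G
  le := by simp
  high := whole_high G
  j := e.eH
  inj := e.eH.injective
  mem_range h := by simp [whole, e.eH.surjective h]
  vert_iff h k := by simp [e.vert_eH]
  σ_mem h _ := (e.σ_eH h).symm
  σ_notMem h hh := by
    simpa [whole, internal, e.σ_eH] using hh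
  scale h hh := e.scale_eH h ((e.mem_internal h).1 hh)

/-- As every vertex carries half-edges, an isomorphism may be given on half-edges only. -/
def Iso.ofHalfEdges {G G' : AGraph ρ} (eH : G.H ≃ G'.H)
    (hv : ∀ h k, G.vert h = G.vert k ↔ G'.vert (eH h) = G'.vert (eH k))
    (hσ : ∀ h, G'.σ (eH h) = eH (G.σ h))
    (hs : ∀ h ∈ G.internal, G'.scale (eH h) = G.scale h) : Iso G G' where
  eV :=
    { toFun := fun v => G'.vert (eH (G.exists_vert_eq v).choose)
      invFun := fun v => G.vert (eH.symm (G'.exists_vert_eq v).choose)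
      left_inv := fun v => by
        rw [← (G.exists_vert_eq v).choose_spec, hv, Equiv.apply_symm_apply,
          (G'.exists_vert_eq _).choose_spec, (G.exists_vert_eq v).choose_spec]
      right_inv := fun v => by
        conv_rhs => rw [← (G'.exists_vert_eq v).choose_spec,
          ← eH.apply_symm_apply (G'.exists_vert_eq v).choose]
        rw [← hv, (G.exists_vert_eq _).choose_spec] }
  eH := eH
  vert_eH h := (hv _ _).1 (G.exists_vert_eq _).choose_spec.symm
  σ_eH := hσ
  scale_eH := hs

namespace Realization

variable {N N' G : AGraph ρ} {R : G.Region} {γ : Finset (Finset G.H)}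

/-- The bijection of half-edges between two realizations of the same minor. -/
def equivH (z : Realization N G R γ) (z' : Realization N' G R γ) : N.H ≃ N'.H where
  toFun h := ((z'.mem_range _).2 ((z.mem_range _).1 ⟨h, rfl⟩)).choose
  invFun h := ((z.mem_range _).2 ((z'.mem_range _).1 ⟨h, rfl⟩)).choose
  left_inv h := z.inj (by
    rw [((z.mem_range _).2 ((z'.mem_range _).1 ⟨_, rfl⟩)).choose_spec,
      ((z'.mem_range _).2 ((z.mem_range _).1 ⟨h, rfl⟩)).choose_spec])
  right_inv h := z'.inj (by
    rw [((z'.mem_range _).2 ((z.mem_range _).1 ⟨_, rfl⟩)).choose_spec,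
      ((z.mem_range _).2 ((z'.mem_range _).1 ⟨h, rfl⟩)).choose_spec])

theorem j_equivH (z : Realization N G R γ) (z' : Realization N' G R γ) (h : N.H) :
    z'.j (z.equivH z' h) = z.j h :=
  ((z'.mem_range _).2 ((z.mem_range _).1 ⟨h, rfl⟩)).choose_spec

theorem mem_internal (z : Realization N G R γ) {h : N.H} :
    h ∈ N.internal ↔ z.j h ∈ R.edges := by
  rw [AGraph.mem_internal]
  refine ⟨fun hh => by_contra fun hn => hh (z.σ_notMem h hn), fun hh e => ?_⟩
  have h1 := z.σ_mem h hh
  rw [e] at h1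
  exact (R.sub _ hh).1 h1.symm

/-- Two realizations of the same minor are isomorphic. -/
def iso (z : Realization N G R γ) (z' : Realization N' G R γ) : Iso N N' :=
  Iso.ofHalfEdges (z.equivH z') (fun h k => by rw [z.vert_iff, z'.vert_iff]; simp only [j_equivH])
    (fun h => by
      by_cases hh : z.j h ∈ R.edges
      · apply z'.inj
        rw [z'.σ_mem _ (by rwa [j_equivH]), j_equivH, j_equivH, z.σ_mem h hh]
      · rw [z.σ_notMem h hh, z'.σ_notMem _ (by rwa [j_equivH])])
    (fun h hh => by
      have hh' := z.mem_internal.1 hh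
      rw [← z.scale h hh', ← z'.scale _ (by rwa [j_equivH]), j_equivH])

/-- The vertex of `G` at `v` is contracted to the vertex of `N` carrying `k`. -/
def Rep (z : Realization N G R γ) (k : N.H) (v : G.V) : Prop :=
  G.vert (z.j k) = v ∨ ∃ f ∈ γ, G.vert (z.j k) ∈ G.verts f ∧ v ∈ G.verts f

theorem rep_self (z : Realization N G R γ) (k : N.H) : z.Rep k (G.vert (z.j k)) := Or.inl rfl

theorem Rep.of_verts {z : Realization N G R γ} {k : N.H} {v w : G.V} (h : z.Rep k v)
    {f : Finset G.H} (hf : f ∈ γ) (hv : v ∈ G.verts f) (hw : w ∈ G.verts f) : z.Rep k w := by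
  rcases h with rfl | ⟨f', hf', h1, h2⟩
  · exact Or.inr ⟨f, hf, hv, hw⟩
  · obtain rfl := z.fam.uniq hf hf' hv h2
    exact Or.inr ⟨f, hf, h1, hw⟩

theorem Rep.vert_eq {z : Realization N G R γ} {k k' : N.H} {v : G.V} (h : z.Rep k v)
    (h' : z.Rep k' v) : N.vert k = N.vert k' := by
  rw [z.vert_iff]
  rcases h with h | ⟨f, hf, h1, h2⟩
  · rcases h' with h' | ⟨f', hf', h3, h4⟩
    · exact Or.inl (h.trans h'.symm)
    · exact Or.inr ⟨f', hf', h ▸ h4, h3⟩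
  · rcases h'.of_verts hf h2 h1 with h' | ⟨f', hf', h3, h4⟩
    · exact Or.inl h'.symm
    · exact Or.inr ⟨f', hf', h4, h3⟩

theorem rep_of_vert_eq (z : Realization N G R γ) {k k' : N.H} (h : N.vert k = N.vert k') {v : G.V}
    (h' : z.Rep k v) : z.Rep k' v := by
  rcases (z.vert_iff k k').1 h with h | ⟨f, hf, h1, h2⟩
  · rcases h' with h' | ⟨f', hf', h3, h4⟩
    · exact Or.inl (h ▸ h')
    · exact Or.inr ⟨f', hf', h ▸ h3, h4⟩
  · rcases h' with rfl | ⟨f', hf', h3, h4⟩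
    · exact Or.inr ⟨f, hf, h2, h1⟩
    · obtain rfl := z.fam.uniq hf hf' h1 h3
      exact Or.inr ⟨f, hf, h2, h4⟩

theorem j_notMem (z : Realization N G R γ) (k : N.H) {f : Finset G.H} (hf : f ∈ γ) : z.j k ∉ f :=
  ((z.mem_range _).1 ⟨k, rfl⟩).2 f hf

theorem exists_j_eq (z : Realization N G R γ) {h : G.H} (hW : G.vert h ∈ R.W)
    (hf : ∀ f ∈ γ, h ∉ f) : ∃ k, z.j k = h := (z.mem_range h).2 ⟨hW, hf⟩

/-- A member of `γ` contains the vertex of some half-edge of `N`. -/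
theorem exists_j_vert_mem (z : Realization N G R γ) {f : Finset G.H} (hf : f ∈ γ) :
    ∃ k, G.vert (z.j k) ∈ G.verts f := by
  obtain ⟨l, hl, hlf⟩ := (z.fam.1 f hf).exists_leg
  obtain ⟨k, rfl⟩ := z.exists_j_eq (R.verts_sub (verts_mono (z.le f hf) hl)) fun f' hf' hl' => by
    obtain rfl := z.fam.uniq hf hf' hl (vert_mem_verts hl')
    exact hlf hl'
  exact ⟨k, hl⟩

/-! ### Lifting subgraphs from a minor and contracting them. -/

/-- The subgraph of `G` whose contraction is the subgraph `g` of `N`. -/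
def up (z : Realization N G R γ) (g : Finset N.H) : Finset G.H :=
  Finset.univ.filter fun h => (∃ k ∈ g, z.j k = h) ∨
    ∃ f ∈ γ, h ∈ f ∧ ∃ k ∈ g, G.vert (z.j k) ∈ G.verts f

/-- The contraction of the subgraph `g` of `G`. -/
def down (z : Realization N G R γ) (g : Finset G.H) : Finset N.H :=
  Finset.univ.filter fun k => z.j k ∈ g

theorem mem_up {z : Realization N G R γ} {g : Finset N.H} {h : G.H} :
    h ∈ z.up g ↔ (∃ k ∈ g, z.j k = h) ∨
      ∃ f ∈ γ, h ∈ f ∧ ∃ k ∈ g, G.vert (z.j k) ∈ G.verts f := by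
  simp [up]

theorem mem_down {z : Realization N G R γ} {g : Finset G.H} {k : N.H} :
    k ∈ z.down g ↔ z.j k ∈ g := by
  simp [down]

theorem j_mem_up {z : Realization N G R γ} {g : Finset N.H} {k : N.H} :
    z.j k ∈ z.up g ↔ k ∈ g := by
  rw [mem_up]
  refine ⟨?_, fun h => Or.inl ⟨k, h, rfl⟩⟩
  rintro (⟨k', hk', e⟩ | ⟨f, hf, hk, _⟩)
  · exact z.inj e ▸ hk'
  · exact absurd hk (z.j_notMem k hf)

theorem down_up (z : Realization N G R γ) (g : Finset N.H) : z.down (z.up g) = g := by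
  ext k
  rw [mem_down, j_mem_up]

theorem mem_verts_up {z : Realization N G R γ} {g : Finset N.H} {v : G.V} :
    v ∈ G.verts (z.up g) ↔ ∃ k ∈ g, z.Rep k v := by
  rw [mem_verts]
  constructor
  · rintro ⟨h, hh, rfl⟩
    rcases mem_up.1 hh with ⟨k, hk, rfl⟩ | ⟨f, hf, hhf, k, hk, hkf⟩
    · exact ⟨k, hk, z.rep_self k⟩
    · exact ⟨k, hk, Or.inr ⟨f, hf, hkf, vert_mem_verts hhf⟩⟩
  · rintro ⟨k, hk, rfl | ⟨f, hf, h1, h2⟩⟩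
    · exact ⟨z.j k, j_mem_up.2 hk, rfl⟩
    · obtain ⟨h, hh, rfl⟩ := mem_verts.1 h2
      exact ⟨h, mem_up.2 (Or.inr ⟨f, hf, hh, k, hk, h1⟩), rfl⟩

theorem vert_mem_iff {z : Realization N G R γ} {g : Finset N.H} {k : N.H} {v : G.V}
    (h : z.Rep k v) : N.vert k ∈ N.verts g ↔ v ∈ G.verts (z.up g) := by
  rw [mem_verts_up, mem_verts]
  constructor
  · rintro ⟨k', hk', e⟩
    exact ⟨k', hk', z.rep_of_vert_eq e.symm h⟩
  · rintro ⟨k', hk', h'⟩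
    exact ⟨k', hk', h'.vert_eq h⟩

theorem mem_edges_of_sub (z : Realization N G R γ) {g : Finset N.H} (hg : N.IsSub g) {k : N.H}
    (hk : k ∈ g) : z.j k ∈ R.edges :=
  z.mem_internal.1 (AGraph.mem_internal.2 (hg k hk).1)

theorem up_subset (z : Realization N G R γ) {g : Finset N.H} (hg : N.IsSub g) :
    z.up g ⊆ R.edges := by
  intro h hh
  rcases mem_up.1 hh with ⟨k, hk, rfl⟩ | ⟨f, hf, hhf, _⟩
  · exact z.mem_edges_of_sub hg hk
  · exact z.le f hf hhf

theorem isSub_up (z : Realization N G R γ) {g : Finset N.H} (hg : N.IsSub g) :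
    G.IsSub (z.up g) := by
  intro h hh
  refine ⟨(R.sub h (z.up_subset hg hh)).1, ?_⟩
  rcases mem_up.1 hh with ⟨k, hk, rfl⟩ | ⟨f, hf, hhf, hk⟩
  · rw [← z.σ_mem k (z.mem_edges_of_sub hg hk)]
    exact j_mem_up.2 (hg k hk).2
  · exact mem_up.2 (Or.inr ⟨f, hf, ((z.fam.1 f hf).onePI.sub h hhf).2, hk⟩)

/-- A member of `γ` that meets the lifted subgraph is contained in it, so no leg of the lift is
hidden in a member of `γ`: all legs survive in `N`. -/
theorem legs_up (z : Realization N G R γ) {g : Finset N.H} (hg : N.IsSub g) :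
    G.legs (z.up g) = (N.legs g).image z.j := by
  ext h
  rw [mem_legs, Finset.mem_image]
  constructor
  · rintro ⟨hv, hn⟩
    have hW : G.vert h ∈ R.W := R.verts_sub (verts_mono (z.up_subset hg) hv)
    obtain ⟨k, rfl⟩ := z.exists_j_eq hW fun f hf hhf => by
      obtain ⟨k, hk, hr⟩ := mem_verts_up.1 hv
      refine hn (mem_up.2 (Or.inr ⟨f, hf, hhf, k, hk, ?_⟩))
      rcases hr with e | ⟨f', hf', h1, h2⟩
      · exact e ▸ vert_mem_verts hhf
      · obtain rfl := z.fam.uniq hf hf' (vert_mem_verts hhf) h2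
        exact h1
    exact ⟨k, mem_legs.2 ⟨(vert_mem_iff (z.rep_self k)).2 hv, fun hk => hn (j_mem_up.2 hk)⟩, rfl⟩
  · rintro ⟨k, hk, rfl⟩
    rw [mem_legs] at hk
    exact ⟨(vert_mem_iff (z.rep_self k)).1 hk.1, fun h => hk.2 (j_mem_up.1 h)⟩

theorem card_legs_up (z : Realization N G R γ) {g : Finset N.H} (hg : N.IsSub g) :
    (G.legs (z.up g)).card = (N.legs g).card := by
  rw [z.legs_up hg, Finset.card_image_of_injective _ z.inj]

/-- Paths in `N` lift to `G`, provided the contracted subgraphs can be crossed. -/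
theorem joined_up (z : Realization N G R γ) {β : Finset N.H} {β' : Finset G.H} {g : Finset N.H}
    (hg : N.IsSub g) (hβ : β ⊆ g) (hβ' : ∀ k ∈ β, z.j k ∈ β')
    (hf : ∀ f ∈ γ, f ⊆ z.up g → ∀ u ∈ G.verts f, ∀ v ∈ G.verts f, G.Joined β' u v)
    {n n' : N.V} (hn : N.Joined β n n') :
    ∀ k k' v w, N.vert k = n → N.vert k' = n' → z.Rep k v → z.Rep k' w →
      v ∈ G.verts (z.up g) → w ∈ G.verts (z.up g) → G.Joined β' v w := by
  -- Vertices contracted to the same vertex of `N` are joined inside members of `γ`, which belong to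
  -- the lift as soon as they touch it.
  have key : ∀ k v w, z.Rep k v → z.Rep k w → v ∈ G.verts (z.up g) → G.Joined β' v w := by
    intro k v w hv hw hvg
    have hsub : ∀ f ∈ γ, G.vert (z.j k) ∈ G.verts f → f ⊆ z.up g := by
      intro f hf' hk h hh
      obtain ⟨k', hk', hr⟩ := mem_verts_up.1 hvg
      refine mem_up.2 (Or.inr ⟨f, hf', hh, k', hk', ?_⟩)
      rcases z.rep_of_vert_eq (hv.vert_eq hr) (z.rep_self k) with e | ⟨f', hf'', h1, h2⟩
      · rwa [e]
      · obtain rfl := z.fam.uniq hf' hf'' hk h2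
        exact h1
    have hkk : ∀ f ∈ γ, G.vert (z.j k) ∈ G.verts f → ∀ v ∈ G.verts f, ∀ w ∈ G.verts f,
      G.Joined β' v w := fun f hf' hk v hv w hw => hf f hf' (hsub f hf' hk) v hv w hw
    rcases hv with rfl | ⟨f, hf', h1, h2⟩
    · rcases hw with rfl | ⟨f, hf', h1, h2⟩
      · exact Relation.ReflTransGen.refl
      · exact hkk f hf' h1 _ h1 _ h2
    · rcases hw with rfl | ⟨f', hf'', h3, h4⟩
      · exact hkk f hf' h1 _ h2 _ h1
      · exact (hkk f hf' h1 _ h2 _ h1).trans (hkk f' hf'' h3 _ h3 _ h4)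
  induction hn with
  | refl =>
    intro k k' v w hk hk' hv hw hvg _
    exact key k' v w (z.rep_of_vert_eq (hk.trans hk'.symm) hv) hw hvg
  | tail _ hs ih =>
    obtain ⟨h, hh, rfl, rfl⟩ := hs
    intro k k' v w hk hk' hv hw hvg hwg
    have h1 := ih k h v (G.vert (z.j h)) hk rfl hv (z.rep_self h) hvg
      (vert_mem_verts (j_mem_up.2 (hβ hh)))
    refine (h1.tail ⟨z.j h, hβ' h hh, rfl, rfl⟩).trans ?_
    rw [← z.σ_mem h (z.mem_edges_of_sub hg (hβ hh))]
    exact key k' _ w (z.rep_of_vert_eq hk'.symm (z.rep_self _)) hw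
      (vert_mem_verts (j_mem_up.2 (hg h (hβ hh)).2))

/-- Paths in `G` descend to `N`. -/
theorem joined_down (z : Realization N G R γ) {β : Finset N.H} {β' : Finset G.H}
    (hβ' : β' ⊆ R.edges) (hβ : ∀ k, z.j k ∈ β' → k ∈ β) {v w : G.V} (hvw : G.Joined β' v w) :
    ∀ k k', z.Rep k v → z.Rep k' w → N.Joined β (N.vert k) (N.vert k') := by
  induction hvw with
  | refl =>
    intro k k' hk hk'
    rw [hk.vert_eq hk']
    exact Relation.ReflTransGen.refl
  | tail _ hs ih =>
    obtain ⟨h, hh, rfl, rfl⟩ := hs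
    intro k k' hk hk'
    by_cases hex : ∃ f ∈ γ, h ∈ f
    · obtain ⟨f, hf, hhf⟩ := hex
      exact ih k k' hk (hk'.of_verts hf (vert_mem_verts ((z.fam.1 f hf).onePI.sub h hhf).2)
        (vert_mem_verts hhf))
    · push Not at hex
      obtain ⟨k₁, rfl⟩ := z.exists_j_eq (R.verts_sub (vert_mem_verts (hβ' hh))) hex
      refine (ih k k₁ hk (z.rep_self k₁)).tail ⟨k₁, hβ k₁ hh, rfl, ?_⟩
      rw [← z.σ_mem k₁ (hβ' hh)] at hk'
      exact (z.rep_self _).vert_eq hk'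

/-- Paths of `N` are lifted, crossing each member of `γ` by its own connectedness. If the cut edge
lies in a member of `γ`, that member is crossed because it is 1PI itself. For highness, an edge
hidden in `f` lies above the legs of `f`; one of these is a half-edge of `g`, which lies above the
legs of `g`. -/
theorem isHighQuad_up (z : Realization N G R γ) {g : Finset N.H} (hg : N.IsHighQuad g) :
    G.IsHighQuad (z.up g) := by
  have hs := hg.onePI.sub
  have hcut : ∀ h ∈ z.up g, ∀ v ∈ G.verts (z.up g), ∀ w ∈ G.verts (z.up g),
      G.Joined (z.up g \ {h, G.σ h}) v w := by
    intro h hh v hv w hw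
    have hdis : ∀ f ∈ γ, h ∉ f → f ⊆ z.up g → f ⊆ z.up g \ {h, G.σ h} := by
      intro f hf hhf hfg x hx
      rw [Finset.mem_sdiff, Finset.mem_insert, Finset.mem_singleton, not_or]
      refine ⟨hfg hx, fun e => hhf (e ▸ hx), fun e => hhf ?_⟩
      have := ((z.fam.1 f hf).onePI.sub x hx).2
      rwa [e, G.σ_σ] at this
    obtain ⟨k, hk, hkv⟩ := mem_verts_up.1 hv
    obtain ⟨k', hk', hkw⟩ := mem_verts_up.1 hw
    rcases mem_up.1 hh with ⟨k₀, hk₀, rfl⟩ | ⟨f₀, hf₀, hhf₀, _⟩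
    · refine z.joined_up hs (β := g \ {k₀, N.σ k₀}) Finset.sdiff_subset ?_ ?_
        (hg.onePI.cut k₀ hk₀ _ (vert_mem_verts hk) _ (vert_mem_verts hk')) k k' v w rfl rfl
        hkv hkw hv hw
      · intro x hx
        simp only [Finset.mem_sdiff, Finset.mem_insert, Finset.mem_singleton, not_or] at hx ⊢
        refine ⟨j_mem_up.2 hx.1, fun e => hx.2.1 (z.inj e), fun e => hx.2.2 (z.inj ?_)⟩
        rw [e, z.σ_mem k₀ (z.mem_edges_of_sub hs hk₀)]
      · intro f hf hfg u hu v hv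
        exact ((z.fam.1 f hf).onePI.connected u hu v hv).mono (hdis f hf (z.j_notMem k₀ hf) hfg)
    · refine z.joined_up hs (β := g) Finset.Subset.rfl ?_ ?_
        (hg.onePI.connected _ (vert_mem_verts hk) _ (vert_mem_verts hk')) k k' v w rfl rfl
        hkv hkw hv hw
      · intro x hx
        simp only [Finset.mem_sdiff, Finset.mem_insert, Finset.mem_singleton, not_or]
        refine ⟨j_mem_up.2 hx, fun e => z.j_notMem x hf₀ (e ▸ hhf₀), fun e => z.j_notMem x hf₀ ?_⟩
        rw [e]
        exact ((z.fam.1 f₀ hf₀).onePI.sub h hhf₀).2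
      · intro f hf hfg u hu v hv
        by_cases hhf : h ∈ f
        · exact ((z.fam.1 f hf).onePI.cut h hhf u hu v hv).mono
            (Finset.sdiff_subset_sdiff hfg Finset.Subset.rfl)
        · exact ((z.fam.1 f hf).onePI.connected u hu v hv).mono (hdis f hf hhf hfg)
  have hne : (z.up g).Nonempty := by
    obtain ⟨k, hk⟩ := hg.onePI.nonempty
    exact ⟨z.j k, j_mem_up.2 hk⟩
  refine ⟨⟨z.isSub_up hs, hne, fun v hv w hw => ?_, hcut⟩, ?_, ?_⟩
  · obtain ⟨h, hh⟩ := hne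
    exact (hcut h hh v hv w hw).mono Finset.sdiff_subset
  · intro h hh l hl hσ
    rw [z.legs_up hs] at hl
    obtain ⟨l, hlN, rfl⟩ := Finset.mem_image.1 hl
    by_cases hle : z.j l ∈ R.edges
    · have hlσ : N.σ l ≠ l := AGraph.mem_internal.1 (z.mem_internal.2 hle)
      have hlt : ∀ k ∈ g, G.scale (z.j l) < G.scale (z.j k) := fun k hk => by
        rw [z.scale l hle, z.scale k (z.mem_edges_of_sub hs hk)]
        exact hg.high k hk l hlN hlσ
      rcases mem_up.1 hh with ⟨k, hk, rfl⟩ | ⟨f, hf, hhf, k, hk, hkf⟩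
      · exact hlt k hk
      · exact (hlt k hk).trans ((z.fam.1 f hf).high h hhf (z.j k)
          (mem_legs.2 ⟨hkf, z.j_notMem k hf⟩) (R.sub _ (z.mem_edges_of_sub hs hk)).1)
    -- A leg leaving `R` is external in `N`, so highness in `N` does not constrain it; the
    -- inequality comes from `R` being high.
    · exact z.high h (z.up_subset hs hh) _ ((z.mem_range _).1 ⟨l, rfl⟩).1 hle hσ
  · rw [z.card_legs_up hs, hg.four]

/-- A high quadruped inside `R` that is not a member of `γ` but contains or avoids each member. -/
structure Compat (z : Realization N G R γ) (g : Finset G.H) : Prop where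
  quad : G.IsHighQuad g
  le : g ⊆ R.edges
  compat : ∀ f ∈ γ, f ⊂ g ∨ Disjoint (G.verts f) (G.verts g)

theorem isSub_down (z : Realization N G R γ) {g : Finset G.H} (hg : G.IsSub g)
    (hle : g ⊆ R.edges) : N.IsSub (z.down g) := by
  intro k hk
  rw [mem_down] at hk ⊢
  refine ⟨AGraph.mem_internal.1 (z.mem_internal.2 (hle hk)), ?_⟩
  rw [z.σ_mem k (hle hk)]
  exact (hg _ hk).2

/-- The danger is that a member `f` of `γ` inside `g` leaves no trace in the contraction. If every
half-edge of `g` at a vertex of `f` belonged to `f`, paths of `g` starting in `f` could not leave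
it, and connectedness would force `g ⊆ f`. Hence some half-edge of `g` at `f` survives in `N`, and
`up` restores `f`. -/
theorem Compat.up_down {z : Realization N G R γ} {g : Finset G.H} (hg : z.Compat g) :
    z.up (z.down g) = g := by
  ext h
  rw [mem_up]
  constructor
  · rintro (⟨k, hk, rfl⟩ | ⟨f, hf, hhf, k, hk, hkf⟩)
    · exact mem_down.1 hk
    · rcases hg.compat f hf with h1 | h1
      · exact h1.subset hhf
      · exact absurd (vert_mem_verts (mem_down.1 hk)) (Finset.disjoint_left.1 h1 hkf)
  · intro hh
    by_cases hex : ∃ f ∈ γ, h ∈ f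
    · obtain ⟨f, hf, hhf⟩ := hex
      refine Or.inr ⟨f, hf, hhf, ?_⟩
      have hfg : f ⊂ g := (hg.compat f hf).resolve_right fun h1 =>
        Finset.disjoint_left.1 h1 (vert_mem_verts hhf) (vert_mem_verts hh)
      by_contra hcon
      push Not at hcon
      have hin : ∀ x ∈ g, G.vert x ∈ G.verts f → x ∈ f := by
        intro x hx hxf
        by_contra hxn
        obtain ⟨k, rfl⟩ := z.exists_j_eq (R.verts_sub (vert_mem_verts (hg.le hx)))
          fun f' hf' hx' => by
            obtain rfl := z.fam.uniq hf hf' hxf (vert_mem_verts hx')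
            exact hxn hx'
        exact hcon k (mem_down.2 hx) hxf
      have key : ∀ w, G.Joined g (G.vert h) w → w ∈ G.verts f := by
        intro w hw
        induction hw with
        | refl => exact vert_mem_verts hhf
        | tail _ hs ih =>
          obtain ⟨x, hx, rfl, rfl⟩ := hs
          exact vert_mem_verts (((z.fam.1 f hf).onePI.sub x (hin x hx ih)).2)
      obtain ⟨x, hx, hxf⟩ := Finset.exists_of_ssubset hfg
      exact hxf (hin x hx (key _ (hg.quad.onePI.connected _ (vert_mem_verts hh) _
        (vert_mem_verts hx))))
    · push Not at hex
      obtain ⟨k, rfl⟩ := z.exists_j_eq (R.verts_sub (vert_mem_verts (hg.le hh))) hex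
      exact Or.inl ⟨k, mem_down.2 hh, rfl⟩

theorem Compat.vert_mem_down {z : Realization N G R γ} {g : Finset G.H} (hg : z.Compat g)
    {k : N.H} : N.vert k ∈ N.verts (z.down g) ↔ G.vert (z.j k) ∈ G.verts g := by
  rw [vert_mem_iff (z.rep_self k), hg.up_down]

theorem Compat.isHighQuad_down {z : Realization N G R γ} {g : Finset G.H} (hg : z.Compat g) :
    N.IsHighQuad (z.down g) := by
  have hs := z.isSub_down hg.quad.onePI.sub hg.le
  have hne : (z.down g).Nonempty := by
    by_contra hne
    rw [Finset.not_nonempty_iff_eq_empty] at hne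
    have := hg.up_down
    rw [hne] at this
    obtain ⟨h, hh⟩ := hg.quad.onePI.nonempty
    rw [← this, mem_up] at hh
    simp at hh
  refine ⟨⟨hs, hne, ?_, ?_⟩, ?_, ?_⟩
  · intro n hn n' hn'
    obtain ⟨k, hk, rfl⟩ := mem_verts.1 hn
    obtain ⟨k', hk', rfl⟩ := mem_verts.1 hn'
    exact z.joined_down hg.le (fun k hk => mem_down.2 hk)
      (hg.quad.onePI.connected _ (vert_mem_verts (mem_down.1 hk)) _
        (vert_mem_verts (mem_down.1 hk'))) k k' (z.rep_self k) (z.rep_self k')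
  · intro k₀ hk₀ n hn n' hn'
    obtain ⟨k, hk, rfl⟩ := mem_verts.1 hn
    obtain ⟨k', hk', rfl⟩ := mem_verts.1 hn'
    rw [mem_down] at hk₀
    refine z.joined_down (Finset.sdiff_subset.trans hg.le) (fun x hx => ?_)
      (hg.quad.onePI.cut (z.j k₀) hk₀ _ (vert_mem_verts (mem_down.1 hk)) _
        (vert_mem_verts (mem_down.1 hk'))) k k' (z.rep_self k) (z.rep_self k')
    simp only [Finset.mem_sdiff, Finset.mem_insert, Finset.mem_singleton, not_or] at hx ⊢
    refine ⟨mem_down.2 hx.1, fun e => hx.2.1 (e ▸ rfl), fun e => hx.2.2 ?_⟩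
    rw [e, z.σ_mem k₀ (hg.le hk₀)]
  · intro k hk l hl hσ
    have hl' : z.j l ∈ G.legs g := by
      rw [← hg.up_down, z.legs_up hs]
      exact Finset.mem_image_of_mem _ hl
    have hle : z.j l ∈ R.edges := z.mem_internal.1 (AGraph.mem_internal.2 hσ)
    rw [mem_down] at hk
    rw [← z.scale l hle, ← z.scale k (hg.le hk)]
    exact hg.quad.high _ hk _ hl' (R.sub _ hle).1
  · rw [← z.card_legs_up hs, hg.up_down, hg.quad.four]

theorem isCompat_up (z : Realization N G R γ) {g : Finset N.H} (hg : N.IsHighQuad g) :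
    z.Compat (z.up g) := by
  refine ⟨z.isHighQuad_up hg, z.up_subset hg.onePI.sub, fun f hf => ?_⟩
  by_cases hd : Disjoint (G.verts f) (G.verts (z.up g))
  · exact Or.inr hd
  · left
    rw [Finset.not_disjoint_iff] at hd
    obtain ⟨v, hvf, hv⟩ := hd
    obtain ⟨k, hk, hr⟩ := mem_verts_up.1 hv
    have hkf : G.vert (z.j k) ∈ G.verts f := by
      rcases hr with e | ⟨f', hf', h1, h2⟩
      · exact e ▸ hvf
      · obtain rfl := z.fam.uniq hf hf' hvf h2
        exact h1
    refine Finset.ssubset_iff_subset_ne.2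
      ⟨fun h hh => mem_up.2 (Or.inr ⟨f, hf, hh, k, hk, hkf⟩), fun e => ?_⟩
    exact z.j_notMem k hf (e ▸ j_mem_up.2 hk)

end Realization

end AGraph

namespace AGraph

/-! ### Families of a minor as coarser families of the graph. -/

/-- A family of disjoint high quadrupeds inside `R`, each member of `γ` lying in one of them. -/
structure Extends {G : AGraph ρ} (R : G.Region) (γ γ' : Finset (Finset G.H)) : Prop where
  fam : G.IsDisjFam γ'
  le : ∀ g ∈ γ', g ⊆ R.edges
  extend : ∀ f ∈ γ, ∃ g ∈ γ', f ⊆ g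

namespace Realization

variable {N G : AGraph ρ} {R : G.Region} {γ γ' : Finset (Finset G.H)}

theorem compat_of_extends (z : Realization N G R γ) (h : Extends R γ γ') {g : Finset G.H}
    (hg : g ∈ γ') (hgγ : g ∉ γ) : z.Compat g := by
  refine ⟨h.fam.1 g hg, h.le g hg, fun f hf => ?_⟩
  obtain ⟨g₁, hg₁, hfg⟩ := h.extend f hf
  by_cases e : g₁ = g
  · subst e
    exact Or.inl (Finset.ssubset_iff_subset_ne.2 ⟨hfg, fun e => hgγ (e ▸ hf)⟩)
  · exact Or.inr ((h.fam.2 g₁ hg₁ g hg e).mono_left (verts_mono hfg))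

/-- The family of `N` corresponding to an extension of `γ`. -/
def downFam (z : Realization N G R γ) (γ' : Finset (Finset G.H)) : Finset (Finset N.H) :=
  (γ' \ γ).image z.down

/-- The extension of `γ` corresponding to a family of `N`. -/
def upFam (z : Realization N G R γ) (δ : Finset (Finset N.H)) : Finset (Finset G.H) :=
  δ.image z.up ∪ γ.filter fun f => ∀ g ∈ δ, ¬ f ⊆ z.up g

theorem mem_downFam {z : Realization N G R γ} {d : Finset N.H} :
    d ∈ z.downFam γ' ↔ ∃ g ∈ γ', g ∉ γ ∧ z.down g = d := by
  simp [downFam, and_assoc]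

theorem mem_upFam {z : Realization N G R γ} {δ : Finset (Finset N.H)} {f : Finset G.H} :
    f ∈ z.upFam δ ↔ (∃ g ∈ δ, z.up g = f) ∨ f ∈ γ ∧ ∀ g ∈ δ, ¬ f ⊆ z.up g := by
  simp [upFam]

theorem isDisjFam_downFam (z : Realization N G R γ) (h : Extends R γ γ') :
    N.IsDisjFam (z.downFam γ') := by
  refine ⟨fun d hd => ?_, fun d hd d' hd' hne => ?_⟩
  · obtain ⟨g, hg, hgγ, rfl⟩ := mem_downFam.1 hd
    exact (z.compat_of_extends h hg hgγ).isHighQuad_down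
  · obtain ⟨g, hg, hgγ, rfl⟩ := mem_downFam.1 hd
    obtain ⟨g', hg', hgγ', rfl⟩ := mem_downFam.1 hd'
    refine Finset.disjoint_left.2 fun n hn hn' => ?_
    obtain ⟨k, rfl⟩ := N.exists_vert_eq n
    exact Finset.disjoint_left.1 (h.fam.2 g hg g' hg' fun e => hne (e ▸ rfl))
      ((z.compat_of_extends h hg hgγ).vert_mem_down.1 hn)
      ((z.compat_of_extends h hg' hgγ').vert_mem_down.1 hn')

theorem extends_upFam (z : Realization N G R γ) {δ : Finset (Finset N.H)} (hδ : N.IsDisjFam δ) :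
    Extends R γ (z.upFam δ) := by
  have hfg : ∀ f ∈ γ, ∀ g ∈ δ, ¬ f ⊆ z.up g → Disjoint (G.verts f) (G.verts (z.up g)) :=
    fun f hf g hg hn => ((z.isCompat_up (hδ.1 g hg)).compat f hf).resolve_left
      fun h => hn h.subset
  refine ⟨⟨fun f hf => ?_, fun f hf f' hf' hne => ?_⟩, fun f hf => ?_, fun f hf => ?_⟩
  · rcases mem_upFam.1 hf with ⟨g, hg, rfl⟩ | ⟨hf, _⟩
    · exact z.isHighQuad_up (hδ.1 g hg)
    · exact z.fam.1 f hf
  · rcases mem_upFam.1 hf with ⟨g, hg, rfl⟩ | ⟨hf, hfδ⟩ <;>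
      rcases mem_upFam.1 hf' with ⟨g', hg', rfl⟩ | ⟨hf', hfδ'⟩
    · refine Finset.disjoint_left.2 fun v hv hv' => ?_
      obtain ⟨k, hk, hr⟩ := mem_verts_up.1 hv
      obtain ⟨k', hk', hr'⟩ := mem_verts_up.1 hv'
      exact Finset.disjoint_left.1 (hδ.2 g hg g' hg' fun e => hne (e ▸ rfl))
        (vert_mem_verts hk) (hr.vert_eq hr' ▸ vert_mem_verts hk')
    · exact (hfg f' hf' g hg (hfδ' g hg)).symm
    · exact hfg f hf g' hg' (hfδ g' hg')
    · exact z.fam.2 f hf f' hf' hne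
  · rcases mem_upFam.1 hf with ⟨g, hg, rfl⟩ | ⟨hf, _⟩
    · exact z.up_subset (hδ.1 g hg).onePI.sub
    · exact z.le f hf
  · by_cases hex : ∃ g ∈ δ, f ⊆ z.up g
    · obtain ⟨g, hg, h⟩ := hex
      exact ⟨_, mem_upFam.2 (Or.inl ⟨g, hg, rfl⟩), h⟩
    · push Not at hex
      exact ⟨f, mem_upFam.2 (Or.inr ⟨hf, hex⟩), Finset.Subset.rfl⟩

theorem upFam_downFam (z : Realization N G R γ) (h : Extends R γ γ') :
    z.upFam (z.downFam γ') = γ' := by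
  ext f
  rw [mem_upFam]
  constructor
  · rintro (⟨d, hd, rfl⟩ | ⟨hf, hfd⟩)
    · obtain ⟨g, hg, hgγ, rfl⟩ := mem_downFam.1 hd
      rwa [(z.compat_of_extends h hg hgγ).up_down]
    · obtain ⟨g, hg, hfg⟩ := h.extend f hf
      by_cases hgγ : g ∈ γ
      · rwa [z.fam.eq_of_subset hf hgγ hfg]
      · refine absurd ?_ (hfd (z.down g) (mem_downFam.2 ⟨g, hg, hgγ, rfl⟩))
        rwa [(z.compat_of_extends h hg hgγ).up_down]
  · intro hf
    by_cases hfγ : f ∈ γ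
    · refine Or.inr ⟨hfγ, fun d hd hfd => ?_⟩
      obtain ⟨g, hg, hgγ, rfl⟩ := mem_downFam.1 hd
      rw [(z.compat_of_extends h hg hgγ).up_down] at hfd
      exact hgγ (h.fam.eq_of_subset hf hg hfd ▸ hfγ)
    · exact Or.inl ⟨z.down f, mem_downFam.2 ⟨f, hf, hfγ, rfl⟩,
        (z.compat_of_extends h hf hfγ).up_down⟩

theorem downFam_upFam (z : Realization N G R γ) {δ : Finset (Finset N.H)} (hδ : N.IsDisjFam δ) :
    z.downFam (z.upFam δ) = δ := by
  ext d
  rw [mem_downFam]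
  constructor
  · rintro ⟨f, hf, hfγ, rfl⟩
    rcases mem_upFam.1 hf with ⟨g, hg, rfl⟩ | ⟨hf, _⟩
    · rwa [z.down_up]
    · exact absurd hf hfγ
  · intro hd
    refine ⟨z.up d, mem_upFam.2 (Or.inl ⟨d, hd, rfl⟩), fun h => ?_, z.down_up d⟩
    obtain ⟨k, hk⟩ := (hδ.1 d hd).onePI.nonempty
    exact z.j_notMem k h (j_mem_up.2 hk)

/-- Families of `N` are extensions of `γ`. -/
theorem sum_families (z : Realization N G R γ) {B : Type*} [AddCommMonoid B]
    (F : Finset (Finset N.H) → B) :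
    ∑ δ ∈ Finset.univ.filter N.IsDisjFam, F δ =
      ∑ γ' ∈ Finset.univ.filter (Extends R γ), F (z.downFam γ') := by
  refine Finset.sum_bij' (fun δ _ => z.upFam δ) (fun γ' _ => z.downFam γ') ?_ ?_ ?_ ?_ ?_
  · intro δ hδ
    simpa using z.extends_upFam (by simpa using hδ)
  · intro γ' hγ'
    simpa using z.isDisjFam_downFam (by simpa using hγ')
  · intro δ hδ
    exact z.downFam_upFam (by simpa using hδ)
  · intro γ' hγ'
    exact z.upFam_downFam (by simpa using hγ')
  · intro δ hδ
    rw [z.downFam_upFam (by simpa using hδ)]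

/-- Contraction is injective on compatible subgraphs, as `up` undoes it. Members common to `γ'` and
`γ` are already vertices of `N` and contribute no factor. -/
theorem prod_downFam (z : Realization N G R γ) (h : Extends R γ γ') {B : Type*} [CommMonoid B]
    (F : Finset N.H → B) : ∏ d ∈ z.downFam γ', F d = ∏ g ∈ γ' \ γ, F (z.down g) := by
  refine Finset.prod_image fun g hg g' hg' e => ?_
  simp only [Finset.coe_sdiff, Set.mem_sdiff, Finset.mem_coe] at hg hg'
  rw [← (z.compat_of_extends h hg.1 hg.2).up_down, e,
    (z.compat_of_extends h hg'.1 hg'.2).up_down]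

/-- This matches the exclusion of `{N}` in the sums for `N` with the exclusion of the whole region
in `G`. If `g` contracts to all of `N`, it contains every surviving edge of `R`. It also meets every
`f` in `γ`, since each vertex of `N` lies on an internal edge, so it contains `f` by compatibility.
-/
theorem internal_mem_downFam (z : Realization N G R γ) (h : Extends R γ γ')
    (hN : ∀ n, n ∈ N.verts N.internal) (hR : R.edges ∉ γ) :
    N.internal ∈ z.downFam γ' ↔ R.edges ∈ γ' := by
  have hdown : z.down R.edges = N.internal := by
    ext k
    rw [mem_down, z.mem_internal]
  rw [mem_downFam]
  constructor
  · rintro ⟨g, hg, hgγ, e⟩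
    have hc := z.compat_of_extends h hg hgγ
    suffices g = R.edges from this ▸ hg
    refine hc.le.antisymm fun x hx => ?_
    by_cases hex : ∃ f ∈ γ, x ∈ f
    · obtain ⟨f, hf, hxf⟩ := hex
      obtain ⟨k, hk⟩ := z.exists_j_vert_mem hf
      have h1 := hN (N.vert k)
      rw [← e, hc.vert_mem_down] at h1
      exact ((hc.compat f hf).resolve_right fun h2 => Finset.disjoint_left.1 h2 hk h1).subset hxf
    · push Not at hex
      obtain ⟨k, rfl⟩ := z.exists_j_eq (R.verts_sub (vert_mem_verts hx)) hex
      rw [← mem_down, e, z.mem_internal]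
      exact hx
  · exact fun hg => ⟨R.edges, hg, hR, hdown⟩

/-- Shrinking further in `N` realizes shrinking the extension in `G`. -/
def quot (z : Realization N G R γ) (h : Extends R γ γ') (hδ : N.IsDisjFam (z.downFam γ'))
    (hle : ∀ d ∈ z.downFam γ', d ⊆ (whole : N.Region).edges) :
    Realization (minor whole (z.downFam γ') hδ hle) G R γ' where
  fam := h.fam
  le := h.le
  high := z.high
  j k := z.j k.1
  inj _ _ e := Subtype.ext (z.inj e)
  mem_range x := by
    constructor
    · rintro ⟨k, rfl⟩
      refine ⟨((z.mem_range _).1 ⟨k.1, rfl⟩).1, fun g hg hk => ?_⟩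
      by_cases hgγ : g ∈ γ
      · exact z.j_notMem k.1 hgγ hk
      · exact k.2.2 (z.down g) (mem_downFam.2 ⟨g, hg, hgγ, rfl⟩) (mem_down.2 hk)
    · rintro ⟨hW, hn⟩
      obtain ⟨k, rfl⟩ := z.exists_j_eq hW fun f hf hx => by
        obtain ⟨g, hg, hfg⟩ := h.extend f hf
        exact hn g hg (hfg hx)
      refine ⟨⟨k, Finset.mem_univ _, fun d hd hk => ?_⟩, rfl⟩
      obtain ⟨g, hg, _, rfl⟩ := mem_downFam.1 hd
      exact hn g hg (mem_down.1 hk)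
  vert_iff k l := by
    rw [vert_eq_iff, z.vert_iff]
    constructor
    · rintro ((e | ⟨f, hf, h1, h2⟩) | ⟨d, hd, h1, h2⟩)
      · exact Or.inl e
      · obtain ⟨g, hg, hfg⟩ := h.extend f hf
        exact Or.inr ⟨g, hg, verts_mono hfg h1, verts_mono hfg h2⟩
      · obtain ⟨g, hg, hgγ, rfl⟩ := mem_downFam.1 hd
        have hc := z.compat_of_extends h hg hgγ
        exact Or.inr ⟨g, hg, hc.vert_mem_down.1 h1, hc.vert_mem_down.1 h2⟩
    · rintro (e | ⟨g, hg, h1, h2⟩)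
      · exact Or.inl (Or.inl e)
      · by_cases hgγ : g ∈ γ
        · exact Or.inl (Or.inr ⟨g, hgγ, h1, h2⟩)
        · have hc := z.compat_of_extends h hg hgγ
          exact Or.inr ⟨z.down g, mem_downFam.2 ⟨g, hg, hgγ, rfl⟩, hc.vert_mem_down.2 h1,
            hc.vert_mem_down.2 h2⟩
  σ_mem k hk := by
    rw [minor_σ_of_mem k (z.mem_internal.2 hk), z.σ_mem k.1 hk]
  σ_notMem k hk := minor_σ_of_notMem k fun h1 => hk (z.mem_internal.1 h1)
  scale k hk := z.scale k.1 hk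

/-- A subgraph of `N` realizes the corresponding subgraph of `G` with some members of `γ` shrunk. -/
def sub (z : Realization N G R γ) {g : Finset G.H} (hg : z.Compat g)
    (hd : N.IsSub (z.down g)) (h0 : N.IsDisjFam ∅)
    (hle : ∀ d ∈ (∅ : Finset (Finset N.H)), d ⊆ (ofSub (z.down g) hd).edges) :
    Realization (minor (ofSub (z.down g) hd) ∅ h0 hle) G (ofSub g hg.quad.onePI.sub)
      (γ.filter fun f => f ⊆ g) where
  fam := z.fam.mono (Finset.filter_subset _ _)
  le f hf := (Finset.mem_filter.1 hf).2
  high := ofSub_high hg.quad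
  j k := z.j k.1
  inj _ _ e := Subtype.ext (z.inj e)
  mem_range x := by
    constructor
    · rintro ⟨k, rfl⟩
      exact ⟨hg.vert_mem_down.1 k.2.1, fun f hf => z.j_notMem k.1 (Finset.mem_filter.1 hf).1⟩
    · rintro ⟨hW, hn⟩
      obtain ⟨k, rfl⟩ := z.exists_j_eq (R.verts_sub (verts_mono hg.le hW)) fun f hf hx => by
        rcases hg.compat f hf with h1 | h1
        · exact hn f (Finset.mem_filter.2 ⟨hf, h1.subset⟩) hx
        · exact Finset.disjoint_left.1 h1 (vert_mem_verts hx) hW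
      exact ⟨⟨k, hg.vert_mem_down.2 hW, by simp⟩, rfl⟩
  vert_iff k l := by
    rw [vert_eq_iff, z.vert_iff]
    have hk := hg.vert_mem_down.1 k.2.1
    constructor
    · rintro ((e | ⟨f, hf, h1, h2⟩) | ⟨d, hd, _⟩)
      · exact Or.inl e
      · refine Or.inr ⟨f, Finset.mem_filter.2 ⟨hf, ?_⟩, h1, h2⟩
        exact ((hg.compat f hf).resolve_right fun h3 => Finset.disjoint_left.1 h3 h1 hk).subset
      · simp at hd
    · rintro (e | ⟨f, hf, h1, h2⟩)
      · exact Or.inl (Or.inl e)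
      · exact Or.inl (Or.inr ⟨f, (Finset.mem_filter.1 hf).1, h1, h2⟩)
  σ_mem k hk := by
    rw [minor_σ_of_mem k (mem_down.2 hk), z.σ_mem k.1 (hg.le hk)]
  σ_notMem k hk := minor_σ_of_notMem k fun h1 => hk (mem_down.1 h1)
  scale k hk := z.scale k.1 (hg.le hk)

end Realization

theorem Iso.card_internal {G G' : AGraph ρ} (e : Iso G G') :
    G.internal.card = G'.internal.card :=
  Finset.card_bij (fun h _ => e.eH h) (fun h hh => (e.mem_internal h).2 hh)
    (fun _ _ _ _ h => e.eH.injective h)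
    fun h hh => ⟨e.eH.symm h, (e.mem_internal _).1 (by simpa using hh), by simp⟩

/-! ### Minors as generators, and sums over families. -/

/-- The regions whose minors are generators of the Hopf algebra. -/
structure Region.Good {G : AGraph ρ} (R : G.Region) : Prop where
  nonempty : R.edges.Nonempty
  connected : ∀ v ∈ R.W, ∀ w ∈ R.W, G.Joined R.edges v w
  cut : ∀ h ∈ R.edges, ∀ v ∈ R.W, ∀ w ∈ R.W, G.Joined (R.edges \ {h, G.σ h}) v w
  four_le : 4 ≤ (Finset.univ.filter fun h => G.vert h ∈ R.W ∧ h ∉ R.edges).card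

theorem IsHighQuad.good {G : AGraph ρ} {g : Finset G.H} (hg : G.IsHighQuad g) :
    (ofSub g hg.onePI.sub).Good :=
  ⟨hg.onePI.nonempty, hg.onePI.connected, hg.onePI.cut, hg.four.ge⟩

/-- A high quadruped as a region. -/
def reg {G : AGraph ρ} (g : Finset G.H) : G.Region := if h : G.IsSub g then ofSub g h else whole

theorem IsSub.reg_eq {G : AGraph ρ} {g : Finset G.H} (hg : G.IsSub g) : reg g = ofSub g hg :=
  dif_pos hg

end AGraph

theorem HGraph.good (G : HGraph ρ) : (whole : G.toAGraph.Region).Good :=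
  ⟨G.onePI.nonempty, fun v _ w _ => G.bipedFree.connected v w,
    fun h hh v _ w _ => G.onePI.cut h hh v (G.mem_verts v) w (G.mem_verts w),
    G.bipedFree.four_le_whole⟩

/-- The minors of good regions, as generators of the Hopf algebra. -/
def minH {G : AGraph ρ} (hG : G.BipedFree) (R : G.Region) (hR : R.Good)
    (γ : Finset (Finset G.H)) (hγ : G.IsDisjFam γ) (hlt : ∀ f ∈ γ, f ⊂ R.edges) : HGraph ρ where
  toAGraph := minor R γ hγ fun f hf => (hlt f hf).subset
  bipedFree := minor_bipedFree hG hR.connected hR.four_le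
  onePI := minor_onePI hR.cut hR.connected
    (exists_notMem hR.nonempty
      (fun v hv w hw => hR.connected v (R.verts_sub hv) w (R.verts_sub hw)) hγ hlt)

/-- The value of `Φ` at a minor, extended by zero. -/
def minF {G : AGraph ρ} {B : Type*} [Zero B] (hG : G.BipedFree) (Φ : HGraph ρ → B) (R : G.Region)
    (γ : Finset (Finset G.H)) : B :=
  if h : R.Good ∧ G.IsDisjFam γ ∧ ∀ f ∈ γ, f ⊂ R.edges then Φ (minH hG R h.1 γ h.2.1 h.2.2) else 0

theorem minF_eq {G : AGraph ρ} {B : Type*} [Zero B] (hG : G.BipedFree) (Φ : HGraph ρ → B)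
    {R : G.Region} (hR : R.Good) {γ : Finset (Finset G.H)} (hγ : G.IsDisjFam γ)
    (hlt : ∀ f ∈ γ, f ⊂ R.edges) : minF hG Φ R γ = Φ (minH hG R hR γ hγ hlt) :=
  dif_pos ⟨hR, hγ, hlt⟩

theorem minF_reg {G : AGraph ρ} {B : Type*} [Zero B] (hG : G.BipedFree) (Φ : HGraph ρ → B)
    {g : Finset G.H} (hg : G.IsHighQuad g) {γ : Finset (Finset G.H)} (hγ : G.IsDisjFam γ)
    (hlt : ∀ f ∈ γ, f ⊂ g) : minF hG Φ (reg g) γ = Φ (subQuot G hG g hg γ hγ hlt) := by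
  rw [hg.onePI.sub.reg_eq, minF_eq hG Φ hg.good hγ hlt]
  rfl

theorem minF_whole (G : HGraph ρ) {B : Type*} [Zero B] (Φ : HGraph ρ → B)
    {γ : Finset (Finset G.H)} (hγ : G.IsDisjFam γ) (hG : G.internal ∉ γ) :
    minF G.bipedFree Φ whole γ = Φ (G.quot γ hγ hG) := by
  rw [minF_eq G.bipedFree Φ G.good hγ fun f hf => (hγ.1 f hf).ssubset fun e => hG (e ▸ hf)]
  rfl

/-- Isomorphism invariance. -/
def Invariant {B : Type*} (Φ : HGraph ρ → B) : Prop :=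
  ∀ X Y : HGraph ρ, Nonempty (Iso X.toAGraph Y.toAGraph) → Φ X = Φ Y

theorem invariant_gen : Invariant (gen : HGraph ρ → HAlg ρ) := fun _ _ h =>
  congrArg MvPolynomial.X (Quotient.sound h)

/-- The sum over all families of `N` other than `{N}`. -/
def famSum {B : Type*} [CommSemiring B] (Φ Ψ : HGraph ρ → B) (N : HGraph ρ) : B :=
  Ψ N + ∑ 𝓕 : ProperFam N.toAGraph,
    (∏ g : 𝓕.1, Φ (sub N.toAGraph N.bipedFree g (𝓕.2.1.1 g g.2))) * Ψ (N.quot 𝓕.1 𝓕.2.1 𝓕.2.2.2)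

/-- The separate term `Ψ N` is the empty family. Shrinking nothing gives only an isomorphic copy of
`N`, whence the invariance of `Ψ`. -/
theorem famSum_eq_sum_filter {B : Type*} [CommSemiring B] {Φ Ψ : HGraph ρ → B} (hΨ : Invariant Ψ)
    (N : HGraph ρ) : famSum Φ Ψ N =
      ∑ δ ∈ Finset.univ.filter fun δ => N.toAGraph.IsDisjFam δ ∧ N.internal ∉ δ,
        (∏ g ∈ δ, minF N.bipedFree Φ (reg g) ∅) * minF N.bipedFree Ψ whole δ := by
  have h0 : (∅ : Finset (Finset N.H)) ∈
      Finset.univ.filter fun δ => N.toAGraph.IsDisjFam δ ∧ N.internal ∉ δ := by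
    simp [isDisjFam_empty]
  rw [← Finset.add_sum_erase _ _ h0, famSum]
  congr 1
  · rw [Finset.prod_empty, one_mul, minF_whole N Ψ (isDisjFam_empty _) (by simp)]
    exact hΨ _ _ ⟨(Realization.ofIso (Iso.refl _)).iso
      (Realization.ofMinor (isDisjFam_empty _) (by simp) (whole_high _))⟩
  · rw [Finset.sum_subtype (p := fun 𝓕 => N.toAGraph.IsDisjFam 𝓕 ∧ 𝓕.Nonempty ∧ N.internal ∉ 𝓕)]
    · refine Finset.sum_congr rfl fun 𝓕 _ => ?_
      rw [minF_whole N Ψ 𝓕.2.1 𝓕.2.2.2]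
      congr 1
      rw [← Finset.prod_coe_sort 𝓕.1]
      refine Finset.prod_congr rfl fun g _ => ?_
      rw [minF_reg N.bipedFree Φ (𝓕.2.1.1 g g.2) (isDisjFam_empty _) (by simp)]
      rfl
    · intro δ
      simp only [Finset.mem_erase, Finset.mem_filter, Finset.mem_univ, true_and,
        Finset.nonempty_iff_ne_empty]
      tauto

/-- Sums over families of a realization of a minor of `G` are sums over families of `G`. -/
theorem famSum_eq {B : Type*} [CommSemiring B] {N : HGraph ρ} {G : AGraph ρ} (hG : G.BipedFree)
    {R : G.Region} {γ : Finset (Finset G.H)} (z : Realization N.toAGraph G R γ) (hR : R.Good)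
    (hγ : R.edges ∉ γ) {Φ Ψ : HGraph ρ → B}
    (hΦ : ∀ X Y : HGraph ρ, Nonempty (Iso X.toAGraph Y.toAGraph) →
      X.internal.card < N.internal.card → Φ X = Φ Y) (hΨ : Invariant Ψ) :
    famSum Φ Ψ N = ∑ γ' ∈ Finset.univ.filter fun γ' => Extends R γ γ' ∧ R.edges ∉ γ',
      (∏ g ∈ γ' \ γ, minF hG Φ (reg g) (γ.filter fun f => f ⊆ g)) * minF hG Ψ R γ' := by
  rw [famSum_eq_sum_filter hΨ, ← Finset.filter_filter, Finset.sum_filter, z.sum_families]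
  conv_rhs => rw [← Finset.filter_filter, Finset.sum_filter]
  refine Finset.sum_congr rfl fun γ' hγ' => ?_
  have hext : Extends R γ γ' := by simpa using hγ'
  have hiff := z.internal_mem_downFam hext N.mem_verts hγ
  by_cases hmem : R.edges ∈ γ'
  · rw [if_neg (not_not.2 (hiff.2 hmem)), if_neg (not_not.2 hmem)]
  · have hmem' := fun h => hmem (hiff.1 h)
    rw [if_pos hmem', if_pos hmem, z.prod_downFam hext]
    have hd := z.isDisjFam_downFam hext
    congr 1
    · refine Finset.prod_congr rfl fun g hg => ?_
      rw [Finset.mem_sdiff] at hg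
      have hc := z.compat_of_extends hext hg.1 hg.2
      rw [minF_reg N.bipedFree Φ hc.isHighQuad_down (isDisjFam_empty _) (by simp),
        minF_reg hG Φ hc.quad (z.fam.mono (Finset.filter_subset _ _))
          (fun f hf => Finset.ssubset_iff_subset_ne.2 ⟨(Finset.mem_filter.1 hf).2,
            fun e => hg.2 (e ▸ (Finset.mem_filter.1 hf).1)⟩)]
      refine hΦ _ _ ⟨(z.sub hc _ _ (by simp)).iso
        (Realization.ofMinor _ (fun f hf => (Finset.mem_filter.1 hf).2) (ofSub_high hc.quad))⟩ ?_
      refine lt_of_le_of_lt (card_internal_minor_le (h𝓕 := isDisjFam_empty _) (hR := by simp))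
        (Finset.card_lt_card ?_)
      exact hc.isHighQuad_down.ssubset fun e => hmem' (e ▸ Realization.mem_downFam.2 ⟨g, hg.1, hg.2, rfl⟩)
    · rw [minF_whole N Ψ hd hmem', minF_eq hG Ψ hR hext.fam fun f hf =>
        Finset.ssubset_iff_subset_ne.2 ⟨hext.le f hf, fun e => hmem (e ▸ hf)⟩]
      exact hΨ _ _ ⟨(z.quot hext hd fun d h => (hd.1 d h).onePI.sub.subset_internal).iso
        (Realization.ofMinor hext.fam hext.le z.high)⟩

/-! ### Invariance of the antipode. -/

theorem antipodeGen_eq (G : HGraph ρ) : antipodeGen G = -famSum antipodeGen gen G := by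
  rw [antipodeGen, famSum, neg_add, sub_eq_add_neg]

/-- Both sides are written as the same sum over families of `Y`, through the isomorphism and through
the identity. `famSum_eq` needs invariance of its first argument only on graphs with fewer edges,
which is the induction hypothesis. -/
theorem invariant_antipodeGen : Invariant (antipodeGen : HGraph ρ → HAlg ρ) := by
  suffices ∀ n, ∀ X Y : HGraph ρ, X.internal.card = n → Nonempty (Iso X.toAGraph Y.toAGraph) →
      antipodeGen X = antipodeGen Y from fun X Y h => this _ X Y rfl h
  intro n
  induction n using Nat.strong_induction_on with
  | _ n ih =>
    rintro X Y rfl ⟨e⟩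
    rw [antipodeGen_eq, antipodeGen_eq,
      famSum_eq Y.bipedFree (Realization.ofIso e) Y.good (by simp)
        (fun X' Y' h hlt => ih _ hlt X' Y' rfl h) invariant_gen,
      famSum_eq Y.bipedFree (Realization.ofIso (Iso.refl _)) Y.good (by simp)
        (fun X' Y' h hlt => ih _ (e.card_internal ▸ hlt) X' Y' rfl h) invariant_gen]

theorem S_gen (G : HGraph ρ) : S ρ (gen G) = antipodeGen G := by
  rw [S, gen, MvPolynomial.aeval_X]
  have h : (⟦G⟧ : Quotient (HGraph.setoid ρ)).out ≈ G := Quotient.mk_out G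
  exact invariant_antipodeGen _ _ h

/-! ### Factorization over the members of a disjoint family. -/

/-- A product over the members of a family of sums over sets of smaller subgraphs is a sum over
sets of subgraphs contained in members of the family. -/
theorem prod_sum_parts {G : AGraph ρ} {B : Type*} [CommSemiring B] {γ : Finset (Finset G.H)}
    (hγ : G.IsDisjFam γ) (p : Finset (Finset G.H) → Prop)
    (hquad : ∀ X, p X → ∀ x ∈ X, G.IsHighQuad x)
    (hp : ∀ X, (∀ x ∈ X, ∃ g ∈ γ, x ⊆ g) → ((∀ g ∈ γ, p (X.filter fun x => x ⊆ g)) ↔ p X))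
    (W : Finset G.H → Finset (Finset G.H) → B) :
    ∏ g ∈ γ, ∑ Y ∈ Finset.univ.filter (fun Y => p Y ∧ ∀ y ∈ Y, y ⊆ g), W g Y =
      ∑ X ∈ Finset.univ.filter (fun X => p X ∧ ∀ x ∈ X, ∃ g ∈ γ, x ⊆ g),
        ∏ g ∈ γ, W g (X.filter fun x => x ⊆ g) := by
  rw [Finset.prod_sum]
  -- The choices can be recovered from their union: a quadruped has a vertex, so it cannot lie in
  -- two disjoint members of `γ`.
  have key : ∀ q ∈ γ.pi fun g => Finset.univ.filter (fun Y => p Y ∧ ∀ y ∈ Y, y ⊆ g),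
      ∀ g (hg : g ∈ γ), ((γ.attach.biUnion fun g => q g.1 g.2).filter fun x => x ⊆ g) = q g hg := by
    intro q hq g hg
    rw [Finset.mem_pi] at hq
    ext x
    simp only [Finset.mem_filter, Finset.mem_biUnion, Finset.mem_attach, true_and, Subtype.exists]
    constructor
    · rintro ⟨⟨g', hg', hx⟩, hxg⟩
      have h' := (Finset.mem_filter.1 (hq g' hg')).2
      obtain ⟨v, hv⟩ := (hquad _ h'.1 x hx).verts_nonempty
      obtain rfl := hγ.uniq hg hg' (verts_mono hxg hv) (verts_mono (h'.2 x hx) hv)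
      exact hx
    · intro hx
      exact ⟨⟨g, hg, hx⟩, (Finset.mem_filter.1 (hq g hg)).2.2 x hx⟩
  refine Finset.sum_bij' (fun q _ => γ.attach.biUnion fun g => q g.1 g.2)
    (fun X _ g _ => X.filter fun x => x ⊆ g) ?_ ?_ ?_ ?_ ?_
  · intro q hq
    have hle : ∀ x ∈ γ.attach.biUnion fun g => q g.1 g.2, ∃ g ∈ γ, x ⊆ g := by
      intro x hx
      obtain ⟨g, _, hx⟩ := Finset.mem_biUnion.1 hx
      exact ⟨g, g.2, (Finset.mem_filter.1 (Finset.mem_pi.1 hq g.1 g.2)).2.2 x hx⟩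
    refine Finset.mem_filter.2 ⟨Finset.mem_univ _, (hp _ hle).1 fun g hg => ?_, hle⟩
    rw [key q hq g hg]
    exact (Finset.mem_filter.1 (Finset.mem_pi.1 hq g hg)).2.1
  · intro X hX
    obtain ⟨_, hpX, hle⟩ := Finset.mem_filter.1 hX
    refine Finset.mem_pi.2 fun g hg => Finset.mem_filter.2 ⟨Finset.mem_univ _,
      (hp X hle).2 hpX g hg, fun y hy => (Finset.mem_filter.1 hy).2⟩
  · intro q hq
    funext g hg
    exact key q hq g hg
  · intro X hX
    obtain ⟨_, hpX, hle⟩ := Finset.mem_filter.1 hX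
    ext x
    simp only [Finset.mem_biUnion, Finset.mem_attach, true_and, Subtype.exists, Finset.mem_filter]
    constructor
    · rintro ⟨_, _, hx, _⟩
      exact hx
    · intro hx
      obtain ⟨g, hg, h⟩ := hle x hx
      exact ⟨g, hg, hx, h⟩
  · intro q hq
    rw [← Finset.prod_attach γ]
    refine Finset.prod_congr rfl fun g _ => ?_
    rw [key q hq g.1 g.2]

/-- Subgraphs lying in different members of `γ` are automatically disjoint, so the condition can be
tested member by member. This is the locality hypothesis of `prod_sum_parts`; `isForest_parts` is
its analogue for forests. -/
theorem isDisjFam_parts {G : AGraph ρ} {γ : Finset (Finset G.H)} (hγ : G.IsDisjFam γ)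
    (X : Finset (Finset G.H)) (hle : ∀ x ∈ X, ∃ g ∈ γ, x ⊆ g) :
    (∀ g ∈ γ, G.IsDisjFam (X.filter fun x => x ⊆ g)) ↔ G.IsDisjFam X := by
  refine ⟨fun h => ⟨fun x hx => ?_, fun x hx y hy hne => ?_⟩,
    fun h g _ => h.mono (Finset.filter_subset _ _)⟩
  · obtain ⟨g, hg, hxg⟩ := hle x hx
    exact (h g hg).1 x (Finset.mem_filter.2 ⟨hx, hxg⟩)
  · obtain ⟨g, hg, hxg⟩ := hle x hx
    obtain ⟨g', hg', hyg⟩ := hle y hy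
    by_cases e : g = g'
    · subst e
      exact (h g hg).2 x (Finset.mem_filter.2 ⟨hx, hxg⟩) y (Finset.mem_filter.2 ⟨hy, hyg⟩) hne
    · exact (hγ.2 g hg g' hg' e).mono (verts_mono hxg) (verts_mono hyg)

theorem isForest_parts {G : AGraph ρ} {γ : Finset (Finset G.H)} (hγ : G.IsDisjFam γ)
    (X : Finset (Finset G.H)) (hle : ∀ x ∈ X, ∃ g ∈ γ, x ⊆ g) :
    (∀ g ∈ γ, G.IsForest (X.filter fun x => x ⊆ g)) ↔ G.IsForest X := by
  refine ⟨fun h => ⟨fun x hx => ?_, fun x hx y hy => ?_⟩,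
    fun h g _ => ⟨fun x hx => h.1 x (Finset.mem_filter.1 hx).1,
      fun x hx y hy => h.2 x (Finset.mem_filter.1 hx).1 y (Finset.mem_filter.1 hy).1⟩⟩
  · obtain ⟨g, hg, hxg⟩ := hle x hx
    exact (h g hg).1 x (Finset.mem_filter.2 ⟨hx, hxg⟩)
  · obtain ⟨g, hg, hxg⟩ := hle x hx
    obtain ⟨g', hg', hyg⟩ := hle y hy
    by_cases e : g = g'
    · subst e
      exact (h g hg).2 x (Finset.mem_filter.2 ⟨hx, hxg⟩) y (Finset.mem_filter.2 ⟨hy, hyg⟩)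
    · exact Or.inr (Or.inr ((hγ.2 g hg g' hg' e).mono (verts_mono hxg) (verts_mono hyg)))

/-- The members of a set of subgraphs contained in members of a disjoint family, sorted by these. -/
theorem prod_parts {G : AGraph ρ} {B : Type*} [CommMonoid B] {γ : Finset (Finset G.H)}
    (hγ : G.IsDisjFam γ) {X : Finset (Finset G.H)} (hquad : ∀ x ∈ X, G.IsHighQuad x)
    (hle : ∀ x ∈ X, ∃ g ∈ γ, x ⊆ g) (w : Finset G.H → B) :
    ∏ x ∈ X, w x = ∏ g ∈ γ, ∏ x ∈ X.filter (fun x => x ⊆ g), w x := by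
  rw [← Finset.prod_biUnion]
  · refine Finset.prod_congr ?_ fun _ _ => rfl
    ext x
    simp only [Finset.mem_biUnion, Finset.mem_filter]
    exact ⟨fun hx => (hle x hx).imp fun g hg => ⟨hg.1, hx, hg.2⟩, fun ⟨_, _, hx, _⟩ => hx⟩
  · intro g hg g' hg' hne
    refine Finset.disjoint_left.2 fun x hx hx' => hne ?_
    rw [Finset.mem_filter] at hx hx'
    obtain ⟨v, hv⟩ := (hquad x hx.1).verts_nonempty
    exact hγ.uniq hg hg' (verts_mono hx.2 hv) (verts_mono hx'.2 hv)

/-! ### Sums over families of subgraphs and of quotients -/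

theorem famSum_sub {B : Type*} [CommSemiring B] {G : AGraph ρ} (hG : G.BipedFree)
    {Φ Ψ : HGraph ρ → B} (hΦ : Invariant Φ) (hΨ : Invariant Ψ) {g : Finset G.H}
    (hg : G.IsHighQuad g) : famSum Φ Ψ (sub G hG g hg) =
      ∑ δ ∈ Finset.univ.filter fun δ => G.IsDisjFam δ ∧ ∀ f ∈ δ, f ⊂ g,
        (∏ f ∈ δ, minF hG Φ (reg f) ∅) * minF hG Ψ (reg g) δ := by
  have z : Realization (sub G hG g hg).toAGraph G (ofSub g hg.onePI.sub) ∅ :=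
    Realization.ofMinor (isDisjFam_empty G) (by simp) (ofSub_high hg)
  rw [famSum_eq hG z hg.good (by simp) (fun X Y h _ => hΦ X Y h) hΨ, hg.onePI.sub.reg_eq]
  refine Finset.sum_congr (Finset.filter_congr fun δ _ => ?_) fun δ _ => by simp
  constructor
  · rintro ⟨h, hn⟩
    exact ⟨h.fam, fun f hf => Finset.ssubset_iff_subset_ne.2 ⟨h.le f hf, fun e => hn (e ▸ hf)⟩⟩
  · rintro ⟨h, hlt⟩
    exact ⟨⟨h, fun f hf => (hlt f hf).subset, by simp⟩, fun hf => (hlt _ hf).ne rfl⟩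

/-- Here `γ'` runs over coarsenings of `γ` in `G` itself, which is what allows the order of the sums
over `γ` and `γ'` to be exchanged. -/
theorem famSum_quot {B : Type*} [CommSemiring B] (G : HGraph ρ)
    {Φ Ψ : HGraph ρ → B} (hΦ : Invariant Φ) (hΨ : Invariant Ψ) {γ : Finset (Finset G.H)}
    (hγ : G.IsDisjFam γ) (hn : G.internal ∉ γ) : famSum Φ Ψ (G.quot γ hγ hn) =
      ∑ γ' ∈ Finset.univ.filter fun γ' =>
          (G.IsDisjFam γ' ∧ G.internal ∉ γ') ∧ ∀ f ∈ γ, ∃ g ∈ γ', f ⊆ g,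
        (∏ g ∈ γ' \ γ, minF G.bipedFree Φ (reg g) (γ.filter fun f => f ⊆ g)) *
          minF G.bipedFree Ψ whole γ' := by
  have z : Realization (G.quot γ hγ hn).toAGraph G.toAGraph whole γ :=
    Realization.ofMinor hγ (fun f hf => (hγ.1 f hf).onePI.sub.subset_internal) (whole_high _)
  rw [famSum_eq G.bipedFree z G.good hn (fun X Y h _ => hΦ X Y h) hΨ]
  refine Finset.sum_congr (Finset.filter_congr fun γ' _ => ?_) fun _ _ => rfl
  constructor
  · rintro ⟨h, hn'⟩
    exact ⟨⟨h.fam, hn'⟩, h.extend⟩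
  · rintro ⟨⟨h, hn'⟩, h'⟩
    exact ⟨⟨h, fun f hf => (h.1 f hf).onePI.sub.subset_internal, h'⟩, hn'⟩

/-! ### The antipode is a right inverse -/

/-- By disjointness `{g}` is the only family inside `g` that contains `g`; it gives the first term,
and the other families give `famSum`. The left side is the factor that `g` contributes in the
factored double sum for the right antipode identity. -/
theorem sum_fam_subset {G : AGraph ρ} (hG : G.BipedFree) {g : Finset G.H} (hg : G.IsHighQuad g) :
    ∑ δ ∈ Finset.univ.filter (fun δ => G.IsDisjFam δ ∧ ∀ f ∈ δ, f ⊆ g),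
      (∏ f ∈ δ, minF hG gen (reg f) ∅) *
        (if g ∈ δ then 1 else minF hG antipodeGen (reg g) δ) =
      gen (sub G hG g hg) + famSum gen antipodeGen (sub G hG g hg) := by
  rw [← Finset.sum_filter_add_sum_filter_not _ (fun δ => g ∈ δ)]
  congr 1
  · rw [Finset.sum_eq_single {g}]
    · simp only [Finset.prod_singleton, Finset.mem_singleton, if_true, mul_one]
      rw [minF_reg hG gen hg (isDisjFam_empty _) (by simp)]
      rfl
    · intro δ hδ hne
      simp only [Finset.mem_filter, Finset.mem_univ, true_and] at hδ
      refine absurd (Finset.eq_singleton_iff_unique_mem.2 ⟨hδ.2, fun f hf => ?_⟩) hne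
      exact hδ.1.1.eq_of_subset hf hδ.2 (hδ.1.2 f hf)
    · intro h
      refine absurd ?_ h
      rw [Finset.mem_filter, Finset.mem_filter]
      refine ⟨⟨Finset.mem_univ _, ⟨?_, ?_⟩, ?_⟩, Finset.mem_singleton_self g⟩ <;> simp [hg]
  · rw [famSum_sub hG invariant_gen invariant_antipodeGen hg]
    have e : ((Finset.univ.filter fun δ => G.IsDisjFam δ ∧ ∀ f ∈ δ, f ⊆ g).filter fun δ => g ∉ δ) =
        Finset.univ.filter fun δ => G.IsDisjFam δ ∧ ∀ f ∈ δ, f ⊂ g := by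
      ext δ
      simp only [Finset.mem_filter, Finset.mem_univ, true_and]
      constructor
      · rintro ⟨⟨h, hle⟩, hn⟩
        exact ⟨h, fun f hf => Finset.ssubset_iff_subset_ne.2 ⟨hle f hf, fun e => hn (e ▸ hf)⟩⟩
      · rintro ⟨h, hlt⟩
        exact ⟨⟨h, fun f hf => (hlt f hf).subset⟩, fun hf => (hlt _ hf).ne rfl⟩
    rw [e]
    refine Finset.sum_congr rfl fun δ hδ => ?_
    rw [if_neg fun h => ((Finset.mem_filter.1 hδ).2.2 g h).ne rfl]

/-- `m ∘ (id ⊗ S) ∘ Δ` vanishes on generators. -/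
theorem gen_add_famSum_antipodeGen (G : HGraph ρ) : gen G + famSum gen antipodeGen G = 0 := by
  suffices ∀ n, ∀ G : HGraph ρ, G.internal.card = n → gen G + famSum gen antipodeGen G = 0 from
    this _ G rfl
  intro n
  induction n using Nat.strong_induction_on with
  | _ n ih =>
    rintro G rfl
    -- The factor of a proper subgraph vanishes by induction.
    have hY : ∀ (g : Finset G.H), G.IsHighQuad g → g ≠ G.internal →
        ∑ δ ∈ Finset.univ.filter (fun δ => G.IsDisjFam δ ∧ ∀ f ∈ δ, f ⊆ g),
          (∏ f ∈ δ, minF G.bipedFree gen (reg f) ∅) *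
            (if g ∈ δ then 1 else minF G.bipedFree antipodeGen (reg g) δ) = 0 := by
      intro g hg hne
      rw [sum_fam_subset G.bipedFree hg]
      refine ih _ (lt_of_le_of_lt (card_internal_minor_le (h𝓕 := isDisjFam_empty _)
        (hR := by simp)) (Finset.card_lt_card (hg.ssubset hne))) _ rfl
    -- The recursion is inserted for `S(G/γ)`, the sums are exchanged, and the sum over `γ` is
    -- factored over `γ'`. A member of `γ'` that already belongs to `γ` carries no antipode, whence
    -- the value `1` in the conditional.
    have hswap : famSum gen antipodeGen G =
        -∑ γ' ∈ Finset.univ.filter (fun γ' => G.IsDisjFam γ' ∧ G.internal ∉ γ'),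
          (∏ g ∈ γ', ∑ δ ∈ Finset.univ.filter (fun δ => G.IsDisjFam δ ∧ ∀ f ∈ δ, f ⊆ g),
            (∏ f ∈ δ, minF G.bipedFree gen (reg f) ∅) *
              (if g ∈ δ then 1 else minF G.bipedFree antipodeGen (reg g) δ)) *
            minF G.bipedFree gen whole γ' := by
      calc famSum gen antipodeGen G
          = -∑ γ ∈ Finset.univ.filter (fun γ => G.IsDisjFam γ ∧ G.internal ∉ γ),
              ∑ γ' ∈ Finset.univ.filter (fun γ' =>
                (G.IsDisjFam γ' ∧ G.internal ∉ γ') ∧ ∀ f ∈ γ, ∃ g ∈ γ', f ⊆ g),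
              (∏ f ∈ γ, minF G.bipedFree gen (reg f) ∅) *
              ((∏ g ∈ γ' \ γ, minF G.bipedFree antipodeGen (reg g) (γ.filter fun f => f ⊆ g)) *
                minF G.bipedFree gen whole γ') := by
            rw [famSum_eq_sum_filter invariant_antipodeGen, ← Finset.sum_neg_distrib]
            refine Finset.sum_congr rfl fun γ hγ => ?_
            obtain ⟨_, hγ, hn⟩ := Finset.mem_filter.1 hγ
            rw [minF_whole G _ hγ hn, antipodeGen_eq,
              famSum_quot G invariant_antipodeGen invariant_gen, mul_neg, Finset.mul_sum]
        _ = _ := by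
            rw [Finset.sum_comm' (t' := Finset.univ.filter
                (fun γ' => G.IsDisjFam γ' ∧ G.internal ∉ γ'))
              (s' := fun γ' => Finset.univ.filter
                (fun γ => G.IsDisjFam γ ∧ ∀ f ∈ γ, ∃ g ∈ γ', f ⊆ g))]
            · congr 1
              refine Finset.sum_congr rfl fun γ' hγ' => ?_
              obtain ⟨_, hγ', hn'⟩ := Finset.mem_filter.1 hγ'
              rw [prod_sum_parts hγ' (fun X => G.IsDisjFam X) (fun X hX => hX.1)
                (isDisjFam_parts hγ'), Finset.sum_mul]
              refine Finset.sum_congr rfl fun γ hγ => ?_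
              obtain ⟨_, hγ, hle⟩ := Finset.mem_filter.1 hγ
              rw [← mul_assoc, Finset.prod_mul_distrib, ← prod_parts hγ' hγ.1 hle]
              congr 2
              rw [← Finset.prod_subset (s₁ := γ' \ γ) (s₂ := γ') Finset.sdiff_subset]
              · refine Finset.prod_congr rfl fun g hg => ?_
                rw [if_neg fun h => (Finset.mem_sdiff.1 hg).2 (Finset.mem_filter.1 h).1]
              · intro g hg hg'
                have : g ∈ γ := by_contra fun h => hg' (Finset.mem_sdiff.2 ⟨hg, h⟩)
                have hmem : g ∈ γ.filter (fun f => f ⊆ g) :=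
                  Finset.mem_filter.2 ⟨this, Finset.Subset.rfl⟩
                rw [if_pos hmem]
            · intro γ γ'
              simp only [Finset.mem_filter, Finset.mem_univ, true_and]
              constructor
              · rintro ⟨⟨h1, _⟩, h2, h3⟩
                exact ⟨⟨h1, h3⟩, h2⟩
              · rintro ⟨⟨h1, h3⟩, h2⟩
                -- The condition that `γ` omits `G` is implied by the one on `γ'`: a member of `γ'`
                -- containing `G` would be `G`.
                refine ⟨⟨h1, fun hmem => ?_⟩, h2, h3⟩
                obtain ⟨g, hg, hle⟩ := h3 _ hmem
                exact h2.2 ((hle.antisymm (h2.1.1 g hg).onePI.sub.subset_internal) ▸ hg)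
    rw [hswap, Finset.sum_eq_single ∅]
    · rw [Finset.prod_empty, one_mul, minF_whole G gen (isDisjFam_empty _) (by simp),
        ← sub_eq_add_neg, sub_eq_zero]
      exact invariant_gen _ _ ⟨(Realization.ofIso (Iso.refl _)).iso
        (Realization.ofMinor (isDisjFam_empty _) (by simp) (whole_high _))⟩
    · intro γ' hγ' hne
      obtain ⟨_, hγ', hn'⟩ := Finset.mem_filter.1 hγ'
      obtain ⟨g, hg⟩ := Finset.nonempty_iff_ne_empty.2 hne
      rw [Finset.prod_eq_zero hg (hY g (hγ'.1 g hg) fun e => hn' (e ▸ hg)), zero_mul]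
    · intro h
      refine absurd ?_ h
      simp [isDisjFam_empty]

/-! ### Forests -/

theorem mem_tops {G : AGraph ρ} {F : Finset (Finset G.H)} {f : Finset G.H} :
    f ∈ tops F ↔ f ∈ F ∧ ∀ f' ∈ F, f ⊆ f' → f' = f := Finset.mem_filter

theorem exists_tops {G : AGraph ρ} {F : Finset (Finset G.H)} {f : Finset G.H} (hf : f ∈ F) :
    ∃ t ∈ tops F, f ⊆ t := by
  obtain ⟨t, ht, hmax⟩ := F.exists_le_maximal hf
  exact ⟨t, mem_tops.2 ⟨hmax.1, fun f' hf' h => (hmax.2 hf' h).antisymm h⟩, ht⟩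

/-- Both conditions on the right are local to the members of `γ`, so sums over forests with
prescribed maximal elements can be factored. -/
theorem tops_eq_iff {G : AGraph ρ} {γ F : Finset (Finset G.H)} (hγ : G.IsDisjFam γ) :
    tops F = γ ↔ (∀ x ∈ F, ∃ g ∈ γ, x ⊆ g) ∧ γ ⊆ F := by
  constructor
  · rintro rfl
    exact ⟨fun x hx => exists_tops hx, Finset.filter_subset _ _⟩
  · rintro ⟨hle, hsub⟩
    ext f
    rw [mem_tops]
    constructor
    · rintro ⟨hf, hmax⟩
      obtain ⟨g, hg, hfg⟩ := hle f hf
      exact hmax g (hsub hg) hfg ▸ hg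
    · intro hf
      refine ⟨hsub hf, fun f' hf' h => ?_⟩
      obtain ⟨g, hg, hfg⟩ := hle f' hf'
      have := hγ.eq_of_subset hf hg (h.trans hfg)
      exact (this ▸ hfg).antisymm h

/-- The product of the `-g / F` over the members `g` of the forest `F`. -/
def forestWeight {G : AGraph ρ} (hG : G.BipedFree) (F : Finset (Finset G.H)) : HAlg ρ :=
  ∏ g ∈ F, -minF hG gen (reg g) (below F g)

/-- The factor of `x` involves only the members of the forest inside `x`, and these stay in the same
part as `x`. -/
theorem forestWeight_parts {G : AGraph ρ} (hG : G.BipedFree) {γ F : Finset (Finset G.H)}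
    (hγ : G.IsDisjFam γ) (hF : G.IsForest F) (hle : ∀ x ∈ F, ∃ g ∈ γ, x ⊆ g) :
    forestWeight hG F = ∏ g ∈ γ, forestWeight hG (F.filter fun x => x ⊆ g) := by
  rw [forestWeight, prod_parts hγ hF.1 hle]
  refine Finset.prod_congr rfl fun g _ => Finset.prod_congr rfl fun x hx => ?_
  have : (F.filter fun f => f ⊂ x) = (F.filter fun x => x ⊆ g).filter fun f => f ⊂ x := by
    rw [Finset.filter_filter]
    refine Finset.filter_congr fun f _ => ⟨fun h => ⟨?_, h⟩, fun h => h.2⟩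
    exact h.subset.trans (Finset.mem_filter.1 hx).2
  rw [below, below, this]

/-- The antipode of `g`, as a sum over the forests of `G` inside `g` that contain `g`. -/
def HasForestSum {G : AGraph ρ} (hG : G.BipedFree) (g : Finset G.H) : Prop :=
  minF hG antipodeGen (reg g) ∅ =
    ∑ Y ∈ Finset.univ.filter (fun Y => G.IsForest Y ∧ ∀ y ∈ Y, y ⊆ g),
      if g ∈ Y then forestWeight hG Y else 0

/-- The formula for the members of `γ` is a hypothesis so that it can be supplied by the induction
in `hasForestSum`. A choice of forests in which some `g` in `γ` is missing contributes zero, so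
exactly the forests with maximal elements `γ` remain. -/
theorem sum_tops_eq_of {G : AGraph ρ} (hG : G.BipedFree) {γ : Finset (Finset G.H)}
    (hγ : G.IsDisjFam γ) (h : ∀ g ∈ γ, HasForestSum hG g) :
    ∑ F ∈ Finset.univ.filter (fun F => G.IsForest F ∧ tops F = γ), forestWeight hG F =
      ∏ g ∈ γ, minF hG antipodeGen (reg g) ∅ := by
  rw [Finset.prod_congr rfl h, prod_sum_parts hγ (fun X => G.IsForest X) (fun X hX => hX.1)
    (isForest_parts hγ)]
  have e : (Finset.univ.filter fun F => G.IsForest F ∧ tops F = γ) =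
      (Finset.univ.filter fun F => G.IsForest F ∧ ∀ x ∈ F, ∃ g ∈ γ, x ⊆ g).filter
        fun F => γ ⊆ F := by
    rw [Finset.filter_filter]
    refine Finset.filter_congr fun F _ => ?_
    rw [tops_eq_iff hγ, and_assoc]
  rw [e, Finset.sum_filter]
  refine Finset.sum_congr rfl fun F hF => ?_
  obtain ⟨_, hF, hle⟩ := Finset.mem_filter.1 hF
  split_ifs with hs
  · rw [forestWeight_parts hG hγ hF hle]
    refine Finset.prod_congr rfl fun g hg => ?_
    have hmem : g ∈ F.filter (fun x => x ⊆ g) :=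
      Finset.mem_filter.2 ⟨hs hg, Finset.Subset.rfl⟩
    rw [if_pos hmem]
  · obtain ⟨g, hg, hgF⟩ := Finset.not_subset.1 hs
    exact (Finset.prod_eq_zero hg (if_neg fun h => hgF (Finset.mem_filter.1 h).1)).symm

/-- With `g` above all of `F`, the maximal elements below `g` are those of `F`, and nothing changes
below the members of `F`. -/
theorem forestWeight_insert {G : AGraph ρ} (hG : G.BipedFree) {g : Finset G.H}
    {F : Finset (Finset G.H)} (hlt : ∀ f ∈ F, f ⊂ g) :
    forestWeight hG (insert g F) = -minF hG gen (reg g) (tops F) * forestWeight hG F := by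
  have hn : g ∉ F := fun h => (hlt g h).ne rfl
  rw [forestWeight, Finset.prod_insert hn, forestWeight]
  congr 1
  · rw [below, Finset.filter_insert, if_neg (fun h => h.ne rfl), Finset.filter_true_of_mem hlt]
  · refine Finset.prod_congr rfl fun x hx => ?_
    rw [below, below, Finset.filter_insert, if_neg fun h => (h.trans (hlt x hx)).ne rfl]

/-- Removing `g` from the forest and grouping the rest by maximal elements `δ` gives, by induction,
the product of the antipodes of the members of `δ`. The sum over `δ` is then the defining recursion
for the antipode of `g`. -/
theorem hasForestSum {G : AGraph ρ} (hG : G.BipedFree) {g : Finset G.H} (hg : G.IsHighQuad g) :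
    HasForestSum hG g := by
  induction g using Finset.strongInduction with
  | _ g ih =>
    rw [HasForestSum, minF_reg hG _ hg (isDisjFam_empty _) (by simp)]
    change antipodeGen (sub G hG g hg) = _
    rw [antipodeGen_eq, famSum_sub hG invariant_antipodeGen invariant_gen hg,
      ← Finset.sum_filter, ← Finset.sum_neg_distrib]
    have hbij : ∑ Y ∈ (Finset.univ.filter fun Y => G.IsForest Y ∧ ∀ y ∈ Y, y ⊆ g).filter
          (fun Y => g ∈ Y), forestWeight hG Y =
        ∑ F ∈ Finset.univ.filter (fun F => G.IsForest F ∧ ∀ f ∈ F, f ⊂ g),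
          forestWeight hG (insert g F) := by
      refine Finset.sum_bij' (fun Y _ => Y.erase g) (fun F _ => insert g F) ?_ ?_ ?_ ?_ ?_
      · intro Y hY
        simp only [Finset.mem_filter, Finset.mem_univ, true_and] at hY ⊢
        exact ⟨⟨fun x hx => hY.1.1.1 x (Finset.mem_of_mem_erase hx), fun x hx y hy =>
          hY.1.1.2 x (Finset.mem_of_mem_erase hx) y (Finset.mem_of_mem_erase hy)⟩, fun f hf =>
          Finset.ssubset_iff_subset_ne.2
            ⟨hY.1.2 f (Finset.mem_of_mem_erase hf), Finset.ne_of_mem_erase hf⟩⟩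
      · intro F hF
        simp only [Finset.mem_filter, Finset.mem_univ, true_and] at hF ⊢
        refine ⟨⟨⟨?_, ?_⟩, ?_⟩, Finset.mem_insert_self _ _⟩
        · intro x hx
          rcases Finset.mem_insert.1 hx with rfl | hx
          · exact hg
          · exact hF.1.1 x hx
        · intro x hx y hy
          rcases Finset.mem_insert.1 hx with rfl | hx' <;>
            rcases Finset.mem_insert.1 hy with rfl | hy'
          · exact Or.inl Finset.Subset.rfl
          · exact Or.inr (Or.inl (hF.2 y hy').subset)
          · exact Or.inl (hF.2 x hx').subset
          · exact hF.1.2 x hx' y hy'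
        · intro x hx
          rcases Finset.mem_insert.1 hx with rfl | hx
          · exact Finset.Subset.rfl
          · exact (hF.2 x hx).subset
      · intro Y hY
        exact Finset.insert_erase (Finset.mem_filter.1 hY).2
      · intro F hF
        exact Finset.erase_insert fun h => ((Finset.mem_filter.1 hF).2.2 g h).ne rfl
      · intro Y hY
        rw [Finset.insert_erase (Finset.mem_filter.1 hY).2]
    rw [hbij, ← Finset.sum_fiberwise_of_maps_to (g := tops)
      (s := Finset.univ.filter fun F => G.IsForest F ∧ ∀ f ∈ F, f ⊂ g)
      (t := Finset.univ.filter fun δ => G.IsDisjFam δ ∧ ∀ f ∈ δ, f ⊂ g)]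
    · refine Finset.sum_congr rfl fun δ hδ => ?_
      obtain ⟨_, hδ, hlt⟩ := Finset.mem_filter.1 hδ
      rw [← sum_tops_eq_of hG hδ fun f hf => ih f (hlt f hf) (hδ.1 f hf), mul_comm, ← neg_mul,
        Finset.mul_sum]
      have e : ((Finset.univ.filter fun F => G.IsForest F ∧ ∀ f ∈ F, f ⊂ g).filter
          fun F => tops F = δ) = Finset.univ.filter fun F => G.IsForest F ∧ tops F = δ := by
        rw [Finset.filter_filter]
        refine Finset.filter_congr fun F _ => ⟨fun h => ⟨h.1.1, h.2⟩, fun h => ⟨⟨h.1, ?_⟩, h.2⟩⟩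
        intro f hf
        obtain ⟨t, ht, hft⟩ := exists_tops hf
        exact lt_of_le_of_lt hft (hlt t (h.2 ▸ ht))
      rw [e]
      refine Finset.sum_congr rfl fun F hF => ?_
      obtain ⟨_, hF, rfl⟩ := Finset.mem_filter.1 hF
      refine (forestWeight_insert hG fun f hf => ?_).symm
      obtain ⟨t, ht, hft⟩ := exists_tops hf
      exact lt_of_le_of_lt hft (hlt t ht)
    · intro F hF
      obtain ⟨_, hF, hlt⟩ := Finset.mem_filter.1 hF
      exact Finset.mem_filter.2 ⟨Finset.mem_univ _, hF.tops, fun f hf =>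
        hlt f (mem_tops.1 hf).1⟩

/-- Forests grouped by their maximal elements. -/
theorem sum_tops_eq {G : AGraph ρ} (hG : G.BipedFree) {γ : Finset (Finset G.H)}
    (hγ : G.IsDisjFam γ) :
    ∑ F ∈ Finset.univ.filter (fun F => G.IsForest F ∧ tops F = γ), forestWeight hG F =
      ∏ g ∈ γ, minF hG antipodeGen (reg g) ∅ :=
  sum_tops_eq_of hG hγ fun g hg => hasForestSum hG (hγ.1 g hg)

theorem prod_subQuot_below {G : AGraph ρ} (hG : G.BipedFree) {B : Type*} [CommRing B]
    (Φ : HGraph ρ → B) {F : Finset (Finset G.H)} (hF : G.IsForest F) :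
    (∏ g : F, -Φ (subQuot G hG g (hF.1 g g.2) (below F g) (hF.below g)
      fun _ => ssubset_of_mem_below)) = ∏ g ∈ F, -minF hG Φ (reg g) (below F g) := by
  rw [← Finset.prod_coe_sort F]
  exact Finset.prod_congr rfl fun g _ => by
    rw [minF_reg hG Φ (hF.1 g g.2) (hF.below g) fun _ => ssubset_of_mem_below]

theorem internal_mem_tops {G : AGraph ρ} {F : Finset (Finset G.H)} (hF : G.IsForest F) :
    G.internal ∈ tops F ↔ G.internal ∈ F := by
  rw [mem_tops]
  exact ⟨fun h => h.1, fun h => ⟨h, fun f hf hle =>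
    ((hF.1 f hf).onePI.sub.subset_internal).antisymm hle⟩⟩

/-- The forest formula for the antipode. -/
theorem antipodeGen_eq_forestSum (G : HGraph ρ) : antipodeGen G = forestSum G := by
  have h1 : forestSum G =
      ∑ F ∈ Finset.univ.filter (fun F => G.IsForest F ∧ G.internal ∉ F),
        -minF G.bipedFree gen whole (tops F) * forestWeight G.bipedFree F := by
    rw [Finset.sum_subtype (p := fun F => G.IsForest F ∧ G.internal ∉ F) _ (by simp), forestSum]
    refine Finset.sum_congr rfl fun F _ => ?_
    rw [prod_subQuot_below G.bipedFree gen F.2.1, forestWeight,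
      minF_whole G gen F.2.1.tops fun h => F.2.2 ((internal_mem_tops F.2.1).1 h)]
  rw [h1, antipodeGen_eq, famSum_eq_sum_filter invariant_gen, ← Finset.sum_neg_distrib,
    ← Finset.sum_fiberwise_of_maps_to (g := tops)
      (s := Finset.univ.filter fun F => G.IsForest F ∧ G.internal ∉ F)
      (t := Finset.univ.filter fun δ => G.IsDisjFam δ ∧ G.internal ∉ δ)]
  · refine Finset.sum_congr rfl fun δ hδ => ?_
    obtain ⟨_, hδ, hn⟩ := Finset.mem_filter.1 hδ
    rw [← sum_tops_eq G.bipedFree hδ, mul_comm, ← neg_mul, Finset.mul_sum]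
    have e : ((Finset.univ.filter fun F => G.IsForest F ∧ G.internal ∉ F).filter
        fun F => tops F = δ) = Finset.univ.filter fun F => G.IsForest F ∧ tops F = δ := by
      rw [Finset.filter_filter]
      refine Finset.filter_congr fun F _ => ⟨fun h => ⟨h.1.1, h.2⟩, fun h => ⟨⟨h.1, ?_⟩, h.2⟩⟩
      rwa [← internal_mem_tops h.1, h.2]
    rw [e]
    refine Finset.sum_congr rfl fun F hF => ?_
    rw [(Finset.mem_filter.1 hF).2.2]
  · intro F hF
    obtain ⟨_, hF, hn⟩ := Finset.mem_filter.1 hF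
    exact Finset.mem_filter.2 ⟨Finset.mem_univ _, hF.tops, fun h => hn ((internal_mem_tops hF).1 h)⟩

/-- Sums over all forests of a graph, grouped by their maximal elements. -/
theorem sum_forest_smul {G : AGraph ρ} (hG : G.BipedFree) {D : Type*} [AddCommGroup D] [Module ℝ D]
    (χ : HAlg ρ →ₐ[ℝ] ℝ) (K : Finset (Finset G.H) → D) :
    ∑ F ∈ Finset.univ.filter G.IsForest, χ (forestWeight hG F) • K (tops F) =
      ∑ δ ∈ Finset.univ.filter G.IsDisjFam,
        (∏ g ∈ δ, χ (minF hG antipodeGen (reg g) ∅)) • K δ := by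
  rw [← Finset.sum_fiberwise_of_maps_to (g := tops) (t := Finset.univ.filter G.IsDisjFam)]
  · refine Finset.sum_congr rfl fun δ hδ => ?_
    rw [← map_prod, ← sum_tops_eq hG (Finset.mem_filter.1 hδ).2, map_sum, Finset.sum_smul,
      Finset.filter_filter]
    exact Finset.sum_congr rfl fun F hF => by rw [(Finset.mem_filter.1 hF).2.2]
  · intro F hF
    exact Finset.mem_filter.2 ⟨Finset.mem_univ _, (Finset.mem_filter.1 hF).2.tops⟩

open MeasureTheory

/-! ### Propagators -/

/-- The range of the Schwinger parameter of the `i`-th slice. -/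
def slice (M : ℝ) (i : ℕ) : Set ℝ :=
  if i = 0 then Set.Ioi 1 else Set.Ioc (M ^ (-2 * (i : ℤ))) (M ^ (-2 * ((i : ℤ) - 1)))

theorem measurableSet_slice (M : ℝ) (i : ℕ) : MeasurableSet (slice M i) := by
  unfold slice
  split_ifs
  · exact measurableSet_Ioi
  · exact measurableSet_Ioc

/-- A positive lower cutoff is all that the estimates use of a slice: it makes `1 / α ^ 2`
integrable, including on the unbounded slice. -/
theorem exists_slice_subset {M : ℝ} (hM : 1 < M) (i : ℕ) : ∃ a > 0, slice M i ⊆ Set.Ioi a := by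
  unfold slice
  split_ifs
  · exact ⟨1, one_pos, Set.Subset.rfl⟩
  · exact ⟨_, zpow_pos (by linarith) _, Set.Ioc_subset_Ioi_self⟩

theorem pos_of_mem_slice {M : ℝ} (hM : 1 < M) {i : ℕ} {α : ℝ} (h : α ∈ slice M i) : 0 < α := by
  obtain ⟨a, ha, hs⟩ := exists_slice_subset hM i
  exact lt_trans ha (hs h)

theorem integrableOn_slice {M : ℝ} (hM : 1 < M) (i : ℕ) :
    IntegrableOn (fun α : ℝ => 1 / α ^ 2) (slice M i) := by
  obtain ⟨a, ha, hs⟩ := exists_slice_subset hM i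
  refine ((integrableOn_Ioi_rpow_of_lt (a := -2) (by norm_num) ha).congr_fun (fun α hα => ?_)
    measurableSet_Ioi).mono_set hs
  have hα : 0 < α := lt_trans ha hα
  change α ^ (-2 : ℝ) = _
  rw [Real.rpow_neg hα.le, one_div]
  norm_num

/-- Completing the square: `m²α + r²/(4α) - mr = (2mα - r)²/(4α)`. The bound gives exponential decay
uniformly in `α`. -/
theorem schwinger_le {m : ℝ} {α : ℝ} (hα : 0 < α) (r : ℝ) :
    Real.exp (-m ^ 2 * α - r ^ 2 / (4 * α)) / α ^ 2 ≤ Real.exp (-(m * r)) * (1 / α ^ 2) := by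
  rw [div_eq_mul_one_div]
  refine mul_le_mul_of_nonneg_right (Real.exp_le_exp.2 ?_) (by positivity)
  have h : -(m * r) - (-m ^ 2 * α - r ^ 2 / (4 * α)) = (2 * m * α - r) ^ 2 / (4 * α) := by
    field_simp
    ring
  have h2 : 0 ≤ (2 * m * α - r) ^ 2 / (4 * α) := by positivity
  linarith

theorem measurable_schwinger (m r : ℝ) :
    Measurable fun α : ℝ => Real.exp (-m ^ 2 * α - r ^ 2 / (4 * α)) / α ^ 2 := by
  fun_prop

theorem cov_eq (M m : ℝ) (i : ℕ) (x y : E4) : cov M m i x y =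
    ∫ α in slice M i, Real.exp (-m ^ 2 * α - ‖x - y‖ ^ 2 / (4 * α)) / α ^ 2 := rfl

theorem cov_nonneg (M m : ℝ) (i : ℕ) (x y : E4) : 0 ≤ cov M m i x y := by
  rw [cov_eq]
  exact integral_nonneg fun α => by positivity

theorem cov_comm (M m : ℝ) (i : ℕ) (x y : E4) : cov M m i x y = cov M m i y x := by
  rw [cov_eq, cov_eq, norm_sub_rev]

theorem cov_add (M m : ℝ) (i : ℕ) (x y a : E4) : cov M m i (x + a) (y + a) = cov M m i x y := by
  rw [cov_eq, cov_eq, add_sub_add_right_eq_sub]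

theorem cov_le {M m : ℝ} (hM : 1 < M) (i : ℕ) (x y : E4) :
    cov M m i x y ≤ Real.exp (-(m * ‖x - y‖)) * ∫ α in slice M i, 1 / α ^ 2 := by
  rw [cov_eq, ← integral_const_mul]
  have hint := (integrableOn_slice hM i).const_mul (Real.exp (-(m * ‖x - y‖)))
  have hle : ∀ᵐ α ∂volume.restrict (slice M i),
      Real.exp (-m ^ 2 * α - ‖x - y‖ ^ 2 / (4 * α)) / α ^ 2 ≤
        Real.exp (-(m * ‖x - y‖)) * (1 / α ^ 2) :=
    (ae_restrict_iff' (measurableSet_slice M i)).2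
      (Filter.Eventually.of_forall fun α hα => schwinger_le (pos_of_mem_slice hM hα) _)
  refine integral_mono_ae (hint.mono' (measurable_schwinger m _).aestronglyMeasurable ?_) hint hle
  filter_upwards [hle] with α hα
  rwa [Real.norm_of_nonneg (by positivity)]

theorem continuous_cov {M m : ℝ} (hM : 1 < M) (hm : 0 < m) (i : ℕ) {X : Type*}
    [TopologicalSpace X] [FirstCountableTopology X] {f g : X → E4} (hf : Continuous f)
    (hg : Continuous g) : Continuous fun p => cov M m i (f p) (g p) := by
  simp_rw [cov_eq]
  refine continuous_of_dominated (bound := fun α => 1 / α ^ 2)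
    (fun p => (measurable_schwinger m _).aestronglyMeasurable) (fun p => ?_)
    (integrableOn_slice hM i) (Filter.Eventually.of_forall fun α => by fun_prop)
  refine (ae_restrict_iff' (measurableSet_slice M i)).2 (Filter.Eventually.of_forall fun α hα => ?_)
  rw [Real.norm_of_nonneg (by positivity)]
  refine (schwinger_le (pos_of_mem_slice hM hα) _).trans ?_
  refine mul_le_of_le_one_left (by positivity) (Real.exp_le_one_iff.2 ?_)
  have := mul_nonneg hm.le (norm_nonneg (f p - g p))
  linarith

/-! ### Integrands -/

theorem AGraph.mem_edges {G : AGraph ρ} {e : Sym2 G.H} :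
    e ∈ G.edges ↔ ∃ h ∈ G.internal, s(h, G.σ h) = e := Finset.mem_image

/-- The propagator of an edge does not depend on its orientation. -/
theorem cov_out (M m : ℝ) {G : AGraph ρ} (h : G.H) (x : G.V → E4) :
    cov M m (G.scale (Quot.out s(h, G.σ h)).1) (x (G.vert (Quot.out s(h, G.σ h)).1))
        (x (G.vert (Quot.out s(h, G.σ h)).2)) =
      cov M m (G.scale h) (x (G.vert h)) (x (G.vert (G.σ h))) := by
  have hout : s((Quot.out s(h, G.σ h)).1, (Quot.out s(h, G.σ h)).2) = s(h, G.σ h) :=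
    Quot.out_eq s(h, G.σ h)
  rcases Sym2.eq_iff.1 hout with ⟨e1, e2⟩ | ⟨e1, e2⟩
  · rw [e1, e2]
  · rw [e1, e2, G.scale_σ, cov_comm]

theorem integrand_nonneg (M m : ℝ) (G : AGraph ρ) (x : G.V → E4) : 0 ≤ integrand M m G x :=
  Finset.prod_nonneg fun _ _ => cov_nonneg _ _ _ _ _

theorem integrand_add (M m : ℝ) (G : AGraph ρ) (x : G.V → E4) (a : E4) :
    integrand M m G (fun v => x v + a) = integrand M m G x :=
  Finset.prod_congr rfl fun _ _ => cov_add _ _ _ _ _ _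

theorem continuous_integrand {M m : ℝ} (hM : 1 < M) (hm : 0 < m) (G : AGraph ρ) :
    Continuous (integrand M m G) := by
  unfold integrand
  refine continuous_finsetProd _ fun e _ => ?_
  exact continuous_cov hM hm _ (continuous_apply _) (continuous_apply _)

theorem integrand_iso (M m : ℝ) {G G' : AGraph ρ} (e : Iso G G') (x : G'.V → E4) :
    integrand M m G (fun v => x (e.eV v)) = integrand M m G' x := by
  refine Finset.prod_bij (fun s _ => Sym2.map e.eH s) ?_ ?_ ?_ ?_
  · intro s hs
    obtain ⟨h, hh, rfl⟩ := mem_edges.1 hs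
    refine mem_edges.2 ⟨e.eH h, (e.mem_internal h).2 hh, ?_⟩
    rw [Sym2.map_mk, e.σ_eH]
  · intro s _ t _ h
    exact Sym2.map.injective e.eH.injective h
  · intro s hs
    obtain ⟨h, hh, rfl⟩ := mem_edges.1 hs
    refine ⟨s(e.eH.symm h, G.σ (e.eH.symm h)),
      mem_edges.2 ⟨e.eH.symm h, (e.mem_internal _).1 (by simpa using hh), rfl⟩, ?_⟩
    rw [Sym2.map_mk, ← e.σ_eH, Equiv.apply_symm_apply]
  · intro s hs
    obtain ⟨h, hh, rfl⟩ := mem_edges.1 hs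
    refine (cov_out M m h fun v => x (e.eV v)).trans ?_
    rw [Sym2.map_mk, ← e.σ_eH, cov_out, e.scale_eH h hh, e.vert_eH, e.σ_eH, e.vert_eH]

/-! ### Decay of the integrand of a connected graph. -/

/-- The total length of the edges. -/
def edgeLength (G : AGraph ρ) (x : G.V → E4) : ℝ :=
  ∑ e ∈ G.edges, ‖x (G.vert (Quot.out e).1) - x (G.vert (Quot.out e).2)‖

theorem edgeLength_nonneg (G : AGraph ρ) (x : G.V → E4) : 0 ≤ edgeLength G x :=
  Finset.sum_nonneg fun _ _ => norm_nonneg _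

theorem norm_sub_le_edgeLength {G : AGraph ρ} {h : G.H} (hh : h ∈ G.internal) (x : G.V → E4) :
    ‖x (G.vert h) - x (G.vert (G.σ h))‖ ≤ edgeLength G x := by
  have h1 := Finset.single_le_sum
    (f := fun e => ‖x (G.vert (Quot.out e).1) - x (G.vert (Quot.out e).2)‖)
    (fun _ _ => norm_nonneg _) (mem_edges.2 ⟨h, hh, rfl⟩)
  have hout : s((Quot.out s(h, G.σ h)).1, (Quot.out s(h, G.σ h)).2) = s(h, G.σ h) :=
    Quot.out_eq s(h, G.σ h)
  refine le_trans (le_of_eq ?_) h1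
  rcases Sym2.eq_iff.1 hout with ⟨e1, e2⟩ | ⟨e1, e2⟩
  · simp only [e1, e2]
  · simp only [e1, e2, norm_sub_rev]

/-- Here `n` is the length of a path from `v` to `w`; each of its edges is at most the total length.
-/
theorem exists_norm_sub_le {G : AGraph ρ} {v w : G.V} (h : G.Joined G.internal v w) :
    ∃ n : ℕ, ∀ x : G.V → E4, ‖x v - x w‖ ≤ n * edgeLength G x := by
  induction h with
  | refl => exact ⟨0, fun x => by simp⟩
  | tail _ hs ih =>
    obtain ⟨n, hn⟩ := ih
    obtain ⟨h, hh, rfl, rfl⟩ := hs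
    refine ⟨n + 1, fun x => (norm_sub_le_norm_sub_add_norm_sub _ (x (G.vert h)) _).trans ?_⟩
    have := norm_sub_le_edgeLength hh x
    have := hn x
    push_cast
    linarith

theorem exists_sum_norm_sub_le {G : AGraph ρ} (hG : ∀ v w, G.Joined G.internal v w) :
    ∃ C > 0, ∀ (v : G.V) (x : G.V → E4), ∑ w, ‖x w - x v‖ ≤ C * edgeLength G x := by
  choose n hn using fun v w => exists_norm_sub_le (hG w v)
  -- The summand `1` keeps the constant positive, even for a graph with a single vertex, since it is
  -- divided by later.
  refine ⟨∑ v, ∑ w, (n v w : ℝ) + 1, by positivity, fun v x => ?_⟩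
  calc ∑ w, ‖x w - x v‖ ≤ ∑ w, (n v w : ℝ) * edgeLength G x :=
        Finset.sum_le_sum fun w _ => hn v w x
    _ = (∑ w, (n v w : ℝ)) * edgeLength G x := by rw [Finset.sum_mul]
    _ ≤ _ := by
      refine mul_le_mul_of_nonneg_right ?_ (edgeLength_nonneg G x)
      have := Finset.single_le_sum (f := fun v => ∑ w, (n v w : ℝ)) (fun _ _ => by positivity)
        (Finset.mem_univ v)
      linarith

theorem exists_integrand_le_exp {M m : ℝ} (hM : 1 < M) (G : AGraph ρ) :
    ∃ K ≥ 0, ∀ x, integrand M m G x ≤ K * Real.exp (-(m * edgeLength G x)) := by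
  refine ⟨∏ e ∈ G.edges, ∫ α in slice M (G.scale (Quot.out e).1), 1 / α ^ 2,
    Finset.prod_nonneg fun e _ => integral_nonneg fun α => by positivity, fun x => ?_⟩
  rw [edgeLength, Finset.mul_sum, ← Finset.sum_neg_distrib, Real.exp_sum,
    ← Finset.prod_mul_distrib]
  refine Finset.prod_le_prod (fun _ _ => cov_nonneg _ _ _ _ _) fun e _ => ?_
  rw [mul_comm]
  exact cov_le hM _ _ _

/-- An integrable weight on space-time. -/
def weight (u : E4) : ℝ := ((1 + ‖u‖) ^ 5)⁻¹

theorem weight_pos (u : E4) : 0 < weight u := by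
  unfold weight
  positivity

theorem weight_le_one (u : E4) : weight u ≤ 1 := by
  refine inv_le_one_of_one_le₀ (one_le_pow₀ ?_)
  linarith [norm_nonneg u]

theorem integrable_weight : Integrable weight := by
  -- The exponent 5 exceeds the dimension 4.
  have h := integrable_one_add_norm (E := E4) (μ := volume) (r := 5) (by simp; norm_num)
  refine h.congr (Filter.Eventually.of_forall fun u => ?_)
  have : 0 < 1 + ‖u‖ := by positivity
  change (1 + ‖u‖) ^ (-(5 : ℝ)) = ((1 + ‖u‖) ^ 5)⁻¹
  rw [Real.rpow_neg this.le]
  norm_num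

/-- Peetre's inequality `1 + |u| ≤ (1 + |u - b|)(1 + |b|)`. It turns decay relative to the point `b`
into decay relative to the origin. -/
theorem weight_sub_mul_le (u b : E4) : weight (u - b) * weight b ≤ weight u := by
  unfold weight
  rw [← mul_inv, ← mul_pow]
  refine inv_anti₀ (by positivity) (pow_le_pow_left₀ (by positivity) ?_ 5)
  have h1 := norm_add_le (u - b) b
  rw [sub_add_cancel] at h1
  nlinarith [norm_nonneg (u - b), norm_nonneg b]

theorem exists_exp_le_weight {c : ℝ} (hc : 0 < c) :
    ∃ B ≥ 0, ∀ u : E4, Real.exp (-(c * ‖u‖)) ≤ B * weight u := by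
  -- The constant comes from `1 + s ≤ max 1 (5/c) * (1 + cs/5) ≤ max 1 (5/c) * exp (cs/5)`, raised
  -- to the fifth power.
  refine ⟨(max 1 (5 / c)) ^ 5, by positivity, fun u => ?_⟩
  have h0 : 0 ≤ c * ‖u‖ / 5 := by positivity
  have h1 : 1 + ‖u‖ ≤ max 1 (5 / c) * (1 + c * ‖u‖ / 5) := by
    rw [mul_add, mul_one]
    refine add_le_add (le_max_left _ _) ?_
    calc ‖u‖ = 5 / c * (c * ‖u‖ / 5) := by field_simp
      _ ≤ _ := mul_le_mul_of_nonneg_right (le_max_right _ _) h0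
  have h2 : 1 + c * ‖u‖ / 5 ≤ Real.exp (c * ‖u‖ / 5) := by
    rw [add_comm]
    exact Real.add_one_le_exp _
  have h3 : (1 + ‖u‖) ^ 5 ≤ max 1 (5 / c) ^ 5 * Real.exp (c * ‖u‖) := by
    calc (1 + ‖u‖) ^ 5 ≤ (max 1 (5 / c) * Real.exp (c * ‖u‖ / 5)) ^ 5 :=
          pow_le_pow_left₀ (by positivity)
            (h1.trans (mul_le_mul_of_nonneg_left h2 (by positivity))) 5
      _ = _ := by
        rw [mul_pow, ← Real.exp_nat_mul]
        congr 2
        push_cast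
        ring
  rw [weight, ← div_eq_mul_inv, le_div_iff₀ (by positivity), Real.exp_neg,
    inv_mul_le_iff₀ (Real.exp_pos _), mul_comm (Real.exp _)]
  exact h3

/-- The integrand of a connected graph decays in the distances to any vertex. -/
theorem exists_integrand_le {M m : ℝ} (hM : 1 < M) (hm : 0 < m) {G : AGraph ρ}
    (hG : ∀ v w, G.Joined G.internal v w) :
    ∃ K ≥ 0, ∀ (v : G.V) x, integrand M m G x ≤ K * ∏ w, weight (x w - x v) := by
  obtain ⟨K, hK, hle⟩ := exists_integrand_le_exp (m := m) hM G
  obtain ⟨C, hC, hsum⟩ := exists_sum_norm_sub_le hG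
  -- Since the distances to `v` add up to at most `C` times the total edge length, each of them may
  -- be given the decay rate `m / C`.
  obtain ⟨B, hB, hexp⟩ := exists_exp_le_weight (c := m / C) (by positivity)
  refine ⟨K * ∏ _w : G.V, B, by positivity, fun v x => (hle x).trans ?_⟩
  rw [mul_assoc, ← Finset.prod_mul_distrib]
  refine mul_le_mul_of_nonneg_left ?_ hK
  calc Real.exp (-(m * edgeLength G x))
      ≤ Real.exp (∑ w, -(m / C * ‖x w - x v‖)) := by
        rw [Real.exp_le_exp, Finset.sum_neg_distrib, ← Finset.mul_sum, neg_le_neg_iff,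
          div_mul_eq_mul_div, div_le_iff₀ hC, mul_assoc, mul_comm (edgeLength G x)]
        exact mul_le_mul_of_nonneg_left (hsum v x) hm.le
    _ ≤ _ := by
        rw [Real.exp_sum]
        exact Finset.prod_le_prod (fun _ _ => (Real.exp_pos _).le) fun w _ => hexp _

/-! ### The numbers `τ A` -/

theorem continuous_place {V : Type} (v : V) (a : E4) : Continuous (place v a) := by
  refine continuous_pi fun w => ?_
  unfold place
  split_ifs
  · exact continuous_const
  · exact continuous_apply _

theorem place_self {V : Type} (v : V) (a : E4) (y : {w // w ≠ v} → E4) : place v a y v = a :=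
  dif_pos rfl

theorem place_of_ne {V : Type} {v w : V} (a : E4) (y : {w // w ≠ v} → E4) (hw : w ≠ v) :
    place v a y w = y ⟨w, hw⟩ := dif_neg hw

theorem tauConverges {M m : ℝ} (hM : 1 < M) (hm : 0 < m) {G : AGraph ρ}
    (hG : ∀ v w, G.Joined G.internal v w) (h : G.H) (a : E4) : TauConverges M m G h a := by
  obtain ⟨K, hK, hle⟩ := exists_integrand_le hM hm hG
  have hint : Integrable fun y : {w // w ≠ G.vert h} → E4 => ∏ w, weight (y w - a) :=
    Integrable.fintype_prod (f := fun _ u => weight (u - a))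
      fun _ => integrable_weight.comp_sub_right a
  refine (hint.const_mul K).mono'
    ((continuous_integrand hM hm G).comp (continuous_place _ a)).aestronglyMeasurable
    (Filter.Eventually.of_forall fun y => ?_)
  rw [Real.norm_of_nonneg (integrand_nonneg _ _ _ _)]
  refine (hle (G.vert h) _).trans (mul_le_mul_of_nonneg_left ?_ hK)
  rw [place_self, ← Fintype.prod_subtype_mul_prod_subtype (fun w => w ≠ G.vert h)]
  -- The weight of the fixed vertex is not integrated and is bounded by 1.
  refine (mul_le_of_le_one_right (Finset.prod_nonneg fun _ _ => (weight_pos _).le)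
    (Finset.prod_le_one (fun _ _ => (weight_pos _).le) fun _ _ => weight_le_one _)).trans
    (le_of_eq ?_)
  exact Finset.prod_congr rfl fun w _ => by rw [place_of_ne a y w.2]

/-- The integral over all positions but that of `v`. -/
def pinned {V : Type} [Fintype V] (f : (V → E4) → ℝ) (v : V) (a : E4) : ℝ :=
  ∫ y : {w // w ≠ v} → E4, f (place v a y)

theorem pinned_add {V : Type} [Fintype V] {f : (V → E4) → ℝ}
    (hf : ∀ x a, f (fun v => x v + a) = f x) (v : V) (a : E4) : pinned f v a = pinned f v 0 := by
  unfold pinned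
  rw [← integral_add_right_eq_self _ (fun _ => a)]
  congr 1
  ext y
  rw [← hf (place v 0 y) a]
  congr 1
  ext1 w
  unfold place
  split_ifs <;> simp

theorem pinned_equiv {V V' : Type} [Fintype V] [Fintype V'] (e : V ≃ V') (f : (V' → E4) → ℝ)
    (v : V) (a : E4) : pinned f (e v) a = pinned (fun x => f fun w => x (e.symm w)) v a := by
  unfold pinned
  let e' : {w // w ≠ v} ≃ {w // w ≠ e v} := e.subtypeEquiv fun w => by simp
  rw [← (volume_measurePreserving_piCongrLeft (fun _ : {w // w ≠ e v} => E4) e').integral_comp']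
  congr 1
  ext y
  congr 1
  ext1 w
  obtain ⟨w, rfl⟩ := e.surjective w
  rw [Equiv.symm_apply_apply]
  by_cases hw : w = v
  · rw [hw, place_self, place_self]
  · rw [place_of_ne _ _ hw, place_of_ne _ _ (e.injective.ne hw)]
    exact Equiv.piCongrLeft_apply_apply (fun _ : {w // w ≠ e v} => E4) e' y ⟨w, hw⟩

/-- Change of the origin from one of the points to another. -/
def shear {W : Type} (u : W) : (W → E4) →ₗ[ℝ] (W → E4) where
  toFun y w := if w = u then -y u else y w - y u
  map_add' y z := by
    ext1 w
    simp only [Pi.add_apply]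
    split_ifs <;> abel
  map_smul' c y := by
    ext1 w
    simp only [Pi.smul_apply, RingHom.id_apply]
    split_ifs
    · rw [smul_neg]
    · rw [smul_sub]

theorem shear_shear {W : Type} (u : W) (y : W → E4) : shear u (shear u y) = y := by
  ext1 w
  simp only [shear, LinearMap.coe_mk, AddHom.coe_mk, if_true]
  split_ifs with h
  · rw [h, neg_neg]
  · abel

/-- The change of origin is a linear involution, so its determinant is `1` or `-1` and it preserves
volume. -/
theorem integral_shear {W : Type} [Fintype W] (u : W) (f : (W → E4) → ℝ) :
    ∫ y, f (shear u y) = ∫ y, f y := by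
  have hdet : LinearMap.det (shear u) * LinearMap.det (shear u) = 1 := by
    rw [← LinearMap.det_comp, show (shear u).comp (shear u) = LinearMap.id from
      LinearMap.ext (shear_shear u), LinearMap.det_id]
  have habs : |(LinearMap.det (shear u))⁻¹| = 1 := by
    rcases mul_self_eq_one_iff.1 hdet with h | h <;> rw [h] <;> norm_num
  have hcont : Continuous (shear u) := LinearMap.continuous_of_finiteDimensional _
  have hmap : Measure.map (shear u) volume = volume := by
    rw [Measure.map_linearMap_addHaar_eq_smul_addHaar volume (left_ne_zero_of_mul_eq_one hdet),
      habs, ENNReal.ofReal_one, one_smul]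
  let e : (W → E4) ≃ᵐ (W → E4) :=
    { toFun := shear u
      invFun := shear u
      left_inv := shear_shear u
      right_inv := shear_shear u
      measurable_toFun := hcont.measurable
      measurable_invFun := hcont.measurable }
  exact MeasurePreserving.integral_comp' (f := e) ⟨hcont.measurable, hmap⟩ f

/-- Exchanging the names of `u` and `v` reduces to integrals over the same variables. After the
shear, `u` is at the origin and `v` at `-y u`; a translation by `y u` puts `v` back at the origin
and every other vertex `w` at `y w`. -/
theorem pinned_vertex {V : Type} [Fintype V] {f : (V → E4) → ℝ}
    (hf : ∀ x a, f (fun v => x v + a) = f x) (v u : V) : pinned f v 0 = pinned f u 0 := by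
  by_cases hne : u = v
  · rw [hne]
  have hsw := pinned_equiv (Equiv.swap v u) f v 0
  rw [Equiv.swap_apply_left] at hsw
  rw [hsw]
  unfold pinned
  rw [← integral_shear ⟨u, hne⟩ fun y => f fun w => place v 0 y ((Equiv.swap v u).symm w)]
  congr 1
  ext y
  rw [← hf (fun w => place v 0 (shear ⟨u, hne⟩ y) ((Equiv.swap v u).symm w)) (y ⟨u, hne⟩)]
  congr 1
  ext1 w
  rw [Equiv.symm_swap]
  by_cases hv : w = v
  · rw [hv, Equiv.swap_apply_left, place_self, place_of_ne _ _ hne]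
    simp [shear]
  · by_cases hu : w = u
    · rw [hu, Equiv.swap_apply_right, place_self, place_of_ne _ _ hne, zero_add]
    · rw [Equiv.swap_apply_of_ne_of_ne hv hu, place_of_ne _ _ hv, place_of_ne _ _ hv]
      simp [shear, hu]

theorem tauAt_eq (M m : ℝ) (G : AGraph ρ) (h h' : G.H) (a a' : E4) :
    tauAt M m G h a = tauAt M m G h' a' := by
  change pinned (integrand M m G) _ a = pinned (integrand M m G) _ a'
  rw [pinned_add (integrand_add M m G), pinned_add (integrand_add M m G) _ a',
    pinned_vertex (integrand_add M m G)]

theorem tauAt_iso (M m : ℝ) {G G' : AGraph ρ} (e : Iso G G') (h : G.H) (a : E4) :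
    tauAt M m G' (e.eH h) a = tauAt M m G h a := by
  change pinned (integrand M m G') (G'.vert (e.eH h)) a = pinned (integrand M m G) _ a
  rw [e.vert_eH, pinned_equiv]
  congr 1
  ext x
  rw [← integrand_iso M m e]
  simp

theorem invariant_tau (M m : ℝ) : Invariant (tau M m : HGraph ρ → ℝ) := by
  rintro X Y ⟨e⟩
  rw [tau, tau, ← tauAt_iso M m e]
  exact tauAt_eq M m _ _ _ _ _

theorem tauA_gen (M m : ℝ) (G : HGraph ρ) : tauA M m ρ (gen G) = tau M m G := by
  rw [tauA, gen, MvPolynomial.aeval_X]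
  have h : (⟦G⟧ : Quotient (HGraph.setoid ρ)).out ≈ G := Quotient.mk_out G
  exact invariant_tau M m _ _ h

/-! ### Amplitudes -/

theorem KGraph.pos {n : ℕ} (G : KGraph ρ n) : 0 < n := by
  have h := G.bipedFree.external_nonempty
  obtain ⟨h, hh⟩ := h
  exact Fin.pos (G.label.symm ⟨h, by simpa [external] using hh⟩)

/-- The integrand controls all positions relative to the vertex `v` of one external edge, and the
test function controls the position of `v`. The bound is linear in a Schwartz seminorm, so it gives
both integrability and continuity of the functional. -/
theorem exists_amp_bound {M m : ℝ} (hM : 1 < M) (hm : 0 < m) {n : ℕ} (G : KGraph ρ n) :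
    ∃ (s : Finset (ℕ × ℕ)) (C : ℝ), 0 ≤ C ∧ ∀ (φ : 𝓢(Fin n → E4, ℝ)) (x : G.V → E4),
      ‖integrand M m G.toAGraph x * φ fun k => x (G.vert (G.label k).1)‖ ≤
        C * (s.sup (schwartzSeminormFamily ℝ (Fin n → E4) ℝ)) φ * ∏ w, weight (x w) := by
  obtain ⟨K, hK, hle⟩ := exists_integrand_le hM hm G.bipedFree.connected
  let k₀ : Fin n := ⟨0, G.pos⟩
  -- This order of decay yields one factor `weight (x v)` for each vertex, to be paired with `weight
  -- (x w - x v)`.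
  let N := 5 * Fintype.card G.V
  refine ⟨Finset.Iic (N, 0), K * 2 ^ N, by positivity, fun φ x => ?_⟩
  have hφ := SchwartzMap.one_add_le_sup_seminorm_apply (𝕜 := ℝ) (m := (N, 0)) (k := N) (n := 0)
    le_rfl le_rfl φ fun k => x (G.vert (G.label k).1)
  rw [norm_iteratedFDeriv_zero] at hφ
  set p := (Finset.sup (Finset.Iic (N, 0)) (schwartzSeminormFamily ℝ (Fin n → E4) ℝ)) φ with hp
  change _ ≤ 2 ^ N * p at hφ
  set v := G.vert (G.label k₀).1
  have h1 : (1 + ‖x v‖) ^ N ≤ (1 + ‖fun k => x (G.vert (G.label k).1)‖) ^ N := by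
    refine pow_le_pow_left₀ (by positivity) (add_le_add_right ?_ 1) N
    exact norm_le_pi_norm (fun k => x (G.vert (G.label k).1)) k₀
  have h2 : ‖φ fun k => x (G.vert (G.label k).1)‖ ≤ 2 ^ N * p * ∏ _w : G.V, weight (x v) := by
    have h3 : ∏ _w : G.V, weight (x v) = ((1 + ‖x v‖) ^ N)⁻¹ := by
      rw [Finset.prod_const, weight, inv_pow, ← pow_mul]
      rfl
    rw [h3, ← div_eq_mul_inv, le_div_iff₀ (by positivity), mul_comm]
    exact (mul_le_mul_of_nonneg_right h1 (norm_nonneg _)).trans hφ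
  have hp0 : 0 ≤ p := apply_nonneg _ φ
  rw [norm_mul, Real.norm_of_nonneg (integrand_nonneg _ _ _ _)]
  calc _ ≤ (K * ∏ w, weight (x w - x v)) * (2 ^ N * p * ∏ _w : G.V, weight (x v)) :=
        mul_le_mul (hle v x) h2 (norm_nonneg _)
          (mul_nonneg hK (Finset.prod_nonneg fun _ _ => (weight_pos _).le))
    _ = K * 2 ^ N * p * ∏ w, weight (x w - x v) * weight (x v) := by
        rw [Finset.prod_mul_distrib]
        ring
    _ ≤ _ := by
        refine mul_le_mul_of_nonneg_left (Finset.prod_le_prod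
          (fun w _ => (mul_pos (weight_pos _) (weight_pos _)).le)
          fun w _ => weight_sub_mul_le _ _) (by positivity)

theorem integrable_prod_weight (V : Type) [Fintype V] :
    Integrable fun x : V → E4 => ∏ w, weight (x w) :=
  Integrable.fintype_prod (f := fun _ => weight) fun _ => integrable_weight

theorem integrable_amp {M m : ℝ} (hM : 1 < M) (hm : 0 < m) {n : ℕ} (G : KGraph ρ n)
    (φ : 𝓢(Fin n → E4, ℝ)) : Integrable fun x : G.V → E4 =>
      integrand M m G.toAGraph x * φ fun k => x (G.vert (G.label k).1) := by
  obtain ⟨s, C, _, hC⟩ := exists_amp_bound hM hm G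
  refine ((integrable_prod_weight G.V).const_mul _).mono' (Continuous.aestronglyMeasurable ?_)
    (Filter.Eventually.of_forall fun x => hC φ x)
  exact (continuous_integrand hM hm G.toAGraph).mul
    (φ.continuous.comp (continuous_pi fun k => continuous_apply _))

theorem exists_amp_eq {M m : ℝ} (hM : 1 < M) (hm : 0 < m) {n : ℕ} (G : KGraph ρ n) :
    ∃ T : 𝓢(Fin n → E4, ℝ) →L[ℝ] ℝ, ∀ φ, amp M m G φ = T φ := by
  refine ⟨SchwartzMap.mkCLMtoNormedSpace (𝕜 := ℝ) (𝕜' := ℝ) (σ := RingHom.id ℝ) (amp M m G)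
    (fun φ ψ => ?_) (fun c φ => ?_) ?_, fun φ => rfl⟩
  · rw [amp, amp, amp, ← integral_add (integrable_amp hM hm G φ) (integrable_amp hM hm G ψ)]
    simp only [add_apply, mul_add]
  · rw [amp, amp, RingHom.id_apply, smul_eq_mul, ← integral_const_mul]
    simp only [smul_apply, smul_eq_mul, mul_left_comm]
  · obtain ⟨s, C, hC, hle⟩ := exists_amp_bound hM hm G
    have hI : 0 ≤ ∫ x : G.V → E4, ∏ w, weight (x w) :=
      integral_nonneg fun x => Finset.prod_nonneg fun _ _ => (weight_pos _).le
    refine ⟨s, C * ∫ x : G.V → E4, ∏ w, weight (x w), mul_nonneg hC hI, fun φ => ?_⟩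
    refine (norm_integral_le_of_norm_le ((integrable_prod_weight G.V).const_mul _)
      (Filter.Eventually.of_forall fun x => hle φ x)).trans (le_of_eq ?_)
    rw [integral_const_mul]
    ring

theorem amp_congr (M m : ℝ) {n : ℕ} {G G' : KGraph ρ n} (h : G ≈ G') : amp M m G = amp M m G' := by
  obtain ⟨e, he⟩ := h
  funext φ
  rw [amp, amp,
    ← (volume_measurePreserving_piCongrLeft (fun _ : G'.V => E4) e.eV).integral_comp']
  congr 1
  ext x
  have hx : ∀ v, MeasurableEquiv.piCongrLeft (fun _ : G'.V => E4) e.eV x (e.eV v) = x v :=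
    fun v => Equiv.piCongrLeft_apply_apply (fun _ : G'.V => E4) e.eV x v
  rw [← integrand_iso M m e]
  simp only [← he, e.vert_eH, hx]

theorem A_kgen (M m : ℝ) {n : ℕ} (G : KGraph ρ n) : A M m ρ (kgen G) = amp M m G := by
  rw [A, kgen, Finsupp.linearCombination_single, one_smul]
  exact amp_congr M m (Quotient.mk_out G)

/-! ### Characters and counterterms -/

theorem gen_out (c : Quotient (HGraph.setoid ρ)) : gen c.out = MvPolynomial.X c := by
  rw [gen, Quotient.out_eq]

/-- `m ∘ (α ⊗ β) ∘ Δ` on generators. -/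
theorem mul_map_Δ {B : Type*} [CommRing B] [Algebra ℝ B] (α β : HAlg ρ →ₐ[ℝ] B)
    (c : Quotient (HGraph.setoid ρ)) :
    Algebra.TensorProduct.lmul' ℝ (Algebra.TensorProduct.map α β (Δ ρ (MvPolynomial.X c))) =
      α (gen c.out) + famSum (fun X => α (gen X)) (fun X => β (gen X)) c.out := by
  rw [Δ, MvPolynomial.aeval_X]
  simp only [map_add, map_sum, Algebra.TensorProduct.map_tmul, Algebra.TensorProduct.lmul'_apply_tmul,
    map_one, mul_one, one_mul, map_prod, famSum, add_assoc]

theorem ε_X (c : Quotient (HGraph.setoid ρ)) : ε ρ (MvPolynomial.X c) = 0 := by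
  rw [ε, MvPolynomial.aeval_X]

theorem mul_S_id : ((Algebra.TensorProduct.lmul' ℝ).comp
    (Algebra.TensorProduct.map (S ρ) (AlgHom.id ℝ (HAlg ρ)))).comp (Δ ρ) =
      (Algebra.ofId ℝ (HAlg ρ)).comp (ε ρ) := by
  refine MvPolynomial.algHom_ext fun c => ?_
  rw [AlgHom.comp_apply, AlgHom.comp_apply, AlgHom.comp_apply, ε_X, map_zero, mul_map_Δ]
  simp only [S_gen, AlgHom.id_apply]
  rw [antipodeGen_eq]
  exact neg_add_cancel _

/-- Unlike `mul_S_id`, this is not the defining recursion; it rests on the exchange of sums in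
`gen_add_famSum_antipodeGen`. -/
theorem mul_id_S : ((Algebra.TensorProduct.lmul' ℝ).comp
    (Algebra.TensorProduct.map (AlgHom.id ℝ (HAlg ρ)) (S ρ))).comp (Δ ρ) =
      (Algebra.ofId ℝ (HAlg ρ)).comp (ε ρ) := by
  refine MvPolynomial.algHom_ext fun c => ?_
  rw [AlgHom.comp_apply, AlgHom.comp_apply, AlgHom.comp_apply, ε_X, map_zero, mul_map_Δ]
  simp only [S_gen, AlgHom.id_apply]
  exact gen_add_famSum_antipodeGen _

theorem map_famSum {B C : Type*} [CommRing B] [CommRing C] [Algebra ℝ B] [Algebra ℝ C]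
    (χ : B →ₐ[ℝ] C) (Φ Ψ : HGraph ρ → B) (N : HGraph ρ) :
    χ (famSum Φ Ψ N) = famSum (fun X => χ (Φ X)) (fun X => χ (Ψ X)) N := by
  simp only [famSum, map_add, map_sum, map_mul, map_prod]

theorem counterterm_eq (M m : ℝ) (G : HGraph ρ) :
    counterterm M m G = -famSum (counterterm M m) (tau M m) G := by
  rw [counterterm, famSum, neg_add, ← Finset.sum_neg_distrib]
  congr 1
  exact Finset.sum_congr rfl fun _ _ => by ring

theorem famSum_congr {B : Type*} [CommSemiring B] {Φ Φ' Ψ : HGraph ρ → B} {N : HGraph ρ}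
    (h : ∀ X : HGraph ρ, X.internal.card < N.internal.card → Φ X = Φ' X) :
    famSum Φ Ψ N = famSum Φ' Ψ N := by
  unfold famSum
  congr 1
  refine Finset.sum_congr rfl fun 𝓕 _ => ?_
  congr 1
  exact Finset.prod_congr rfl fun g _ => h _ (sub_card_lt N 𝓕 g)

/-- A function satisfying the recursion of the counterterms is the antipode followed by a
character. -/
theorem eq_map_antipodeGen {B : Type*} [CommRing B] [Algebra ℝ B] (χ : HAlg ρ →ₐ[ℝ] B)
    {Φ : HGraph ρ → B} (h : ∀ G, Φ G = -famSum Φ (fun X => χ (gen X)) G) (G : HGraph ρ) :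
    Φ G = χ (antipodeGen G) := by
  induction hn : G.internal.card using Nat.strong_induction_on generalizing G with
  | _ n ih =>
    subst hn
    rw [h, antipodeGen_eq, map_neg, map_famSum, famSum_congr fun X hX => ih _ hX X rfl]

theorem counterterm_eq_tauA (M m : ℝ) (G : HGraph ρ) :
    counterterm M m G = tauA M m ρ (antipodeGen G) := by
  refine eq_map_antipodeGen (tauA M m ρ) (fun G => ?_) G
  rw [counterterm_eq]
  simp only [tauA_gen]

theorem CU_eq (M m : ℝ) : CU M m ρ = (tauA M m ρ).comp (S ρ) := by
  refine MvPolynomial.algHom_ext fun c => ?_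
  rw [AlgHom.comp_apply, ← gen_out c, S_gen, ← counterterm_eq_tauA, gen_out, CU,
    MvPolynomial.aeval_X]

theorem CU_gen (M m : ℝ) (G : HGraph ρ) : CU M m ρ (gen G) = counterterm M m G := by
  rw [CU_eq, AlgHom.comp_apply, S_gen, counterterm_eq_tauA]

theorem conv_X (α β : HAlg ρ →ₐ[ℝ] ℝ) (c : Quotient (HGraph.setoid ρ)) :
    conv α β (MvPolynomial.X c) =
      α (gen c.out) + famSum (fun X => α (gen X)) (fun X => β (gen X)) c.out :=
  mul_map_Δ α β c

/-- Inverses for the convolution on the left are given by the antipode. -/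
theorem conv_eq_ε_iff (χ β : HAlg ρ →ₐ[ℝ] ℝ) : conv β χ = ε ρ ↔ β = χ.comp (S ρ) := by
  constructor
  · intro h
    have hrec : ∀ c : Quotient (HGraph.setoid ρ), β (gen c.out) =
        -famSum (fun X => β (gen X)) (fun X => χ (gen X)) c.out := fun c => by
      have := congrArg (fun f => f (MvPolynomial.X c)) h
      simp only [conv_X, ε_X] at this
      exact eq_neg_of_add_eq_zero_left this
    have hinv : ∀ δ : HAlg ρ →ₐ[ℝ] ℝ, Invariant fun X => δ (gen X) := fun δ X Y e =>
      congrArg δ (invariant_gen X Y e)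
    refine MvPolynomial.algHom_ext fun c => ?_
    rw [AlgHom.comp_apply, ← gen_out c, S_gen]
    refine eq_map_antipodeGen χ (Φ := fun X => β (gen X)) (fun G => ?_) c.out
    -- The convolution identity gives the recursion only at the chosen representatives, so it is
    -- transported to `G` by comparing both sums with sums over families of `G`.
    obtain ⟨e⟩ : (⟦G⟧ : Quotient (HGraph.setoid ρ)).out ≈ G := Quotient.mk_out G
    refine (hinv β G _ ⟨e.symm⟩).trans ((hrec _).trans ?_)
    rw [
      famSum_eq G.bipedFree (Realization.ofIso e) G.good (by simp) (fun X Y h _ => hinv β X Y h)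
        (hinv χ),
      famSum_eq G.bipedFree (Realization.ofIso (Iso.refl _)) G.good (by simp)
        (fun X Y h _ => hinv β X Y h) (hinv χ)]
  · rintro rfl
    refine MvPolynomial.algHom_ext fun c => ?_
    rw [conv_X, ε_X]
    simp only [AlgHom.comp_apply, S_gen]
    rw [antipodeGen_eq, map_neg, map_famSum]
    exact neg_add_cancel _

/-- If `Ψ` and `Ψ'` agree on all proper quotients, the two sums differ only in the empty family.
Equality of the sums then forces equality at `N`, which is the induction step for right inverses. -/
theorem famSum_congr_right {B : Type*} [CommSemiring B] {Φ Ψ Ψ' : HGraph ρ → B} {N : HGraph ρ}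
    (h : ∀ 𝓕 : ProperFam N.toAGraph, Ψ (N.quot 𝓕.1 𝓕.2.1 𝓕.2.2.2) = Ψ' (N.quot 𝓕.1 𝓕.2.1 𝓕.2.2.2)) :
    famSum Φ Ψ N + Ψ' N = famSum Φ Ψ' N + Ψ N := by
  unfold famSum
  rw [add_right_comm, add_right_comm (Ψ' N), add_comm (Ψ N)]
  congr 1
  exact Finset.sum_congr rfl fun 𝓕 _ => by rw [h 𝓕]

theorem AGraph.card_internal_minor_lt {G : AGraph ρ} {R : G.Region} {𝓕 : Finset (Finset G.H)}
    {h𝓕 : G.IsDisjFam 𝓕} {hR : ∀ f ∈ 𝓕, f ⊆ R.edges} (hne : 𝓕.Nonempty) :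
    (minor R 𝓕 h𝓕 hR).internal.card < R.edges.card := by
  obtain ⟨f, hf⟩ := hne
  obtain ⟨h, hh⟩ := (h𝓕.1 f hf).onePI.nonempty
  rw [← Finset.card_image_of_injective (minor R 𝓕 h𝓕 hR).internal
    (Subtype.val_injective : Function.Injective fun h : (minor R 𝓕 h𝓕 hR).H => h.1)]
  refine Finset.card_lt_card (Finset.ssubset_iff_subset_ne.2 ⟨fun x hx => ?_, fun e => ?_⟩)
  · obtain ⟨k, hk, rfl⟩ := Finset.mem_image.1 hx
    exact (mem_internal_minor k).1 hk
  · have := hR f hf hh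
    rw [← e] at this
    obtain ⟨k, _, rfl⟩ := Finset.mem_image.1 this
    exact k.2.2 f hf hh

theorem quot_card_lt (G : HGraph ρ) (𝓕 : ProperFam G.toAGraph) :
    (G.quot 𝓕.1 𝓕.2.1 𝓕.2.2.2).internal.card < G.internal.card :=
  card_internal_minor_lt (R := whole) (h𝓕 := 𝓕.2.1)
    (hR := fun _ hf => (𝓕.2.1.1 _ hf).onePI.sub.subset_internal) 𝓕.2.2.1

/-- Inverses for the convolution on the right are given by the antipode, too. -/
theorem conv_eq_ε_iff' (χ β : HAlg ρ →ₐ[ℝ] ℝ) : conv χ β = ε ρ ↔ β = χ.comp (S ρ) := by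
  have hS : conv χ (χ.comp (S ρ)) = ε ρ := by
    refine MvPolynomial.algHom_ext fun c => ?_
    rw [conv_X, ε_X]
    simp only [AlgHom.comp_apply, S_gen]
    rw [← map_famSum, ← map_add, gen_add_famSum_antipodeGen, map_zero]
  refine ⟨fun h => ?_, fun h => h ▸ hS⟩
  have key : ∀ G : HGraph ρ, β (gen G) = χ.comp (S ρ) (gen G) := by
    intro G
    induction hn : G.internal.card using Nat.strong_induction_on generalizing G with
    | _ n ih =>
      subst hn
      obtain ⟨e⟩ : (⟦G⟧ : Quotient (HGraph.setoid ρ)).out ≈ G := Quotient.mk_out G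
      have hG : gen (⟦G⟧ : Quotient (HGraph.setoid ρ)).out = gen G := gen_out _
      have h1 := congrArg (fun f => f (MvPolynomial.X ⟦G⟧)) (h.trans hS.symm)
      simp only [conv_X] at h1
      have h2 := famSum_congr_right (Φ := fun X => χ (gen X)) (Ψ := fun X => β (gen X))
        (Ψ' := fun X => χ.comp (S ρ) (gen X)) (N := (⟦G⟧ : Quotient (HGraph.setoid ρ)).out)
        fun 𝓕 => ih _ (e.card_internal ▸ quot_card_lt _ 𝓕) _ rfl
      rw [hG] at h2
      linarith
  refine MvPolynomial.algHom_ext fun c => ?_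
  rw [← gen_out c]
  exact key _

/-! ### Labelled graphs -/

/-- The value of `K` at a cograph of a labelled graph, extended by zero. -/
def quotF {n : ℕ} {D : Type*} [Zero D] (G : KGraph ρ n) (K : KGraph ρ n → D)
    (γ : Finset (Finset G.H)) : D :=
  if h : G.IsDisjFam γ then K (G.quot γ h) else 0

theorem quotF_eq {n : ℕ} {D : Type*} [Zero D] (G : KGraph ρ n) (K : KGraph ρ n → D)
    {γ : Finset (Finset G.H)} (h : G.IsDisjFam γ) : quotF G K γ = K (G.quot γ h) := dif_pos h

/-- The sum over all families of a labelled graph. -/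
def labelledSum {n : ℕ} {D : Type*} [AddCommGroup D] [Module ℝ D] (Φ : HGraph ρ → ℝ)
    (K : KGraph ρ n → D) (G : KGraph ρ n) : D :=
  ∑ δ ∈ Finset.univ.filter G.IsDisjFam,
    (∏ g ∈ δ, minF G.bipedFree Φ (reg g) ∅) • quotF G K δ

/-- The labelled counterpart of the invariance of `famSum`, here with `{G}` allowed as a family. It
is needed because the coaction is defined through chosen representatives. -/
theorem labelledSum_congr {n : ℕ} {D : Type*} [AddCommGroup D] [Module ℝ D] {Φ : HGraph ρ → ℝ}
    {K : KGraph ρ n → D} (hΦ : Invariant Φ) (hK : ∀ X Y, X ≈ Y → K X = K Y) {N G : KGraph ρ n}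
    (h : N ≈ G) : labelledSum Φ K N = labelledSum Φ K G := by
  obtain ⟨e, he⟩ := h
  let z := Realization.ofIso e
  have hfilter : (Finset.univ.filter (Extends (whole : G.Region) ∅)) =
      Finset.univ.filter G.IsDisjFam := Finset.filter_congr fun γ' _ =>
    ⟨fun h => h.fam, fun h => ⟨h, fun f hf => (h.1 f hf).onePI.sub.subset_internal, by simp⟩⟩
  rw [labelledSum, z.sum_families, hfilter, labelledSum]
  refine Finset.sum_congr rfl fun δ hδ => ?_
  have hext : Extends (whole : G.Region) ∅ δ := by
    rw [← hfilter] at hδ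
    exact (Finset.mem_filter.1 hδ).2
  have hd := z.isDisjFam_downFam hext
  rw [z.prod_downFam hext, Finset.sdiff_empty]
  congr 1
  · refine Finset.prod_congr rfl fun g hg => ?_
    have hc := z.compat_of_extends hext hg (by simp)
    rw [minF_reg N.bipedFree Φ hc.isHighQuad_down (isDisjFam_empty _) (by simp),
      minF_reg G.bipedFree Φ hc.quad (isDisjFam_empty _) (by simp)]
    refine hΦ _ _ ⟨(z.sub hc _ _ (by simp)).iso ?_⟩
    rw [Finset.filter_empty]
    exact Realization.ofMinor (isDisjFam_empty _) (by simp) (ofSub_high hc.quad)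
  · rw [quotF_eq N K hd, quotF_eq G K hext.fam]
    let z₁ := z.quot hext hd fun d h => (hd.1 d h).onePI.sub.subset_internal
    let z₂ := Realization.ofMinor hext.fam hext.le z.high
    -- The isomorphism of the quotients commutes with the embeddings of half-edges into `G`, where
    -- the labels agree by `he`.
    refine hK _ _ ⟨z₁.iso z₂, fun k => z₂.inj ?_⟩
    exact (z₁.j_equivH z₂ _).trans (he k)

theorem act_kgen {n : ℕ} {D : Type*} [AddCommGroup D] [Module ℝ D] (α : HAlg ρ →ₐ[ℝ] ℝ)
    (f : KSpace ρ n →ₗ[ℝ] D) (G : KGraph ρ n) :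
    act α f (kgen G) = labelledSum (fun X => α (gen X)) (fun X => f (kgen X)) G := by
  have hG : (⟦G⟧ : Quotient (KGraph.setoid ρ n)).out ≈ G := Quotient.mk_out G
  refine Eq.trans ?_ (labelledSum_congr (Φ := fun X => α (gen X)) (K := fun X => f (kgen X))
    (fun X Y e => congrArg α (invariant_gen X Y e))
    (fun X Y e => congrArg (fun c => f (Finsupp.single c 1)) (Quotient.sound e)) hG)
  simp only [act, LinearMap.comp_apply, coaction, kgen, Finsupp.linearCombination_single, one_smul,
    map_sum, TensorProduct.map_tmul, LinearEquiv.coe_coe, TensorProduct.lid_tmul,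
    AlgHom.toLinearMap_apply, map_prod]
  rw [labelledSum, Finset.sum_subtype (p := (⟦G⟧ : Quotient (KGraph.setoid ρ n)).out.IsDisjFam)
    _ (by simp)]
  refine Finset.sum_congr rfl fun 𝓕 _ => ?_
  rw [quotF_eq _ _ 𝓕.2, ← Finset.prod_coe_sort 𝓕.1]
  congr 1
  refine Finset.prod_congr rfl fun g _ => ?_
  rw [minF_reg _ (fun X => α (gen X)) (𝓕.2.1 g g.2) (isDisjFam_empty _) (by simp)]
  rfl

theorem map_minF {B C : Type*} [Zero B] [Zero C] {G : AGraph ρ} (hG : G.BipedFree)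
    {F : Type*} [FunLike F B C] [ZeroHomClass F B C] (χ : F) (Φ : HGraph ρ → B)
    (R : G.Region) (γ : Finset (Finset G.H)) :
    χ (minF hG Φ R γ) = minF hG (fun X => χ (Φ X)) R γ := by
  unfold minF
  split_ifs
  · rfl
  · exact map_zero χ

/-- The multiscale forest formula is the action of the counterterms. -/
theorem ampUR_eq (M m : ℝ) {n : ℕ} (G : KGraph ρ n) :
    ampUR M m G = act (CU M m ρ) (A M m ρ) (kgen G) := by
  rw [act_kgen, labelledSum]
  simp only [A_kgen, CU_gen, counterterm_eq_tauA, ← map_minF]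
  -- The counterterms are `τA` of antipodes by now, so the sum over families is the sum over forests
  -- grouped by their maximal elements.
  rw [← sum_forest_smul G.bipedFree (tauA M m ρ) (quotF G fun X => amp M m X), ampUR,
    Finset.sum_subtype (p := G.IsForest) _ (by simp)]
  refine Finset.sum_congr rfl fun F _ => ?_
  rw [quotF_eq G _ F.2.tops, prod_subQuot_below G.bipedFree (tau M m) F.2, forestWeight, map_prod]
  congr 1
  refine Finset.prod_congr rfl fun g _ => ?_
  rw [map_neg, map_minF]
  simp only [tauA_gen]

theorem AUR_eq (M m : ℝ) (n : ℕ) : AUR (n := n) M m ρ = act (CU M m ρ) (A M m ρ) := by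
  refine Finsupp.lhom_ext' fun c => LinearMap.ext_ring ?_
  have hc : kgen c.out = Finsupp.single c (1 : ℝ) := by rw [kgen, Quotient.out_eq]
  rw [LinearMap.comp_apply, LinearMap.comp_apply, Finsupp.lsingle_apply, ← hc, ← ampUR_eq, hc, AUR,
    Finsupp.linearCombination_single, one_smul]

end Multiscale
end

theorem mainTheorem9 (ρ : ℕ) (M m : ℝ) (hM : 1 < M) (hm : 0 < m) :
    -- `τA` is a well-defined character: the integrals converge, and neither the external edge that
    -- is kept, nor its position, nor the representative of the isomorphism class matters
    (∀ G : HGraph ρ, ∀ h ∈ G.external, ∀ a : E4,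
      TauConverges M m G.toAGraph h a ∧ tauAt M m G.toAGraph h a = tauA M m ρ (gen G)) ∧
    -- the amplitudes are tempered distributions and depend on isomorphism classes only
    (∀ (n : ℕ) (G : KGraph ρ n),
      (∀ φ : 𝓢(Fin n → E4, ℝ), MeasureTheory.Integrable fun x : G.V → E4 =>
        integrand M m G.toAGraph x * φ fun k => x (G.vert (G.label k).1)) ∧
      (∃ T : 𝓢(Fin n → E4, ℝ) →L[ℝ] ℝ, ∀ φ, amp M m G φ = T φ) ∧
      A M m ρ (kgen G) = amp M m G) ∧
    -- the recursion defining the counterterms holds for every graph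
    (∀ G : HGraph ρ, CU M m ρ (gen G) = counterterm M m G) ∧
    -- `S` is the antipode
    (((Algebra.TensorProduct.lmul' ℝ).comp
        (Algebra.TensorProduct.map (S ρ) (AlgHom.id ℝ (HAlg ρ)))).comp (Δ ρ) =
        (Algebra.ofId ℝ (HAlg ρ)).comp (ε ρ) ∧
      ((Algebra.TensorProduct.lmul' ℝ).comp
        (Algebra.TensorProduct.map (AlgHom.id ℝ (HAlg ρ)) (S ρ))).comp (Δ ρ) =
        (Algebra.ofId ℝ (HAlg ρ)).comp (ε ρ)) ∧
    -- the antipode is the sum over forests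
    (∀ G : HGraph ρ, S ρ (gen G) = forestSum G) ∧
    -- the counterterms are the convolution inverse of `τA`, and equal to `τA ∘ S`
    (∀ β : HAlg ρ →ₐ[ℝ] ℝ, conv β (tauA M m ρ) = ε ρ ↔ β = CU M m ρ) ∧
    (∀ β : HAlg ρ →ₐ[ℝ] ℝ, conv (tauA M m ρ) β = ε ρ ↔ β = CU M m ρ) ∧
    CU M m ρ = (tauA M m ρ).comp (S ρ) ∧
    -- the usefully renormalized amplitudes are `C_U · A`
    (∀ n : ℕ, AUR (n := n) M m ρ = act (CU M m ρ) (A M m ρ)) ∧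
    (∀ (n : ℕ) (G : KGraph ρ n), ampUR M m G = act (CU M m ρ) (A M m ρ) (kgen G)) := by
  refine ⟨fun G h hh a => ⟨tauConverges hM hm G.bipedFree.connected h a, ?_⟩,
    fun n G => ⟨integrable_amp hM hm G, exists_amp_eq hM hm G, A_kgen M m G⟩,
    CU_gen M m, ⟨mul_S_id, mul_id_S⟩, fun G => (S_gen G).trans (antipodeGen_eq_forestSum G),
    fun β => ?_, fun β => ?_, CU_eq M m, AUR_eq M m, fun n G => ampUR_eq M m G⟩
  · rw [tauA_gen]
    exact tauAt_eq M m _ _ _ _ _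
  · rw [CU_eq]
    exact conv_eq_ε_iff _ β
  · rw [CU_eq]
    exact conv_eq_ε_iff' _ β
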